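/- Let $n\ge 2$ and $m\ge 1$ be integers and $\alpha\in[0,1]$. Let $(M,g)$ be a complete connected smooth $n$-dimensional Riemannian manifold with bounded sectional curvature and positive injectivity radius. Let $(M_\infty,g_\infty)$ be a complete connected smooth $n$-dimensional manifold with a Riemannian metric of class $C^m$, let $p_j\in M$ $(j\in\mathbb N)$ and $p_\infty\in M_\infty$, and suppose that $(M,p_j)\to(M_\infty,p_\infty)$ in the pointed $C^{m,\alpha}$ topology. This means: for every $R>0$ there are an open set $\Omega_R\subseteq M_\infty$ with $B(p_\infty,R)\subseteq\Omega_R$, a number $\nu_R\in\mathbb N$, and $C^{m+1}$ embeddings $F_{j,R}:\Omega_R\to M$ for $j\ge\nu_R$, such that $B(p_j,R)\subseteq F_{j,R}(\Omega_R)$ for all $j\ge\nu_R$ and $F_{j,R}^*g\to g_\infty$ on $\Omega_R$ in the $C^{m,\alpha}$ topology as $j\to\infty$ (that is, in every chart of $M_\infty$ the coefficients of $F_{j,R}^*g-g_\infty$ tend to $0$ in $C^{m,\alpha}$ on compact subsets of the part of the chart lying in $\Omega_R$). For a Riemannian manifold $X$ of dimension $n$ and $0\le v<\mathrm{Vol}(X)$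 let $$I_X(v)=\inf\{\mathrm{Area}(\partial\Omega) : \Omega\subseteq X \text{ open, relatively compact, with smooth boundary},\ \mathrm{Vol}(\Omega)=v\}$$ be the isoperimetric profile of $X$ (so $I_X(0)=0$), where $\mathrm{Vol}$ and $\mathrm{Area}$ are the $n$- and $(n-1)$-dimensional Riemannian (Hausdorff) measures. Then $I_{M_\infty}\ge I_M$ pointwise; that is, $\mathrm{Vol}(M_\infty)\le\mathrm{Vol}(M)$, so that $I_M$ is defined wherever $I_{M_\infty}$ is, and $$I_{M_\infty}(v)\ge I_M(v)\qquad\text{for every } 0\le v<\mathrm{Vol}(M_\infty).$$ -/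

import Mathlib

open Set Filter Topology MeasureTheory Manifold Bundle
open scoped ContDiff ENNReal

noncomputable section

namespace RiemannianIso

/-! ### Riemannian metrics in coordinates -/

section Local

variable {n : ℕ} {M : Type*} [TopologicalSpace M] [ChartedSpace (EuclideanSpace ℝ (Fin n)) M]
  [RiemannianBundle (fun x : M => TangentSpace (𝓡 n) x)]

/-- The coefficient `(ψ^* g)_{ij}` at `y` of the pullback of the metric `g` of `M` under a map
`ψ` from `ℝⁿ` to `M`. If `ψ` is the inverse of a chart, these are the coefficients `g_{ij}` of the
metric in that chart. -/
def metricCoeff (ψ : EuclideanSpace ℝ (Fin n) → M) (i j : Fin n)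
    (y : EuclideanSpace ℝ (Fin n)) : ℝ :=
  inner ℝ (mfderiv (𝓡 n) (𝓡 n) ψ y (EuclideanSpace.single i (1 : ℝ)))
    (mfderiv (𝓡 n) (𝓡 n) ψ y (EuclideanSpace.single j (1 : ℝ)))

/-- The `i`-th partial derivative. -/
def partialDeriv (i : Fin n) (f : EuclideanSpace ℝ (Fin n) → ℝ)
    (y : EuclideanSpace ℝ (Fin n)) : ℝ :=
  fderiv ℝ f y (EuclideanSpace.single i (1 : ℝ))

/-- The Christoffel symbol `Γ^k_{ij} = ½ g^{kl} (∂_i g_{jl} + ∂_j g_{il} - ∂_l g_{ij})` at `y`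
in the local parametrization `ψ`. -/
def christoffel (ψ : EuclideanSpace ℝ (Fin n) → M) (k i j : Fin n)
    (y : EuclideanSpace ℝ (Fin n)) : ℝ :=
  (1 / 2) * ∑ l, (Matrix.of fun a b => metricCoeff ψ a b y)⁻¹ k l *
    (partialDeriv i (metricCoeff ψ j l) y + partialDeriv j (metricCoeff ψ i l) y
      - partialDeriv l (metricCoeff ψ i j) y)

/-- The component `R^l_{ijk}` of the curvature tensor at `y`, where
`R(∂_i, ∂_j) ∂_k = ∇_i ∇_j ∂_k - ∇_j ∇_i ∂_k = R^l_{ijk} ∂_l`. -/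
def curvatureCoeff (ψ : EuclideanSpace ℝ (Fin n) → M) (l i j k : Fin n)
    (y : EuclideanSpace ℝ (Fin n)) : ℝ :=
  partialDeriv i (christoffel ψ l j k) y - partialDeriv j (christoffel ψ l i k) y
    + ∑ s, (christoffel ψ s j k y * christoffel ψ l i s y
      - christoffel ψ s i k y * christoffel ψ l j s y)

variable (n)

/-- The components of a tangent vector at `x` in the preferred chart at `x`. -/
def chartComponents {x : M} (u : TangentSpace (𝓡 n) x) : EuclideanSpace ℝ (Fin n) :=
  mfderiv (𝓡 n) (𝓡 n) (chartAt (EuclideanSpace ℝ (Fin n)) x) x u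

/-- The sectional curvature `⟨R(u,v)v, u⟩ / (|u|² |v|² - ⟨u,v⟩²)` of the plane spanned by
linearly independent tangent vectors `u, v` at `x`. -/
def sectionalCurvature (x : M) (u v : TangentSpace (𝓡 n) x) : ℝ :=
  let φ := chartAt (EuclideanSpace ℝ (Fin n)) x
  let a := chartComponents n u
  let b := chartComponents n v
  (∑ i, ∑ j, ∑ k, ∑ l, ∑ s,
      curvatureCoeff φ.symm l i j k (φ x) * metricCoeff φ.symm l s (φ x)
        * a i * b j * b k * a s)
    / (‖u‖ ^ 2 * ‖v‖ ^ 2 - inner ℝ u v ^ 2)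

variable (M) in
/-- The sectional curvatures of `M` are bounded: `|K| ≤ Λ` for some `Λ`. -/
def BoundedSectionalCurvature : Prop :=
  ∃ Λ : ℝ, ∀ (x : M) (u v : TangentSpace (𝓡 n) x),
    LinearIndependent ℝ ![u, v] → |sectionalCurvature n x u v| ≤ Λ

/-! ### Geodesics, the exponential map and the injectivity radius -/

/-- `γ` is a (complete, affinely parametrized) geodesic: a smooth curve which at every time `t`
solves `γ''^k + Γ^k_{ij} γ'^i γ'^j = 0`, computed in the preferred chart at `γ t`. -/
def IsGeodesic (γ : ℝ → M) : Prop :=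
  ContMDiff 𝓘(ℝ, ℝ) (𝓡 n) ∞ γ ∧
    ∀ t : ℝ,
      let φ := chartAt (EuclideanSpace ℝ (Fin n)) (γ t)
      let c : ℝ → EuclideanSpace ℝ (Fin n) := fun s => φ (γ s)
      ∀ k : Fin n, deriv (deriv c) t k
        + ∑ i, ∑ j, christoffel φ.symm k i j (c t) * deriv c t i * deriv c t j = 0

/-- `γ` is a geodesic with `γ 0 = p` and `γ' 0 = v`. -/
def IsGeodesicFrom (p : M) (v : TangentSpace (𝓡 n) p) (γ : ℝ → M) : Prop :=
  IsGeodesic n γ ∧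
    (⟨γ 0, mfderiv 𝓘(ℝ, ℝ) (𝓡 n) γ 0 (1 : ℝ)⟩ : TangentBundle (𝓡 n) M) = ⟨p, v⟩

open Classical in
/-- The exponential map at `p`: the value at time `1` of the geodesic starting at `p` with velocity
`v`. In a complete smooth manifold such a geodesic exists and is unique. -/
def expMap (p : M) (v : TangentSpace (𝓡 n) p) : M :=
  if h : ∃ γ : ℝ → M, IsGeodesicFrom n p v γ then h.choose 1 else p

/-- `exp_p` is a diffeomorphism from the open ball of radius `r` about `0` in `T_p M` onto its
image: it is smooth, injective, and has injective (hence bijective) differential there. -/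
def ExpDiffeoOnBall (p : M) (r : ℝ≥0∞) : Prop :=
  ContMDiffOn 𝓘(ℝ, TangentSpace (𝓡 n) p) (𝓡 n) ∞ (expMap n p)
      {v : TangentSpace (𝓡 n) p | ‖v‖ₑ < r} ∧
    InjOn (expMap n p) {v : TangentSpace (𝓡 n) p | ‖v‖ₑ < r} ∧
    ∀ v : TangentSpace (𝓡 n) p, ‖v‖ₑ < r →
      Function.Injective (mfderiv 𝓘(ℝ, TangentSpace (𝓡 n) p) (𝓡 n) (expMap n p) v)

/-- The injectivity radius at `p`. -/
def injectivityRadiusAt (p : M) : ℝ≥0∞ := sSup {r : ℝ≥0∞ | ExpDiffeoOnBall n p r}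

variable (M) in
/-- The injectivity radius of `M`, the infimum over all points. -/
def injectivityRadius : ℝ≥0∞ := ⨅ p : M, injectivityRadiusAt n p

end Local

/-! ### Volume, area and the isoperimetric profile -/

section Profile

variable (n : ℕ) (M : Type*) [MetricSpace M] [ChartedSpace (EuclideanSpace ℝ (Fin n)) M]
  [MeasurableSpace M] [BorelSpace M]

variable {M} in
/-- The Riemannian volume of a subset of the `n`-dimensional Riemannian manifold `M`: its
`n`-dimensional Hausdorff measure for the Riemannian distance (normalized to be Lebesgue measure
on `ℝⁿ`). -/
def vol (A : Set M) : ℝ≥0∞ := μHE[n] A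

variable {M} in
/-- The area of a hypersurface of the `n`-dimensional Riemannian manifold `M`: its
`(n-1)`-dimensional Hausdorff measure for the Riemannian distance. -/
def area (S : Set M) : ℝ≥0∞ := μHE[n - 1] S

variable {M} in
/-- `Ω` is a relatively compact open set with smooth boundary: near every boundary point it is the
sublevel set `{f < 0}` of a smooth function with nonvanishing differential. -/
def IsSmoothDomain (Ω : Set M) : Prop :=
  IsOpen Ω ∧ IsCompact (closure Ω) ∧
    ∀ x ∈ frontier Ω, ∃ (U : Set M) (f : M → ℝ), IsOpen U ∧ x ∈ U ∧
      ContMDiffOn (𝓡 n) 𝓘(ℝ, ℝ) ∞ f U ∧ mfderiv (𝓡 n) 𝓘(ℝ, ℝ) f x ≠ 0 ∧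
      ∀ y ∈ U, y ∈ Ω ↔ f y < 0

/-- The isoperimetric profile: the infimum of the areas of the boundaries of the relatively
compact open sets with smooth boundary and volume `v`. It is meant for `0 ≤ v < Vol(M)`; at `v = 0`
the empty set is admissible, so its value there is `0`. -/
def isoperimetricProfile (v : ℝ≥0∞) : ℝ≥0∞ :=
  ⨅ (Ω : Set M) (_ : IsSmoothDomain n Ω) (_ : vol n Ω = v), area n (frontier Ω)

end Profile

/-! ### Pointed `C^{m,α}` convergence -/

section Convergence

/-- All derivatives of `f` of order at most `m` are bounded by `ε` on `K`, and those of order `m`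
have `α`-Hölder constant at most `ε` on `K`. -/
def HolderSmallOn {n : ℕ} (m : ℕ) (α ε : ℝ) (K : Set (EuclideanSpace ℝ (Fin n)))
    (f : EuclideanSpace ℝ (Fin n) → ℝ) : Prop :=
  (∀ k ≤ m, ∀ y ∈ K, ‖iteratedFDeriv ℝ k f y‖ ≤ ε) ∧
    ∀ y ∈ K, ∀ z ∈ K, ‖iteratedFDeriv ℝ m f y - iteratedFDeriv ℝ m f z‖ ≤ ε * ‖y - z‖ ^ α

variable {n : ℕ}
  {M : Type*} [MetricSpace M] [ChartedSpace (EuclideanSpace ℝ (Fin n)) M]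
  {N : Type*} [MetricSpace N] [ChartedSpace (EuclideanSpace ℝ (Fin n)) N]

variable (n) in
/-- `F` restricts to a `C^k` embedding of the open set `Ω` of `N` into `M`. -/
def IsEmbeddingOn (k : ℕ) (F : N → M) (Ω : Set N) : Prop :=
  ContMDiffOn (𝓡 n) (𝓡 n) k F Ω ∧ IsEmbedding (Ω.domRestrict F) ∧
    ∀ x ∈ Ω, Function.Injective (mfderiv (𝓡 n) (𝓡 n) F x)

variable [RiemannianBundle (fun x : M => TangentSpace (𝓡 n) x)]
  [RiemannianBundle (fun x : N => TangentSpace (𝓡 n) x)]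

variable (n) in
/-- `F_i^* g → g_N` on the open set `Ω` of `N` in the `C^{m,α}` topology: in every chart `φ` of `N`,
the coefficients of `F_i^* g` converge to those of `g_N`, in the `C^{m,α}` norm on compact subsets
of the part of the chart that lies in `Ω`. -/
def PullbackMetricsConvergeOn (m : ℕ) (α : ℝ) (F : ℕ → N → M) (Ω : Set N) : Prop :=
  ∀ φ ∈ IsManifold.maximalAtlas (𝓡 n) ∞ N, ∀ K : Set (EuclideanSpace ℝ (Fin n)),
    IsCompact K → K ⊆ φ.target → φ.symm '' K ⊆ Ω →
    ∀ (a b : Fin n) (ε : ℝ), 0 < ε → ∃ ν : ℕ, ∀ i ≥ ν,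
      HolderSmallOn m α ε K
        (fun y => metricCoeff (F i ∘ φ.symm) a b y - metricCoeff φ.symm a b y)

variable (n) in
/-- `(M, p_i) → (N, q)` in the pointed `C^{m,α}` topology. -/
def PointedConverges (m : ℕ) (α : ℝ) (p : ℕ → M) (q : N) : Prop :=
  ∀ R : ℝ, 0 < R → ∃ Ω : Set N, IsOpen Ω ∧ Metric.ball q R ⊆ Ω ∧
    ∃ (ν : ℕ) (F : ℕ → N → M),
      (∀ i ≥ ν, IsEmbeddingOn n (m + 1) (F i) Ω ∧ Metric.ball (p i) R ⊆ F i '' Ω) ∧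
      PullbackMetricsConvergeOn n m α F Ω

end Convergence

end RiemannianIso

end

/-!
The embeddings `F_j` that come with the convergence `(M, p_j) → (N, q)` are almost isometric on
compact sets, so a domain of `N` can be transplanted to `M` with almost the same volume and almost
the same boundary area; this is the uniform convergence of the coefficients of the pulled back
metrics (`PullbackMetricsConvergeOn.eventually_distortionLT`). Three points remain.

*Smoothness.* `F_j` is only a `C^{m+1}` map, and the image of a smooth domain need not have smooth
boundary. Being injective on a compact set and distorting lengths there by factors strictly between
`c⁻¹` and `c` are conditions that survive small `C^1` perturbations
(`eventually_injOn_of_tendstoC1At`, `isC1Stable_distortionLT`). So `F_j` can be smoothed, chart by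
chart, by mollification (`exists_smooth_of_isC1Stable`). The outcome is that for every compact
`K ⊆ N` and every `c > 1` there is a smooth embedding of a neighbourhood of `K` in `M` whose
differential changes lengths by factors between `c⁻¹` and `c`
(`PointedConverges.exists_isQuasiIsometryOn`).

*Measures.* Both distances are infima of lengths of paths, so a map whose differential is bounded by
`c` is locally `c`-Lipschitz (`exists_lipschitzOnWith_of_norm_mfderiv_le`) and multiplies
`d`-dimensional Hausdorff measure by at most `c ^ d`
(`euclideanHausdorffMeasure_image_le_of_norm_mfderiv_le`). Countable subadditivity turns the local
statement into a global one because a connected Riemannian manifold is second countable. The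
inequality of the total volumes follows by exhausting `N` by compact sets and letting `c → 1`.

*Exact volume.* The image `G(D)` of a domain `D` of volume `v` has a volume close to `v`, but in
general not equal to it. If `G(D)` is too large, a small coordinate ball is removed from `D` before
it is transplanted; if it is too small, a small coordinate ball is added outside the closure of `D`,
which is not all of `N` when `v < Vol(N)` (`IsSmoothDomain.eq_univ_of_dense`). The radius which
gives volume exactly `v` exists by the intermediate value theorem
(`IsQuasiIsometryOn.exists_euclideanHausdorffMeasure_image_closedBall_eq`). If the radii allowed are
bounded by a small constant, the area of the additional sphere is less than `ε`
(`tendsto_euclideanHausdorffMeasure_sphere`; this needs `n ≥ 2`), and that range of radii suffices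
once `c` is close to `1`. Hence the profile of `M` at `v` is at most `c ^ (n - 1) * (Area(∂D) + ε)`
(`IsSmoothDomain.eventually_isoperimetricProfile_le`), and it remains to let `c → 1` and `ε → 0`.
-/

noncomputable section

namespace RiemannianIso

open scoped NNReal

/-! ### Maps with bounded differential are locally Lipschitz -/

section Lipschitz

variable {n : ℕ}
  {X : Type*} [PseudoEMetricSpace X] [ChartedSpace (EuclideanSpace ℝ (Fin n)) X]
  [RiemannianBundle (fun x : X => TangentSpace (𝓡 n) x)] [IsRiemannianManifold (𝓡 n) X]
  {Y : Type*} [PseudoEMetricSpace Y] [ChartedSpace (EuclideanSpace ℝ (Fin n)) Y]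
  [RiemannianBundle (fun x : Y => TangentSpace (𝓡 n) x)] [IsRiemannianManifold (𝓡 n) Y]

/-- A `C^1` map whose differential has norm at most `c` is locally `c`-Lipschitz: short paths
between points near `x` stay in the domain, and their images are at most `c` times as long. -/
theorem exists_lipschitzOnWith_of_norm_mfderiv_le {F : X → Y} {U : Set X} (hU : IsOpen U)
    (hF : ContMDiffOn (𝓡 n) (𝓡 n) 1 F U) {c : ℝ≥0}
    (hc : ∀ x ∈ U, ∀ u : TangentSpace (𝓡 n) x, ‖mfderiv (𝓡 n) (𝓡 n) F x u‖ ≤ c * ‖u‖)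
    {x : X} (hx : x ∈ U) : ∃ V ∈ 𝓝 x, V ⊆ U ∧ LipschitzOnWith c F V := by
  obtain ⟨δ, hδ, hδU⟩ := EMetric.mem_nhds_iff.1 (hU.mem_nhds hx)
  obtain ⟨r, hr0, hrδ⟩ : ∃ r : ℝ≥0, 0 < r ∧ (r : ℝ≥0∞) + (r + r) < δ := by
    obtain ⟨d, hd0, hd⟩ := ENNReal.lt_iff_exists_nnreal_btwn.1 hδ
    refine ⟨d / 3, by simpa using hd0, ?_⟩
    have : (d / 3 : ℝ≥0) + (d / 3 + d / 3) = d := by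
      ext; push_cast; ring
    exact_mod_cast this ▸ hd
  refine ⟨Metric.eball x r, Metric.eball_mem_nhds x (by exact_mod_cast hr0), ?_, ?_⟩
  · refine (Metric.eball_subset_eball ?_).trans hδU
    exact le_self_add.trans hrδ.le
  intro y hy z hz
  have hyz : edist y z < r + r :=
    (edist_triangle_right y z x).trans_lt (ENNReal.add_lt_add hy hz)
  have key : ∀ b, edist y z < b → edist (F y) (F z) ≤ c * b := by
    intro b hb
    have hlt : riemannianEDist (𝓡 n) y z < min b (r + r) := by
      rw [← IsRiemannianManifold.out (I := 𝓡 n) y z]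
      exact lt_min hb hyz
    obtain ⟨γ, hγ0, hγ1, hγ, hlen⟩ := exists_lt_of_riemannianEDist_lt hlt
    have hmem : ∀ t ∈ Icc (0 : ℝ) 1, γ t ∈ U := by
      intro t ht
      apply hδU
      have h1 : edist y (γ t) ≤ pathELength (𝓡 n) γ 0 t := by
        rw [IsRiemannianManifold.out (I := 𝓡 n) y]
        exact riemannianEDist_le_pathELength (hγ.mono (Icc_subset_Icc_right ht.2)) hγ0 rfl ht.1
      have h2 : edist y (γ t) < r + r :=
        (h1.trans (pathELength_mono le_rfl ht.2)).trans_lt (hlen.trans_le (min_le_right _ _))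
      have h3 : edist (γ t) x ≤ edist y x + edist y (γ t) := by
        rw [edist_comm y (γ t), add_comm]
        exact edist_triangle _ _ _
      exact (h3.trans_lt (ENNReal.add_lt_add hy h2)).trans hrδ
    have hFγ : ContMDiffOn 𝓘(ℝ, ℝ) (𝓡 n) 1 (F ∘ γ) (Icc 0 1) := hF.comp hγ hmem
    calc edist (F y) (F z) ≤ pathELength (𝓡 n) (F ∘ γ) 0 1 := by
          rw [IsRiemannianManifold.out (I := 𝓡 n) (F y)]
          exact riemannianEDist_le_pathELength hFγ (by simp [hγ0]) (by simp [hγ1]) zero_le_one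
      _ ≤ c * pathELength (𝓡 n) γ 0 1 := by
          rw [pathELength_eq_lintegral_mfderivWithin_Icc,
            pathELength_eq_lintegral_mfderivWithin_Icc,
            ← lintegral_const_mul' _ _ ENNReal.coe_ne_top]
          refine setLIntegral_mono' measurableSet_Icc (fun t ht => ?_)
          have hcomp : mfderivWithin 𝓘(ℝ, ℝ) (𝓡 n) (F ∘ γ) (Icc 0 1) t
              = (mfderiv (𝓡 n) (𝓡 n) F (γ t)).comp (mfderivWithin 𝓘(ℝ, ℝ) (𝓡 n) γ (Icc 0 1) t) := by
            apply mfderiv_comp_mfderivWithin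
            · exact (hF.contMDiffAt (hU.mem_nhds (hmem t ht))).mdifferentiableAt one_ne_zero
            · exact hγ.mdifferentiableOn one_ne_zero t ht
            · rw [uniqueMDiffWithinAt_iff_uniqueDiffWithinAt]
              exact uniqueDiffOn_Icc zero_lt_one t ht
          rw [hcomp]
          have := hc (γ t) (hmem t ht) (mfderivWithin 𝓘(ℝ, ℝ) (𝓡 n) γ (Icc 0 1) t 1)
          rw [← ofReal_norm, ← ofReal_norm, ← ENNReal.ofReal_coe_nnreal,
            ← ENNReal.ofReal_mul c.coe_nonneg]
          exact ENNReal.ofReal_le_ofReal this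
      _ ≤ c * b := by gcongr; exact hlen.le.trans (min_le_left _ _)
  have hfin : edist y z ≠ ⊤ := (hyz.trans_le le_top).ne
  have hne : (𝓝[>] (edist y z)).NeBot := nhdsGT_neBot_of_exists_gt ⟨⊤, hfin.lt_top⟩
  refine ge_of_tendsto (x := 𝓝[>] (edist y z)) (f := fun b => (c : ℝ≥0∞) * b) ?_
    (eventually_nhdsWithin_of_forall key)
  exact ((ENNReal.continuous_const_mul ENNReal.coe_ne_top).tendsto _).mono_left nhdsWithin_le_nhds

end Lipschitz

/-! ### The metric in a chart -/

section ChartNorm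

variable {n : ℕ} {X : Type*} [TopologicalSpace X] [ChartedSpace (EuclideanSpace ℝ (Fin n)) X]

theorem mdifferentiable_of_mem_maximalAtlas
    {e : OpenPartialHomeomorph X (EuclideanSpace ℝ (Fin n))}
    (he : e ∈ IsManifold.maximalAtlas (𝓡 n) ∞ X) : e.MDifferentiable (𝓡 n) (𝓡 n) :=
  ⟨(contMDiffOn_of_mem_maximalAtlas he).mdifferentiableOn (by simp),
    (contMDiffOn_symm_of_mem_maximalAtlas he).mdifferentiableOn (by simp)⟩

theorem mfderiv_symm_mfderiv {e : OpenPartialHomeomorph X (EuclideanSpace ℝ (Fin n))}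
    (he : e ∈ IsManifold.maximalAtlas (𝓡 n) ∞ X) {x : X} (hx : x ∈ e.source)
    (u : TangentSpace (𝓡 n) x) :
    mfderiv (𝓡 n) (𝓡 n) e.symm (e x) (mfderiv (𝓡 n) (𝓡 n) e x u) = u :=
  congr($((mdifferentiable_of_mem_maximalAtlas he).symm_comp_deriv hx) u)

theorem mfderiv_mfderiv_symm {e : OpenPartialHomeomorph X (EuclideanSpace ℝ (Fin n))}
    (he : e ∈ IsManifold.maximalAtlas (𝓡 n) ∞ X) {x : X} (hx : x ∈ e.source)
    (w : EuclideanSpace ℝ (Fin n)) :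
    mfderiv (𝓡 n) (𝓡 n) e x (mfderiv (𝓡 n) (𝓡 n) e.symm (e x) w) = w := by
  have := congr($((mdifferentiable_of_mem_maximalAtlas he).comp_symm_deriv (e.map_source hx)) w)
  rw [e.left_inv hx] at this
  exact this

variable [RiemannianBundle (fun x : X => TangentSpace (𝓡 n) x)]

/-- The norm, for the Riemannian metric of `X`, of the tangent vector at `e.symm z` whose
components in the chart `e` are `w`. -/
def chartNorm (e : OpenPartialHomeomorph X (EuclideanSpace ℝ (Fin n)))
    (z w : EuclideanSpace ℝ (Fin n)) : ℝ :=
  ‖mfderiv (𝓡 n) (𝓡 n) e.symm z w‖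

theorem chartNorm_smul (e : OpenPartialHomeomorph X (EuclideanSpace ℝ (Fin n)))
    (z w : EuclideanSpace ℝ (Fin n)) (a : ℝ) : chartNorm e z (a • w) = |a| * chartNorm e z w := by
  have : mfderiv (𝓡 n) (𝓡 n) e.symm z (a • w) = a • mfderiv (𝓡 n) (𝓡 n) e.symm z w :=
    (mfderiv (𝓡 n) (𝓡 n) e.symm z).map_smul a w
  rw [chartNorm, this, norm_smul, Real.norm_eq_abs, chartNorm]

theorem chartNorm_pos {e : OpenPartialHomeomorph X (EuclideanSpace ℝ (Fin n))}
    (he : e ∈ IsManifold.maximalAtlas (𝓡 n) ∞ X) {z w : EuclideanSpace ℝ (Fin n)}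
    (hz : z ∈ e.target) (hw : w ≠ 0) : 0 < chartNorm e z w := by
  have hinj := (mdifferentiable_of_mem_maximalAtlas he).symm.mfderiv_injective
    (x := z) (by simpa using hz)
  refine norm_pos_iff.2 fun h => hw (hinj ?_)
  exact h.trans (map_zero _).symm

theorem norm_tangentSpace_congr {x y : X} (h : x = y) (v : EuclideanSpace ℝ (Fin n)) :
    ‖(show TangentSpace (𝓡 n) x from v)‖ = ‖(show TangentSpace (𝓡 n) y from v)‖ := by
  subst h; rfl

theorem chartNorm_mfderiv {e : OpenPartialHomeomorph X (EuclideanSpace ℝ (Fin n))}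
    (he : e ∈ IsManifold.maximalAtlas (𝓡 n) ∞ X) {x : X} (hx : x ∈ e.source)
    (u : TangentSpace (𝓡 n) x) :
    chartNorm e (e x) (mfderiv (𝓡 n) (𝓡 n) e x u) = ‖u‖ := by
  unfold chartNorm
  refine (norm_tangentSpace_congr (e.left_inv hx) _).trans ?_
  exact congrArg (fun v : TangentSpace (𝓡 n) x => ‖v‖) (mfderiv_symm_mfderiv he hx u)

theorem continuousOn_chartNorm [IsManifold (𝓡 n) ∞ X]
    [IsContinuousRiemannianBundle (EuclideanSpace ℝ (Fin n))
      (fun x : X => TangentSpace (𝓡 n) x)]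
    {e : OpenPartialHomeomorph X (EuclideanSpace ℝ (Fin n))}
    (he : e ∈ IsManifold.maximalAtlas (𝓡 n) ∞ X) :
    ContinuousOn (fun p : EuclideanSpace ℝ (Fin n) × EuclideanSpace ℝ (Fin n) =>
      chartNorm e p.1 p.2) (e.target ×ˢ univ) := by
  have h1 := (contMDiffOn_symm_of_mem_maximalAtlas he).continuousOn_tangentMapWithin
    (by simp) e.open_target.uniqueMDiffOn
  have h2 : Continuous (fun p : EuclideanSpace ℝ (Fin n) × EuclideanSpace ℝ (Fin n) =>
      (⟨p.1, p.2⟩ : TangentBundle (𝓡 n) (EuclideanSpace ℝ (Fin n)))) :=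
    (tangentBundleModelSpaceHomeomorph (𝓡 n)).symm.continuous
  have h3 : ContinuousOn (fun p : EuclideanSpace ℝ (Fin n) × EuclideanSpace ℝ (Fin n) =>
      (⟨e.symm p.1, mfderiv (𝓡 n) (𝓡 n) e.symm p.1 p.2⟩ : TangentBundle (𝓡 n) X))
      (e.target ×ˢ univ) := by
    refine (h1.comp h2.continuousOn fun p hp => hp.1).congr fun p hp => ?_
    simp only [Function.comp, tangentMapWithin]
    rw [mfderivWithin_of_isOpen e.open_target hp.1]
  have h4 := (h3.inner_bundle h3).sqrt
  refine h4.congr fun p hp => ?_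
  rw [chartNorm, norm_eq_sqrt_real_inner]

theorem tendsto_chartNorm [IsManifold (𝓡 n) ∞ X]
    [IsContinuousRiemannianBundle (EuclideanSpace ℝ (Fin n)) (fun x : X => TangentSpace (𝓡 n) x)]
    {e : OpenPartialHomeomorph X (EuclideanSpace ℝ (Fin n))}
    (he : e ∈ IsManifold.maximalAtlas (𝓡 n) ∞ X) {ι : Type*} {l : Filter ι}
    {f g : ι → EuclideanSpace ℝ (Fin n)}
    {z w : EuclideanSpace ℝ (Fin n)} (hz : z ∈ e.target) (hf : Tendsto f l (𝓝 z))
    (hg : Tendsto g l (𝓝 w)) :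
    Tendsto (fun i => chartNorm e (f i) (g i)) l (𝓝 (chartNorm e z w)) := by
  have hc : ContinuousAt
    (fun p : EuclideanSpace ℝ (Fin n) × EuclideanSpace ℝ (Fin n) => chartNorm e p.1 p.2) (z, w) :=
    (continuousOn_chartNorm he).continuousAt
      ((e.open_target.prod isOpen_univ).mem_nhds ⟨hz, mem_univ _⟩)
  have := hc.tendsto.comp (hf.prodMk_nhds hg)
  exact this

/-- In a chart, the norms given by the metric are locally uniformly equivalent to the Euclidean
norm. -/
theorem exists_chartNorm_bounds [IsManifold (𝓡 n) ∞ X]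
    [IsContinuousRiemannianBundle (EuclideanSpace ℝ (Fin n))
      (fun x : X => TangentSpace (𝓡 n) x)]
    {e : OpenPartialHomeomorph X (EuclideanSpace ℝ (Fin n))}
    (he : e ∈ IsManifold.maximalAtlas (𝓡 n) ∞ X) {K : Set (EuclideanSpace ℝ (Fin n))}
    (hK : IsCompact K) (hKe : K ⊆ e.target) :
    ∃ C : ℝ, 0 < C ∧ ∀ z ∈ K, ∀ w, chartNorm e z w ≤ C * ‖w‖ ∧ ‖w‖ ≤ C * chartNorm e z w := by
  have hS : IsCompact (K ×ˢ Metric.sphere (0 : EuclideanSpace ℝ (Fin n)) 1) :=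
    hK.prod (isCompact_sphere _ _)
  have hcont := (continuousOn_chartNorm he).mono
    (show K ×ˢ Metric.sphere (0 : EuclideanSpace ℝ (Fin n)) 1 ⊆ e.target ×ˢ univ from
      prod_mono hKe (subset_univ _))
  obtain ⟨A, hA⟩ := (hS.image_of_continuousOn hcont).bddAbove
  have hpos : ∀ p ∈ K ×ˢ Metric.sphere (0 : EuclideanSpace ℝ (Fin n)) 1,
      0 < chartNorm e p.1 p.2 := fun p hp =>
    chartNorm_pos he (hKe hp.1) (Metric.ne_of_mem_sphere hp.2 one_ne_zero)
  obtain ⟨B, hB0, hB⟩ : ∃ B : ℝ, 0 < B ∧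
      ∀ p ∈ K ×ˢ Metric.sphere (0 : EuclideanSpace ℝ (Fin n)) 1, 1 ≤ B * chartNorm e p.1 p.2 := by
    rcases (K ×ˢ Metric.sphere (0 : EuclideanSpace ℝ (Fin n)) 1).eq_empty_or_nonempty with h | h
    · exact ⟨1, one_pos, by simp [h]⟩
    obtain ⟨p, hp, hmin⟩ := hS.exists_isMinOn h hcont
    refine ⟨(chartNorm e p.1 p.2)⁻¹, inv_pos.2 (hpos p hp), fun q hq => ?_⟩
    rw [inv_mul_eq_div, one_le_div (hpos p hp)]
    exact hmin hq
  refine ⟨max 1 (max A B), lt_max_of_lt_left one_pos, fun z hz w => ?_⟩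
  rcases eq_or_ne w 0 with rfl | hw
  · have := chartNorm_smul e z 0 0; simp_all
  have hw' : 0 < ‖w‖ := norm_pos_iff.2 hw
  have hmem : (z, ‖w‖⁻¹ • w) ∈ K ×ˢ Metric.sphere (0 : EuclideanSpace ℝ (Fin n)) 1 :=
    ⟨hz, by simp [norm_smul, hw]⟩
  have hval : chartNorm e z w = ‖w‖ * chartNorm e z (‖w‖⁻¹ • w) := by
    rw [chartNorm_smul, abs_of_pos (inv_pos.2 hw'), mul_inv_cancel_left₀ hw'.ne']
  have h1 : chartNorm e z (‖w‖⁻¹ • w) ≤ max 1 (max A B) :=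
    (hA (mem_image_of_mem _ hmem)).trans ((le_max_left _ _).trans (le_max_right _ _))
  have h2 : 1 ≤ max 1 (max A B) * chartNorm e z (‖w‖⁻¹ • w) :=
    (hB _ hmem).trans (mul_le_mul_of_nonneg_right
      ((le_max_right _ _).trans (le_max_right _ _)) (hpos _ hmem).le)
  rw [hval]
  constructor <;> nlinarith

end ChartNorm

/-- The chain rule for the expression of a map in charts. -/
theorem fderiv_comp_charts {n : ℕ}
    {X : Type*} [TopologicalSpace X] [ChartedSpace (EuclideanSpace ℝ (Fin n)) X]
    {Y : Type*} [TopologicalSpace Y] [ChartedSpace (EuclideanSpace ℝ (Fin n)) Y]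
    {e : OpenPartialHomeomorph X (EuclideanSpace ℝ (Fin n))}
    (he : e ∈ IsManifold.maximalAtlas (𝓡 n) ∞ X)
    {e' : OpenPartialHomeomorph Y (EuclideanSpace ℝ (Fin n))}
    (he' : e' ∈ IsManifold.maximalAtlas (𝓡 n) ∞ Y) {F : X → Y} {x : X} (hx : x ∈ e.source)
    (hFx : F x ∈ e'.source) (hF : MDifferentiableAt (𝓡 n) (𝓡 n) F x)
    (u : TangentSpace (𝓡 n) x) :
    fderiv ℝ (e' ∘ F ∘ e.symm) (e x) (mfderiv (𝓡 n) (𝓡 n) e x u)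
      = mfderiv (𝓡 n) (𝓡 n) e' (F x) (mfderiv (𝓡 n) (𝓡 n) F x u) := by
  have h1 : HasMFDerivAt (𝓡 n) (𝓡 n) (F ∘ e.symm) (e x)
      ((mfderiv (𝓡 n) (𝓡 n) F (e.symm (e x))).comp (mfderiv (𝓡 n) (𝓡 n) e.symm (e x))) := by
    apply HasMFDerivAt.comp
    · rw [e.left_inv hx]; exact hF.hasMFDerivAt
    · exact ((mdifferentiable_of_mem_maximalAtlas he).mdifferentiableAt_symm
        (e.map_source hx)).hasMFDerivAt
  have h2 : HasMFDerivAt (𝓡 n) (𝓡 n) (e' ∘ F ∘ e.symm) (e x)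
      ((mfderiv (𝓡 n) (𝓡 n) e' (F (e.symm (e x)))).comp
        ((mfderiv (𝓡 n) (𝓡 n) F (e.symm (e x))).comp (mfderiv (𝓡 n) (𝓡 n) e.symm (e x)))) := by
    apply HasMFDerivAt.comp _ _ h1
    apply MDifferentiableAt.hasMFDerivAt
    apply (mdifferentiable_of_mem_maximalAtlas he').mdifferentiableAt
    simpa [e.left_inv hx] using hFx
  rw [← mfderiv_eq_fderiv, h2.mfderiv]
  have h4 := mfderiv_symm_mfderiv he hx u
  change mfderiv (𝓡 n) (𝓡 n) e' (F (e.symm (e x))) (mfderiv (𝓡 n) (𝓡 n) F (e.symm (e x))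
    (mfderiv (𝓡 n) (𝓡 n) e.symm (e x) (mfderiv (𝓡 n) (𝓡 n) e x u))) = _
  rw [h4, e.left_inv hx]

/-- The norm of the differential of a map in terms of its expression in charts. -/
theorem chartNorm_fderiv_comp {n : ℕ}
    {X : Type*} [TopologicalSpace X] [ChartedSpace (EuclideanSpace ℝ (Fin n)) X]
    {Y : Type*} [TopologicalSpace Y] [ChartedSpace (EuclideanSpace ℝ (Fin n)) Y]
    [RiemannianBundle (fun x : Y => TangentSpace (𝓡 n) x)]
    {e : OpenPartialHomeomorph X (EuclideanSpace ℝ (Fin n))}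
    (he : e ∈ IsManifold.maximalAtlas (𝓡 n) ∞ X)
    {e' : OpenPartialHomeomorph Y (EuclideanSpace ℝ (Fin n))}
    (he' : e' ∈ IsManifold.maximalAtlas (𝓡 n) ∞ Y) {F : X → Y} {x : X} (hx : x ∈ e.source)
    (hFx : F x ∈ e'.source) (hF : MDifferentiableAt (𝓡 n) (𝓡 n) F x)
    (u : TangentSpace (𝓡 n) x) :
    chartNorm e' (e' (F x)) (fderiv ℝ (e' ∘ F ∘ e.symm) (e x) (mfderiv (𝓡 n) (𝓡 n) e x u))
      = ‖mfderiv (𝓡 n) (𝓡 n) F x u‖ := by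
  rw [fderiv_comp_charts he he' hx hFx hF, chartNorm_mfderiv he' hFx]

/-! ### Connected manifolds are second countable -/

section SecondCountable

/-- A separable set `S` has a separable open enlargement containing every point whose distance to
`S` is small compared to the radius of some separable ball around it. -/
theorem exists_isSeparable_enlargement {X : Type*} [PseudoMetricSpace X] {S : Set X}
    (hS : TopologicalSpace.IsSeparable S) :
    ∃ T : Set X, IsOpen T ∧ TopologicalSpace.IsSeparable T ∧
      ∀ (y : X) (r : ℝ), 0 < r → TopologicalSpace.IsSeparable (Metric.ball y r) →
        ∀ a ∈ S, dist a y < r / 8 → y ∈ T := by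
  obtain ⟨C, hC, hSC⟩ := hS
  have : Countable C := hC
  refine ⟨⋃ (c : C) (q : {q : ℚ // TopologicalSpace.IsSeparable (Metric.ball (c : X) (q : ℝ))}),
    Metric.ball (c : X) (q : ℝ), ?_, ?_, ?_⟩
  · exact isOpen_iUnion fun c => isOpen_iUnion fun q => Metric.isOpen_ball
  · exact .iUnion fun c => .iUnion fun q => q.2
  · intro y r hr hsep a ha hay
    obtain ⟨c, hc, hac⟩ := Metric.mem_closure_iff.1 (hSC ha) (r / 8) (by positivity)
    obtain ⟨q, hq1, hq2⟩ := exists_rat_btwn (show r / 4 < r / 2 by linarith)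
    have hcy : dist c y < r / 4 := by
      have := dist_triangle c a y
      rw [dist_comm c a] at this
      linarith
    have hsub : Metric.ball c (q : ℝ) ⊆ Metric.ball y r :=
      Metric.ball_subset_ball' (by linarith)
    refine mem_iUnion.2 ⟨⟨c, hc⟩, mem_iUnion.2 ⟨⟨q, hsep.mono hsub⟩, ?_⟩⟩
    rw [Metric.mem_ball, dist_comm]
    exact hcy.trans hq1

/-- A connected locally separable metric space is second countable. -/
theorem secondCountableTopology_of_locally_isSeparable {X : Type*} [PseudoMetricSpace X]
    [PreconnectedSpace X]
    (h : ∀ x : X, ∃ r > 0, TopologicalSpace.IsSeparable (Metric.ball x r)) :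
    SecondCountableTopology X := by
  rcases isEmpty_or_nonempty X with hX | ⟨⟨x₀⟩⟩
  · infer_instance
  choose T hTo hTs hT using fun S : {S : Set X // TopologicalSpace.IsSeparable S} =>
    exists_isSeparable_enlargement S.2
  let A : ℕ → {S : Set X // TopologicalSpace.IsSeparable S} := fun k =>
    Nat.rec ⟨{x₀}, (Set.countable_singleton x₀).isSeparable⟩ (fun _ S => ⟨T S, hTs S⟩) k
  have hA : ∀ k, (A (k + 1)).1 = T (A k) := fun k => rfl
  have hstep : ∀ y ∈ closure (⋃ k, (A k).1), ∃ k, y ∈ T (A k) := by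
    intro y hy
    obtain ⟨r, hr, hsep⟩ := h y
    obtain ⟨a, ha, hay⟩ := Metric.mem_closure_iff.1 hy (r / 8) (by positivity)
    obtain ⟨k, hk⟩ := mem_iUnion.1 ha
    exact ⟨k, hT (A k) y r hr hsep a hk (by rwa [dist_comm])⟩
  have huniv : (⋃ k, (A k).1) = univ := by
    refine IsClopen.eq_univ ⟨?_, ?_⟩ ⟨x₀, mem_iUnion.2 ⟨0, rfl⟩⟩
    · refine isClosed_of_closure_subset fun y hy => ?_
      obtain ⟨k, hk⟩ := hstep y hy
      exact mem_iUnion.2 ⟨k + 1, hk⟩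
    · rw [isOpen_iff_mem_nhds]
      intro y hy
      obtain ⟨k, hk⟩ := hstep y (subset_closure hy)
      exact mem_of_superset ((hTo _).mem_nhds hk) (subset_iUnion (fun k => (A k).1) (k + 1))
  have hsep : TopologicalSpace.IsSeparable (univ : Set X) := huniv ▸ .iUnion fun k => (A k).2
  have : TopologicalSpace.SeparableSpace X := TopologicalSpace.isSeparable_univ_iff.1 hsep
  exact UniformSpace.secondCountable_of_separable X

variable (X : Type*) [MetricSpace X]

/-- A Riemannian manifold whose distance is finite is connected. -/
theorem preconnectedSpace_of_isRiemannianManifold (n : ℕ)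
    [ChartedSpace (EuclideanSpace ℝ (Fin n)) X]
    [RiemannianBundle (fun x : X => TangentSpace (𝓡 n) x)] [IsRiemannianManifold (𝓡 n) X] :
    PreconnectedSpace X := by
  refine ⟨isPreconnected_of_forall_pair fun x _ y _ => ?_⟩
  have hlt : riemannianEDist (𝓡 n) x y < ⊤ := by
    rw [← IsRiemannianManifold.out (I := 𝓡 n) x y]
    exact edist_lt_top x y
  obtain ⟨γ, hγ0, hγ1, hγ, -⟩ := exists_lt_of_riemannianEDist_lt hlt
  refine ⟨γ '' Icc 0 1, subset_univ _, ⟨0, by simp, hγ0⟩, ⟨1, by simp, hγ1⟩, ?_⟩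
  exact isPreconnected_Icc.image _ hγ.continuousOn

theorem secondCountableTopology_of_isRiemannianManifold (n : ℕ)
    [ChartedSpace (EuclideanSpace ℝ (Fin n)) X]
    [RiemannianBundle (fun x : X => TangentSpace (𝓡 n) x)] [IsRiemannianManifold (𝓡 n) X] :
    SecondCountableTopology X := by
  have := preconnectedSpace_of_isRiemannianManifold X n
  refine secondCountableTopology_of_locally_isSeparable fun x => ?_
  let e := chartAt (EuclideanSpace ℝ (Fin n)) x
  obtain ⟨r, hr, hsub⟩ := Metric.isOpen_iff.1 e.open_source x (mem_chart_source _ x)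
  refine ⟨r, hr, TopologicalSpace.IsSeparable.mono ?_ hsub⟩
  have h1 : TopologicalSpace.IsSeparable (e '' e.source) := .of_separableSpace _
  rw [e.image_source_eq_target] at h1
  rw [← e.symm_image_target_eq_source]
  exact e.continuousOn_symm.isSeparable_image h1

end SecondCountable

/-! ### Hausdorff measures of locally Lipschitz images -/

section Hausdorff

variable {X Y : Type*} [MetricSpace X] [MeasurableSpace X] [BorelSpace X]
  [MetricSpace Y] [MeasurableSpace Y] [BorelSpace Y]

theorem LipschitzOnWith.euclideanHausdorffMeasure_image_le {G : X → Y} {S : Set X} {c : ℝ≥0}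
    (h : LipschitzOnWith c G S) (d : ℕ) : μHE[d] (G '' S) ≤ (c : ℝ≥0∞) ^ d * μHE[d] S := by
  have := h.hausdorffMeasure_image_le (d := d) (by positivity)
  rw [Measure.euclideanHausdorffMeasure_def, Measure.euclideanHausdorffMeasure_def,
    Measure.smul_apply, Measure.smul_apply, ENNReal.smul_def, ENNReal.smul_def, smul_eq_mul,
    smul_eq_mul, mul_left_comm]
  rw [ENNReal.rpow_natCast] at this
  gcongr

theorem euclideanHausdorffMeasure_image_le_of_locally [SecondCountableTopology X]
    {G : X → Y} {S : Set X} {c : ℝ≥0}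
    (h : ∀ x ∈ S, ∃ V ∈ 𝓝 x, LipschitzOnWith c G (V ∩ S)) (d : ℕ) :
    μHE[d] (G '' S) ≤ (c : ℝ≥0∞) ^ d * μHE[d] S := by
  rcases S.eq_empty_or_nonempty with rfl | hne
  · simp
  choose! V hV hL using h
  obtain ⟨t, htS, htc, hcov⟩ := TopologicalSpace.countable_cover_nhdsWithin
    (f := fun x => interior (V x)) (s := S)
    fun x hx => mem_nhdsWithin_of_mem_nhds (interior_mem_nhds.2 (hV x hx))
  have htne : t.Nonempty := by
    obtain ⟨x, hx⟩ := hne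
    obtain ⟨i, hi, -⟩ := mem_iUnion₂.1 (hcov hx)
    exact ⟨i, hi⟩
  obtain ⟨f, rfl⟩ := htc.exists_eq_range htne
  let P : ℕ → Set X := disjointed fun i => interior (V (f i))
  have hPm : ∀ i, MeasurableSet (P i) :=
    MeasurableSet.disjointed fun i => isOpen_interior.measurableSet
  have hPU : ⋃ i, P i = ⋃ i, interior (V (f i)) := iUnion_disjointed
  have hS : S = ⋃ i, S ∩ P i := by
    rw [← inter_iUnion, hPU, eq_comm, inter_eq_left]
    simpa using hcov
  have hsum : ∑' i, μHE[d] (S ∩ P i) = μHE[d] S := by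
    have h1 := measure_iUnion (μ := (μHE[d] : Measure X).restrict S)
      (disjoint_disjointed fun i => interior (V (f i))) hPm
    rw [hPU, Measure.restrict_apply (isOpen_iUnion fun i => isOpen_interior).measurableSet,
      inter_eq_right.2 (by simpa using hcov)] at h1
    rw [h1]
    refine tsum_congr fun i => ?_
    rw [Measure.restrict_apply (hPm i), inter_comm]
  calc μHE[d] (G '' S) = μHE[d] (⋃ i, G '' (S ∩ P i)) := by rw [← image_iUnion, ← hS]
    _ ≤ ∑' i, μHE[d] (G '' (S ∩ P i)) := measure_iUnion_le _
    _ ≤ ∑' i, (c : ℝ≥0∞) ^ d * μHE[d] (S ∩ P i) := by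
        refine ENNReal.tsum_le_tsum fun i => ?_
        refine LipschitzOnWith.euclideanHausdorffMeasure_image_le
          ((hL (f i) (htS (mem_range_self i))).mono fun x hx => ⟨?_, hx.1⟩) d
        exact interior_subset (disjointed_subset _ i hx.2)
    _ = (c : ℝ≥0∞) ^ d * μHE[d] S := by rw [ENNReal.tsum_mul_left, hsum]

end Hausdorff

/-! ### Smooth approximation in `C^1` of compactly supported functions -/

section Mollify

open scoped Convolution

theorem dist_convolution_bump_le {E F : Type*} [NormedAddCommGroup E] [NormedSpace ℝ E]
    [FiniteDimensional ℝ E] [MeasurableSpace E] [BorelSpace E] [NormedAddCommGroup F]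
    [NormedSpace ℝ F] [CompleteSpace F] (μ : Measure E) [μ.IsAddHaarMeasure]
    {f : E → F} (hf : Continuous f) {ε δ : ℝ}
    (hδ : ∀ x y, dist x y < δ → dist (f x) (f y) ≤ ε) (φ : ContDiffBump (0 : E))
    (hφ : φ.rOut ≤ δ) (x : E) :
    dist ((φ.normed μ ⋆[ContinuousLinearMap.lsmul ℝ ℝ, μ] f) x) (f x) ≤ ε := by
  apply φ.dist_normed_convolution_le hf.aestronglyMeasurable
  intro y hy
  exact hδ _ _ (lt_of_lt_of_le hy hφ)

/-- A compactly supported `C^1` map is a uniform limit in `C^1` of smooth maps, its mollifications.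
-/
theorem exists_contDiff_norm_fderiv_sub_le {E F : Type*} [NormedAddCommGroup E]
    [NormedSpace ℝ E] [FiniteDimensional ℝ E] [NormedAddCommGroup F] [NormedSpace ℝ F]
    [CompleteSpace F] {f : E → F} (hf : ContDiff ℝ 1 f) (hc : HasCompactSupport f)
    {ε : ℝ} (hε : 0 < ε) :
    ∃ g : E → F, ContDiff ℝ ∞ g ∧ ∀ x, ‖g x - f x‖ ≤ ε ∧ ‖fderiv ℝ g x - fderiv ℝ f x‖ ≤ ε := by
  let _ : MeasurableSpace E := borel E
  have : BorelSpace E := ⟨rfl⟩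
  let μ : Measure E := Measure.addHaar
  have hdf : Continuous (fderiv ℝ f) := hf.continuous_fderiv one_ne_zero
  have hcdf : HasCompactSupport (fderiv ℝ f) := hc.fderiv (𝕜 := ℝ)
  obtain ⟨δ₁, hδ₁, h₁⟩ := Metric.uniformContinuous_iff.1
    (hc.uniformContinuous_of_continuous hf.continuous) ε hε
  obtain ⟨δ₂, hδ₂, h₂⟩ := Metric.uniformContinuous_iff.1
    (hcdf.uniformContinuous_of_continuous hdf) ε hε
  have hδ : 0 < min δ₁ δ₂ := lt_min hδ₁ hδ₂
  let φ : ContDiffBump (0 : E) := ⟨min δ₁ δ₂ / 2, min δ₁ δ₂, half_pos hδ, half_lt_self hδ⟩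
  have hφs : ContDiff ℝ ∞ (φ.normed μ) := φ.contDiff_normed
  have hfl : LocallyIntegrable f μ := hf.continuous.locallyIntegrable
  have hφl : LocallyIntegrable (φ.normed μ) μ := hφs.continuous.locallyIntegrable
  refine ⟨φ.normed μ ⋆[ContinuousLinearMap.lsmul ℝ ℝ, μ] f,
    φ.hasCompactSupport_normed.contDiff_convolution_left _ hφs hfl, fun x => ⟨?_, ?_⟩⟩
  · rw [← dist_eq_norm]
    exact dist_convolution_bump_le μ hf.continuous (fun x y h => (h₁ h).le) φ (min_le_left _ _) x
  · rw [(hc.hasFDerivAt_convolution_right (ContinuousLinearMap.lsmul ℝ ℝ) hφl hf x).fderiv]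
    have hconv : ((φ.normed μ) ⋆[(ContinuousLinearMap.lsmul ℝ ℝ : ℝ →L[ℝ] F →L[ℝ] F).precompR E, μ]
          fderiv ℝ f) x
        = ((φ.normed μ) ⋆[ContinuousLinearMap.lsmul ℝ ℝ, μ] fderiv ℝ f) x := by
      refine integral_congr_ae (Eventually.of_forall fun t => ?_)
      ext v
      simp
    rw [hconv, ← dist_eq_norm]
    exact dist_convolution_bump_le μ hdf (fun x y h => (h₂ h).le) φ (min_le_right _ _) x

end Mollify

/-! ### Convergence in `C^1` and the conditions stable under it -/

section C1Convergence

variable {n : ℕ}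
  {X : Type*} [TopologicalSpace X] [ChartedSpace (EuclideanSpace ℝ (Fin n)) X]
  {Y : Type*} [TopologicalSpace Y] [ChartedSpace (EuclideanSpace ℝ (Fin n)) Y]

variable (n) in
/-- The maps `G k` converge to `F` in `C^1`, locally uniformly near `x`: the `G k` are
differentiable near `x` for large `k`, and, in some charts around `x` and `F x`, their values and
differentials at `y` converge to those of `F` at `x` as `k → ∞` and `y → x` simultaneously. -/
def TendstoC1At (G : ℕ → X → Y) (F : X → Y) (x : X) : Prop :=
  (∀ᶠ p : ℕ × X in atTop ×ˢ 𝓝 x, MDifferentiableAt (𝓡 n) (𝓡 n) (G p.1) p.2) ∧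
  Tendsto (fun p : ℕ × X => G p.1 p.2) (atTop ×ˢ 𝓝 x) (𝓝 (F x)) ∧
  ∃ e ∈ IsManifold.maximalAtlas (𝓡 n) ∞ X, ∃ e' ∈ IsManifold.maximalAtlas (𝓡 n) ∞ Y,
    x ∈ e.source ∧ F x ∈ e'.source ∧
    Tendsto (fun p : ℕ × EuclideanSpace ℝ (Fin n) => fderiv ℝ (e' ∘ G p.1 ∘ e.symm) p.2)
      (atTop ×ˢ 𝓝 (e x)) (𝓝 (fderiv ℝ (e' ∘ F ∘ e.symm) (e x)))

variable (n) in
/-- `P` is an open condition on `C^1` maps on `Ω`, for locally uniform `C^1` convergence. -/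
def IsC1Stable (Ω : Set X) (P : (X → Y) → Prop) : Prop :=
  ∀ F : X → Y, ContMDiffOn (𝓡 n) (𝓡 n) 1 F Ω → P F →
    ∀ G : ℕ → X → Y, (∀ x ∈ Ω, TendstoC1At n G F x) → ∀ᶠ k in atTop, P (G k)

theorem IsC1Stable.and {Ω : Set X} {P Q : (X → Y) → Prop} (hP : IsC1Stable n Ω P)
    (hQ : IsC1Stable n Ω Q) : IsC1Stable n Ω fun F => P F ∧ Q F :=
  fun F hF h G hG => (hP F hF h.1 G hG).and (hQ F hF h.2 G hG)

theorem IsC1Stable.forall_finset {Ω : Set X} {ι : Type*} (t : Finset ι)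
    {P : ι → (X → Y) → Prop} (hP : ∀ i ∈ t, IsC1Stable n Ω (P i)) :
    IsC1Stable n Ω fun F => ∀ i ∈ t, P i F :=
  fun F hF h G hG => (eventually_all_finset t).2 fun i hi => hP i hi F hF (h i hi) G hG

theorem eventually_forall_mem_of_isCompact {ι Z : Type*} [TopologicalSpace Z] {l : Filter ι}
    {K : Set Z} (hK : IsCompact K) {P : ι → Z → Prop}
    (h : ∀ x ∈ K, ∀ᶠ p : ι × Z in l ×ˢ 𝓝 x, P p.1 p.2) : ∀ᶠ k in l, ∀ x ∈ K, P k x := by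
  have h1 : {p : ι × Z | P p.1 p.2} ∈ l ×ˢ 𝓝ˢ K := hK.mem_prod_nhdsSet_of_forall h
  obtain ⟨A, hA, B, hB, hAB⟩ := mem_prod_iff.1 h1
  filter_upwards [hA] with k hk x hx
  exact hAB (mk_mem_prod hk (subset_of_mem_nhdsSet hB hx))

theorem isC1Stable_mapsTo {Ω K : Set X} {O : Set Y} (hK : IsCompact K) (hKΩ : K ⊆ Ω)
    (hO : IsOpen O) : IsC1Stable n Ω fun F => MapsTo F K O := by
  intro F _ hFK G hG
  exact eventually_forall_mem_of_isCompact hK fun x hx =>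
    (hG x (hKΩ hx)).2.1.eventually (hO.mem_nhds (hFK hx))

section Distortion

variable [RiemannianBundle (fun x : X => TangentSpace (𝓡 n) x)]
  [RiemannianBundle (fun x : Y => TangentSpace (𝓡 n) x)]

variable (n) in
/-- The differential of `F` at `x` changes the lengths of vectors by a factor strictly between
`c⁻¹` and `c`. -/
def DistortionLT (c : ℝ) (F : X → Y) (x : X) : Prop :=
  ∀ u : TangentSpace (𝓡 n) x, u ≠ 0 →
    ‖mfderiv (𝓡 n) (𝓡 n) F x u‖ < c * ‖u‖ ∧ ‖u‖ < c * ‖mfderiv (𝓡 n) (𝓡 n) F x u‖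

theorem DistortionLT.injective {c : ℝ} {F : X → Y} {x : X} (h : DistortionLT n c F x) :
    Function.Injective (mfderiv (𝓡 n) (𝓡 n) F x) := by
  refine (injective_iff_map_eq_zero _).2 fun u hu => by_contra fun hne => ?_
  have := (h u hne).2
  rw [hu, norm_zero, mul_zero] at this
  exact this.not_ge (norm_nonneg _)

/-- The distortion bound in charts. -/
theorem distortionLT_iff_chartNorm
    {e : OpenPartialHomeomorph X (EuclideanSpace ℝ (Fin n))}
    (he : e ∈ IsManifold.maximalAtlas (𝓡 n) ∞ X)
    {e' : OpenPartialHomeomorph Y (EuclideanSpace ℝ (Fin n))}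
    (he' : e' ∈ IsManifold.maximalAtlas (𝓡 n) ∞ Y)
    {c : ℝ} {F : X → Y} {x : X} (hx : x ∈ e.source) (hFx : F x ∈ e'.source)
    (hF : MDifferentiableAt (𝓡 n) (𝓡 n) F x) :
    DistortionLT n c F x ↔ ∀ w ∈ Metric.sphere (0 : EuclideanSpace ℝ (Fin n)) 1,
      chartNorm e' (e' (F x)) (fderiv ℝ (e' ∘ F ∘ e.symm) (e x) w) < c * chartNorm e (e x) w ∧
      chartNorm e (e x) w
        < c * chartNorm e' (e' (F x)) (fderiv ℝ (e' ∘ F ∘ e.symm) (e x) w) := by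
  constructor
  · intro h w hw
    have hw0 : w ≠ 0 := Metric.ne_of_mem_sphere hw one_ne_zero
    have hu := mfderiv_mfderiv_symm he hx w
    have h1 := chartNorm_fderiv_comp he he' hx hFx hF (mfderiv (𝓡 n) (𝓡 n) e.symm (e x) w)
    have h2 := chartNorm_mfderiv he hx (mfderiv (𝓡 n) (𝓡 n) e.symm (e x) w)
    rw [hu] at h1 h2
    rw [h1, h2]
    refine h _ fun h0 => hw0 ?_
    rw [← hu, h0]
    exact map_zero _
  · intro h u hu
    rw [← chartNorm_fderiv_comp he he' hx hFx hF u, ← chartNorm_mfderiv he hx u]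
    have hinj := (mdifferentiable_of_mem_maximalAtlas he).mfderiv_injective hx
    obtain ⟨w, hw⟩ : ∃ w : EuclideanSpace ℝ (Fin n), w = mfderiv (𝓡 n) (𝓡 n) e x u := ⟨_, rfl⟩
    have hw0 : w ≠ 0 := fun h0 => hu (hinj ((hw.symm.trans h0).trans (map_zero _).symm))
    rw [← hw]
    have hpos : 0 < ‖w‖ := norm_pos_iff.2 hw0
    have hsph : ‖w‖⁻¹ • w ∈ Metric.sphere (0 : EuclideanSpace ℝ (Fin n)) 1 := by
      simp [norm_smul, hw0]
    have := h _ hsph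
    rw [map_smul, chartNorm_smul, chartNorm_smul, abs_of_pos (inv_pos.2 hpos), mul_left_comm,
      mul_left_comm c] at this
    exact ⟨lt_of_mul_lt_mul_left this.1 (inv_pos.2 hpos).le,
      lt_of_mul_lt_mul_left this.2 (inv_pos.2 hpos).le⟩

variable [IsManifold (𝓡 n) ∞ X] [IsManifold (𝓡 n) ∞ Y]
  [IsContinuousRiemannianBundle (EuclideanSpace ℝ (Fin n)) (fun x : X => TangentSpace (𝓡 n) x)]
  [IsContinuousRiemannianBundle (EuclideanSpace ℝ (Fin n)) (fun x : Y => TangentSpace (𝓡 n) x)]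

theorem TendstoC1At.eventually_distortionLT {c : ℝ} {G : ℕ → X → Y} {F : X → Y} {x : X}
    (hF : MDifferentiableAt (𝓡 n) (𝓡 n) F x) (h : TendstoC1At n G F x)
    (hd : DistortionLT n c F x) :
    ∀ᶠ p : ℕ × X in atTop ×ˢ 𝓝 x, DistortionLT n c (G p.1) p.2 := by
  obtain ⟨hdiff, h0, e, he, e', he', hx, hFx, h1⟩ := h
  rw [distortionLT_iff_chartNorm he he' hx hFx hF] at hd
  have hex : Tendsto (fun p : ℕ × X => (p.1, e p.2)) (atTop ×ˢ 𝓝 x) (atTop ×ˢ 𝓝 (e x)) :=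
    tendsto_id.prodMap (e.continuousAt hx)
  have hsrc : ∀ᶠ p : ℕ × X in atTop ×ˢ 𝓝 x, p.2 ∈ e.source :=
    tendsto_snd.eventually (e.open_source.mem_nhds hx)
  have hsrc' : ∀ᶠ p : ℕ × X in atTop ×ˢ 𝓝 x, G p.1 p.2 ∈ e'.source :=
    h0.eventually (e'.open_source.mem_nhds hFx)
  have key : ∀ᶠ p : ℕ × X in atTop ×ˢ 𝓝 x, ∀ w ∈ Metric.sphere (0 : EuclideanSpace ℝ (Fin n)) 1,
      chartNorm e' (e' (G p.1 p.2)) (fderiv ℝ (e' ∘ G p.1 ∘ e.symm) (e p.2) w)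
        < c * chartNorm e (e p.2) w ∧
      chartNorm e (e p.2) w
        < c * chartNorm e' (e' (G p.1 p.2)) (fderiv ℝ (e' ∘ G p.1 ∘ e.symm) (e p.2) w) := by
    refine eventually_forall_mem_of_isCompact (isCompact_sphere _ _) fun w hw => ?_
    have t1 := tendsto_chartNorm he (e.map_source hx)
      (((e.continuousAt hx).tendsto.comp tendsto_snd).comp
        (tendsto_fst (f := (atTop : Filter ℕ) ×ˢ 𝓝 x) (g := 𝓝 w))) tendsto_snd
    have t3 : Tendsto (fun q : (ℕ × X) × EuclideanSpace ℝ (Fin n) =>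
        fderiv ℝ (e' ∘ G q.1.1 ∘ e.symm) (e q.1.2))
        ((atTop ×ˢ 𝓝 x) ×ˢ 𝓝 w) (𝓝 (fderiv ℝ (e' ∘ F ∘ e.symm) (e x))) :=
      (h1.comp hex).comp tendsto_fst
    have t4 : Tendsto (fun q : (ℕ × X) × EuclideanSpace ℝ (Fin n) =>
        fderiv ℝ (e' ∘ G q.1.1 ∘ e.symm) (e q.1.2) q.2)
        ((atTop ×ˢ 𝓝 x) ×ˢ 𝓝 w) (𝓝 (fderiv ℝ (e' ∘ F ∘ e.symm) (e x) w)) :=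
      (isBoundedBilinearMap_apply.continuous.tendsto (fderiv ℝ (e' ∘ F ∘ e.symm) (e x), w)).comp
        (t3.prodMk_nhds tendsto_snd)
    have t2 := tendsto_chartNorm he' (e'.map_source hFx)
      (((e'.continuousAt hFx).tendsto.comp h0).comp
        (tendsto_fst (f := (atTop : Filter ℕ) ×ˢ 𝓝 x) (g := 𝓝 w)))
      t4
    exact (t2.eventually_lt (t1.const_mul c) (hd w hw).1).and
      (t1.eventually_lt (t2.const_mul c) (hd w hw).2)
  filter_upwards [hdiff, hsrc, hsrc', key] with p hp1 hp2 hp3 hp4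
  exact (distortionLT_iff_chartNorm he he' hp2 hp3 hp1).2 hp4

theorem isC1Stable_distortionLT {Ω K : Set X} (hΩ : IsOpen Ω) (hK : IsCompact K) (hKΩ : K ⊆ Ω)
    (c : ℝ) : IsC1Stable n Ω fun F : X → Y => ∀ x ∈ K, DistortionLT n c F x := by
  intro F hF hFK G hG
  exact eventually_forall_mem_of_isCompact hK fun x hx =>
    (hG x (hKΩ hx)).eventually_distortionLT
      ((hF.contMDiffAt (hΩ.mem_nhds (hKΩ hx))).mdifferentiableAt one_ne_zero) (hFK x hx)

end Distortion

section Injectivity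

/-- An injective linear map of a finite-dimensional space remains injective, uniformly on a convex
set, after perturbation: if the differential of `f` is close to `A`, then `f` is injective. -/
theorem exists_forall_injOn_of_norm_fderiv_sub_le {E : Type*} [NormedAddCommGroup E]
    [NormedSpace ℝ E] [FiniteDimensional ℝ E] {A : E →L[ℝ] E} (hA : Function.Injective A) :
    ∃ δ > 0, ∀ (f : E → E) (s : Set E), Convex ℝ s → (∀ z ∈ s, DifferentiableAt ℝ f z) →
      (∀ z ∈ s, ‖fderiv ℝ f z - A‖ ≤ δ) → InjOn f s := by
  obtain ⟨κ, hκ, hanti⟩ := (LinearMap.injective_iff_antilipschitz (A : E →ₗ[ℝ] E)).1 hA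
  have hκ' : (0 : ℝ) < κ := hκ
  refine ⟨(2 * (κ : ℝ))⁻¹, by positivity, fun f s hs hdiff hbound y hy z hz hyz => ?_⟩
  have h1 := hs.norm_image_sub_le_of_norm_fderiv_le' hdiff hbound hy hz
  have h2 := hanti.le_mul_dist z y
  rw [dist_eq_norm, dist_eq_norm] at h2
  have h3 : ‖A (z - y)‖ ≤ (2 * (κ : ℝ))⁻¹ * ‖z - y‖ := by
    rwa [hyz, sub_self, zero_sub, norm_neg] at h1
  have h4 : ‖z - y‖ ≤ κ * ((2 * (κ : ℝ))⁻¹ * ‖z - y‖) := by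
    refine h2.trans (mul_le_mul_of_nonneg_left ?_ hκ'.le)
    rw [← map_sub]
    exact h3
  have h5 : (κ : ℝ) * ((2 * (κ : ℝ))⁻¹ * ‖z - y‖) = ‖z - y‖ / 2 := by field_simp
  rw [h5] at h4
  have h6 : ‖z - y‖ = 0 := le_antisymm (by linarith) (norm_nonneg _)
  exact (sub_eq_zero.1 (norm_eq_zero.1 h6)).symm

theorem injective_fderiv_comp_charts {e : OpenPartialHomeomorph X (EuclideanSpace ℝ (Fin n))}
    (he : e ∈ IsManifold.maximalAtlas (𝓡 n) ∞ X)
    {e' : OpenPartialHomeomorph Y (EuclideanSpace ℝ (Fin n))}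
    (he' : e' ∈ IsManifold.maximalAtlas (𝓡 n) ∞ Y)
    {F : X → Y} {x : X} (hx : x ∈ e.source) (hFx : F x ∈ e'.source)
    (hF : MDifferentiableAt (𝓡 n) (𝓡 n) F x)
    (hinj : Function.Injective (mfderiv (𝓡 n) (𝓡 n) F x)) :
    Function.Injective (fderiv ℝ (e' ∘ F ∘ e.symm) (e x)) := by
  refine (injective_iff_map_eq_zero _).2 fun w hw => ?_
  have hu := mfderiv_mfderiv_symm he hx w
  have h1 := fderiv_comp_charts he he' hx hFx hF (mfderiv (𝓡 n) (𝓡 n) e.symm (e x) w)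
  rw [hu, hw] at h1
  have h2 := hinj ((mdifferentiable_of_mem_maximalAtlas he').mfderiv_injective hFx
    ((h1.symm.trans (map_zero _).symm).trans
      (congrArg (mfderiv (𝓡 n) (𝓡 n) e' (F x)) (map_zero (mfderiv (𝓡 n) (𝓡 n) F x)).symm)))
  rw [← hu, h2]
  exact map_zero _

/-- Where `F` is an immersion, maps `C^1`-close to it are injective on a common neighbourhood. -/
theorem TendstoC1At.eventually_injective {G : ℕ → X → Y} {F : X → Y} {x : X}
    (hF : MDifferentiableAt (𝓡 n) (𝓡 n) F x) (h : TendstoC1At n G F x)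
    (hinj : Function.Injective (mfderiv (𝓡 n) (𝓡 n) F x)) :
    ∀ᶠ p : ℕ × (X × X) in atTop ×ˢ 𝓝 (x, x), G p.1 p.2.1 = G p.1 p.2.2 → p.2.1 = p.2.2 := by
  obtain ⟨hdiff, h0, e, he, e', he', hx, hFx, h1⟩ := h
  obtain ⟨δ, hδ, hδinj⟩ := exists_forall_injOn_of_norm_fderiv_sub_le
    (injective_fderiv_comp_charts he he' hx hFx hF hinj)
  have hsymm : Tendsto (fun p : ℕ × EuclideanSpace ℝ (Fin n) => (p.1, e.symm p.2))
    (atTop ×ˢ 𝓝 (e x))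
      (atTop ×ˢ 𝓝 x) := by
    refine tendsto_id.prodMap ?_
    have := (e.continuousAt_symm (e.map_source hx)).tendsto
    rwa [e.left_inv hx] at this
  have hev : ∀ᶠ p : ℕ × EuclideanSpace ℝ (Fin n) in atTop ×ˢ 𝓝 (e x),
      ‖fderiv ℝ (e' ∘ G p.1 ∘ e.symm) p.2 - fderiv ℝ (e' ∘ F ∘ e.symm) (e x)‖ ≤ δ ∧
        DifferentiableAt ℝ (e' ∘ G p.1 ∘ e.symm) p.2 := by
    have ha : ∀ᶠ p : ℕ × EuclideanSpace ℝ (Fin n) in atTop ×ˢ 𝓝 (e x),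
        ‖fderiv ℝ (e' ∘ G p.1 ∘ e.symm) p.2 - fderiv ℝ (e' ∘ F ∘ e.symm) (e x)‖ ≤ δ := by
      filter_upwards [h1.eventually (Metric.ball_mem_nhds _ hδ)] with p hp
      rw [← dist_eq_norm]
      exact (Metric.mem_ball.1 hp).le
    have hb : ∀ᶠ p : ℕ × EuclideanSpace ℝ (Fin n) in atTop ×ˢ 𝓝 (e x), p.2 ∈ e.target :=
      tendsto_snd.eventually (e.open_target.mem_nhds (e.map_source hx))
    filter_upwards [ha, hb, hsymm.eventually hdiff,
      hsymm.eventually (h0.eventually (e'.open_source.mem_nhds hFx))] with p h1 h2 h3 h4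
    refine ⟨h1, ?_⟩
    rw [← mdifferentiableAt_iff_differentiableAt]
    have h5 := (mdifferentiable_of_mem_maximalAtlas he).mdifferentiableAt_symm h2
    have h6 := (mdifferentiable_of_mem_maximalAtlas he').mdifferentiableAt h4
    exact MDifferentiableAt.comp p.2 h6 (MDifferentiableAt.comp p.2 h3 h5)
  obtain ⟨A, hA, B, hB, hAB⟩ := mem_prod_iff.1 hev
  obtain ⟨r, hr, hrB⟩ := Metric.mem_nhds_iff.1 hB
  have hN : ∀ᶠ y in 𝓝 x, y ∈ e.source ∧ e y ∈ Metric.ball (e x) r :=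
    (e.open_source.eventually_mem hx).and
      ((e.continuousAt hx).eventually (Metric.ball_mem_nhds _ hr))
  have hNN : ∀ᶠ p : ℕ × (X × X) in atTop ×ˢ 𝓝 (x, x), p.1 ∈ A ∧
      (p.2.1 ∈ e.source ∧ e p.2.1 ∈ Metric.ball (e x) r) ∧
      (p.2.2 ∈ e.source ∧ e p.2.2 ∈ Metric.ball (e x) r) := by
    refine (tendsto_fst.eventually hA).and (Eventually.and ?_ ?_)
    · exact ((continuous_fst.tendsto (x, x)).comp tendsto_snd).eventually hN
    · exact ((continuous_snd.tendsto (x, x)).comp tendsto_snd).eventually hN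
  filter_upwards [hNN] with p ⟨hp1, hp2, hp3⟩ hp
  have hI := hδinj (e' ∘ G p.1 ∘ e.symm) (Metric.ball (e x) r) (convex_ball _ _)
    (fun z hz => (hAB (mk_mem_prod hp1 (hrB hz))).2)
    (fun z hz => (hAB (mk_mem_prod hp1 (hrB hz))).1)
  refine e.injOn hp2.1 hp3.1 (hI hp2.2 hp3.2 ?_)
  simp only [Function.comp, e.left_inv hp2.1, e.left_inv hp3.1, hp]

/-- For immersions, injectivity on a compact set is an open condition in `C^1`. -/
theorem eventually_injOn_of_tendstoC1At [T2Space Y] {Ω K : Set X} (hΩ : IsOpen Ω)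
    (hK : IsCompact K) (hKΩ : K ⊆ Ω) {F : X → Y} (hF : ContMDiffOn (𝓡 n) (𝓡 n) 1 F Ω)
    (hinj : InjOn F K) (himm : ∀ x ∈ K, Function.Injective (mfderiv (𝓡 n) (𝓡 n) F x))
    {G : ℕ → X → Y} (hG : ∀ x ∈ Ω, TendstoC1At n G F x) : ∀ᶠ k in atTop, InjOn (G k) K := by
  have key : ∀ᶠ k in atTop, ∀ p ∈ K ×ˢ K, G k p.1 = G k p.2 → p.1 = p.2 := by
    refine eventually_forall_mem_of_isCompact (hK.prod hK) fun q hq => ?_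
    obtain ⟨x, y⟩ := q
    obtain ⟨hx, hy⟩ : x ∈ K ∧ y ∈ K := hq
    by_cases hxy : x = y
    · subst hxy
      exact (hG x (hKΩ hx)).eventually_injective
        ((hF.contMDiffAt (hΩ.mem_nhds (hKΩ hx))).mdifferentiableAt one_ne_zero) (himm x hx)
    · have h1 : Tendsto (fun p : ℕ × (X × X) => G p.1 p.2.1) (atTop ×ˢ 𝓝 (x, y)) (𝓝 (F x)) :=
        (hG x (hKΩ hx)).2.1.comp (tendsto_id.prodMap (continuous_fst.tendsto (x, y)))
      have h2 : Tendsto (fun p : ℕ × (X × X) => G p.1 p.2.2) (atTop ×ˢ 𝓝 (x, y)) (𝓝 (F y)) :=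
        (hG y (hKΩ hy)).2.1.comp (tendsto_id.prodMap (continuous_snd.tendsto (x, y)))
      have h3 : (diagonal Y)ᶜ ∈ 𝓝 (F x, F y) :=
        isClosed_diagonal.isOpen_compl.mem_nhds fun h => hxy (hinj hx hy h)
      filter_upwards [(h1.prodMk_nhds h2).eventually h3] with p hp h
      exact absurd h hp
  filter_upwards [key] with k hk x hx y hy hxy
  exact hk (x, y) ⟨hx, hy⟩ hxy

end Injectivity

end C1Convergence

/-! ### Smoothing a `C^1` map -/

section Smoothing

/-- In a vector space: a map `f` that is `C^1` near a closed ball is the `C^1` limit of maps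
`f + h k` with `h k` supported in a smaller ball, which are smooth in a still smaller ball and
wherever `f` is. -/
theorem exists_smoothing_perturbation {E F : Type*} [NormedAddCommGroup E] [InnerProductSpace ℝ E]
    [FiniteDimensional ℝ E] [NormedAddCommGroup F] [NormedSpace ℝ F] [CompleteSpace F]
    {f : E → F} {T : Set E} (hT : IsOpen T) (hf : ContDiffOn ℝ 1 f T) {z : E} {r : ℝ} (hr : 0 < r)
    (hball : Metric.closedBall z (4 * r) ⊆ T) {δ : ℝ} (hδ : 0 < δ) :
    ∃ h : ℕ → E → F, (∀ k, ContDiff ℝ 1 (h k)) ∧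
      (∀ k, ∀ y ∉ Metric.closedBall z (2 * r), h k y = 0) ∧ (∀ k y, ‖h k y‖ ≤ δ) ∧
      (∀ ε > 0, ∀ᶠ k in atTop, ∀ y, ‖h k y‖ ≤ ε ∧ ‖fderiv ℝ (h k) y‖ ≤ ε) ∧
      (∀ k, ContDiffOn ℝ ∞ (fun y => f y + h k y) (Metric.ball z r)) ∧
      ∀ k, ∀ y ∈ T, ContDiffAt ℝ ∞ f y → ContDiffAt ℝ ∞ (h k) y := by
  let χ : ContDiffBump z := ⟨r, 2 * r, hr, by linarith⟩
  let χ₂ : ContDiffBump z := ⟨3 * r, 4 * r, by linarith, by linarith⟩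
  have hχ : ContDiff ℝ ∞ χ := χ.contDiff
  have hχ₂ : ContDiff ℝ ∞ χ₂ := χ₂.contDiff
  -- the cut-off of `f`, a compactly supported `C^1` function on the whole space
  let f₂ : E → F := fun y => χ₂ y • f y
  have hf₂at : ∀ (j : ℕ∞ω) (y : E), j ≤ (∞ : ℕ∞ω) → (y ∈ T → ContDiffAt ℝ j f y) →
    ContDiffAt ℝ j f₂ y := by
    intro j y hj hy
    by_cases hyT : y ∈ T
    · exact (hχ₂.contDiffAt.of_le hj).smul (hy hyT)
    · have : f₂ =ᶠ[𝓝 y] fun _ => 0 := by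
        have hy4 : y ∈ (tsupport χ₂)ᶜ := by
          rw [χ₂.tsupport_eq]
          exact fun h => hyT (hball h)
        filter_upwards [(isClosed_tsupport χ₂).isOpen_compl.mem_nhds hy4] with w hw
        simp [f₂, image_eq_zero_of_notMem_tsupport hw]
      exact contDiffAt_const.congr_of_eventuallyEq this
  have hf₂ : ContDiff ℝ 1 f₂ := contDiff_iff_contDiffAt.2 fun y =>
    hf₂at 1 y (by simp) fun hy => hf.contDiffAt (hT.mem_nhds hy)
  have hf₂c : HasCompactSupport f₂ := χ₂.hasCompactSupport.smul_right
  have hf₂f : ∀ y ∈ Metric.closedBall z (3 * r), f₂ y = f y := fun y hy => by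
    simp [f₂, χ₂.one_of_mem_closedBall hy]
  obtain ⟨C, hC0, hC⟩ : ∃ C : ℝ, 0 ≤ C ∧ ∀ y, ‖fderiv ℝ χ y‖ ≤ C := by
    obtain ⟨C, hC⟩ := (χ.hasCompactSupport.fderiv (𝕜 := ℝ)).exists_bound_of_continuous
      (hχ.continuous_fderiv (by simp))
    exact ⟨C, (norm_nonneg _).trans (hC z), hC⟩
  have happ : ∀ k : ℕ, ∃ g : E → F, ContDiff ℝ ∞ g ∧ ∀ x,
      ‖g x - f₂ x‖ ≤ min δ (1 / (k + 1)) ∧ ‖fderiv ℝ g x - fderiv ℝ f₂ x‖ ≤ min δ (1 / (k + 1)) :=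
    fun k => exists_contDiff_norm_fderiv_sub_le hf₂ hf₂c (lt_min hδ (by positivity))
  choose g hgs hg using happ
  let h : ℕ → E → F := fun k y => χ y • (g k y - f₂ y)
  have hdiff : ∀ k, ContDiff ℝ 1 fun y => g k y - f₂ y := fun k =>
    ((hgs k).of_le (by simp)).sub hf₂
  have hh1 : ∀ k, ContDiff ℝ 1 (h k) := fun k => (hχ.of_le (by simp)).smul (hdiff k)
  have hhb : ∀ k y, ‖h k y‖ ≤ ‖g k y - f₂ y‖ := fun k y => by
    rw [norm_smul, Real.norm_eq_abs, abs_of_nonneg χ.nonneg]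
    exact mul_le_of_le_one_left (norm_nonneg _) χ.le_one
  have hhd : ∀ k y, ‖fderiv ℝ (h k) y‖ ≤ (1 + C) * (1 / (k + 1)) := fun k y => by
    have hd1 : DifferentiableAt ℝ χ y := hχ.differentiable (by simp) y
    have hd2 := (hdiff k).differentiable one_ne_zero y
    have hd3 := (hgs k).differentiable (by simp) y
    have hd4 := hf₂.differentiable one_ne_zero y
    have hg1 := ((hg k y).1).trans (min_le_right _ _)
    have hg2 := ((hg k y).2).trans (min_le_right _ _)
    rw [fderiv_fun_smul hd1 hd2, fderiv_fun_sub hd3 hd4]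
    refine (norm_add_le _ _).trans ?_
    rw [add_mul]
    refine add_le_add ?_ ?_
    · rw [norm_smul, Real.norm_eq_abs, abs_of_nonneg χ.nonneg]
      exact mul_le_mul χ.le_one hg2 (norm_nonneg _) zero_le_one
    · rw [ContinuousLinearMap.norm_smulRight_apply]
      exact mul_le_mul (hC y) hg1 (norm_nonneg _) hC0
  refine ⟨h, hh1, ?_, fun k y => (hhb k y).trans ((hg k y).1.trans (min_le_left _ _)), ?_, ?_, ?_⟩
  · intro k y hy
    have : χ y = 0 := χ.zero_of_le_dist (by
      rw [Metric.mem_closedBall, not_le] at hy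
      exact hy.le)
    simp [h, this]
  · intro ε hε
    have hlim : Tendsto (fun k : ℕ => (1 + C) * (1 / ((k : ℝ) + 1))) atTop (𝓝 0) := by
      simpa using tendsto_one_div_add_atTop_nhds_zero_nat.const_mul (1 + C)
    filter_upwards [hlim.eventually (gt_mem_nhds hε)] with k hk y
    refine ⟨?_, (hhd k y).trans hk.le⟩
    refine ((hhb k y).trans ((hg k y).1.trans (min_le_right _ _))).trans (le_trans ?_ hk.le)
    exact le_mul_of_one_le_left (by positivity) (by linarith)
  · intro k
    refine (hgs k).contDiffOn.congr fun y hy => ?_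
    have h1 : χ y = 1 := χ.one_of_mem_closedBall (Metric.ball_subset_closedBall hy)
    have h2 : f₂ y = f y := hf₂f y (Metric.closedBall_subset_closedBall (by linarith)
      (Metric.ball_subset_closedBall hy))
    simp [h, h1, h2]
  · intro k y _ hy
    exact hχ.contDiffAt.smul ((hgs k).contDiffAt.sub (hf₂at ∞ y le_rfl fun _ => hy))

variable {n : ℕ}
  {X : Type*} [TopologicalSpace X] [ChartedSpace (EuclideanSpace ℝ (Fin n)) X]
  {Y : Type*} [TopologicalSpace Y] [ChartedSpace (EuclideanSpace ℝ (Fin n)) Y]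

theorem contDiffAt_comp_charts {e : OpenPartialHomeomorph X (EuclideanSpace ℝ (Fin n))}
    (he : e ∈ IsManifold.maximalAtlas (𝓡 n) ∞ X)
    {e' : OpenPartialHomeomorph Y (EuclideanSpace ℝ (Fin n))}
    (he' : e' ∈ IsManifold.maximalAtlas (𝓡 n) ∞ Y)
    {F : X → Y} {z : EuclideanSpace ℝ (Fin n)} (hz : z ∈ e.target) (hFz : F (e.symm z) ∈ e'.source)
    {j : ℕ∞ω}
    (hj : j ≤ (∞ : ℕ∞ω)) (hF : ContMDiffAt (𝓡 n) (𝓡 n) j F (e.symm z)) :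
    ContDiffAt ℝ j (e' ∘ F ∘ e.symm) z := by
  rw [← contMDiffAt_iff_contDiffAt]
  have h1 : ContMDiffAt (𝓡 n) (𝓡 n) j e.symm z :=
    (contMDiffAt_symm_of_mem_maximalAtlas he hz).of_le hj
  have h2 : ContMDiffAt (𝓡 n) (𝓡 n) j e' (F (e.symm z)) :=
    (contMDiffAt_of_mem_maximalAtlas he' hFz).of_le hj
  exact ContMDiffAt.comp z h2 (ContMDiffAt.comp z hF h1)

variable [IsManifold (𝓡 n) ∞ X] [IsManifold (𝓡 n) ∞ Y]

/-- A map that is `C^1` on an open set converges to itself in `C^1` there. -/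
theorem tendstoC1At_of_eventuallyEq {Ω : Set X} (hΩ : IsOpen Ω) {F : X → Y}
    (hF : ContMDiffOn (𝓡 n) (𝓡 n) 1 F Ω) {x : X} (hx : x ∈ Ω) {G : ℕ → X → Y} {V : Set X}
    (hV : V ∈ 𝓝 x) (hG : ∀ k, EqOn (G k) F V) : TendstoC1At n G F x := by
  have hFx := hF.contMDiffAt (hΩ.mem_nhds hx)
  have hGF : ∀ᶠ p : ℕ × X in atTop ×ˢ 𝓝 x, G p.1 =ᶠ[𝓝 p.2] F := by
    have h1 : ∀ᶠ y in 𝓝 x, ∀ᶠ w in 𝓝 y, w ∈ V := eventually_eventually_nhds.2 hV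
    filter_upwards [tendsto_snd.eventually h1] with p hp
    filter_upwards [hp] with w hw using hG p.1 hw
  refine ⟨?_, ?_, chartAt _ x, IsManifold.chart_mem_maximalAtlas x, chartAt _ (F x),
    IsManifold.chart_mem_maximalAtlas (F x), mem_chart_source _ _, mem_chart_source _ _, ?_⟩
  · have h1 : ∀ᶠ y in 𝓝 x, MDifferentiableAt (𝓡 n) (𝓡 n) F y := by
      filter_upwards [hΩ.mem_nhds hx] with y hy
      exact (hF.contMDiffAt (hΩ.mem_nhds hy)).mdifferentiableAt one_ne_zero
    filter_upwards [hGF, tendsto_snd.eventually h1] with p hp1 hp2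
    exact hp2.congr_of_eventuallyEq hp1
  · refine (hFx.continuousAt.tendsto.comp tendsto_snd).congr' ?_
    filter_upwards [hGF] with p hp using hp.eq_of_nhds.symm
  · let e := chartAt (EuclideanSpace ℝ (Fin n)) x
    let e' := chartAt (EuclideanSpace ℝ (Fin n)) (F x)
    have hxe : x ∈ e.source := mem_chart_source _ _
    have he : e ∈ IsManifold.maximalAtlas (𝓡 n) ∞ X := IsManifold.chart_mem_maximalAtlas x
    have he' : e' ∈ IsManifold.maximalAtlas (𝓡 n) ∞ Y := IsManifold.chart_mem_maximalAtlas (F x)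
    have hsymm : Tendsto e.symm (𝓝 (e x)) (𝓝 x) := by
      have := (e.continuousAt_symm (e.map_source hxe)).tendsto
      rwa [e.left_inv hxe] at this
    have hc : ContDiffAt ℝ 1 (e' ∘ F ∘ e.symm) (e x) := by
      refine contDiffAt_comp_charts he he' (e.map_source hxe) ?_ (by simp) ?_
      · rw [e.left_inv hxe]; exact mem_chart_source _ _
      · rwa [e.left_inv hxe]
    have hc' : ContinuousAt (fderiv ℝ (e' ∘ F ∘ e.symm)) (e x) :=
      (hc.fderiv_right (m := 0) (by simp)).continuousAt
    refine (hc'.tendsto.comp tendsto_snd).congr' ?_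
    have hex : Tendsto (fun p : ℕ × EuclideanSpace ℝ (Fin n) => (p.1, e.symm p.2))
      (atTop ×ˢ 𝓝 (e x)) (atTop ×ˢ 𝓝 x) :=
      tendsto_id.prodMap hsymm
    have htgt : ∀ᶠ p : ℕ × EuclideanSpace ℝ (Fin n) in atTop ×ˢ 𝓝 (e x), p.2 ∈ e.target :=
      tendsto_snd.eventually (e.open_target.mem_nhds (e.map_source hxe))
    filter_upwards [hex.eventually hGF, htgt] with p hp hpt
    refine Filter.EventuallyEq.fderiv_eq ?_
    filter_upwards [(e.continuousAt_symm hpt).tendsto.eventually hp] with w hw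
    simp only [Function.comp] at hw ⊢
    rw [hw]

/-- A `C^1` map can be smoothed near a given point by a small `C^1` perturbation supported in a
chart, without destroying smoothness elsewhere. -/
theorem exists_smoothing_in_chart [T2Space X] {Ω : Set X} (hΩ : IsOpen Ω) {F : X → Y}
    (hF : ContMDiffOn (𝓡 n) (𝓡 n) 1 F Ω) {e : OpenPartialHomeomorph X (EuclideanSpace ℝ (Fin n))}
    (he : e ∈ IsManifold.maximalAtlas (𝓡 n) ∞ X)
    {e' : OpenPartialHomeomorph Y (EuclideanSpace ℝ (Fin n))}
    (he' : e' ∈ IsManifold.maximalAtlas (𝓡 n) ∞ Y)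
    {z : EuclideanSpace ℝ (Fin n)} {r : ℝ} (hr : 0 < r)
    (hball : Metric.closedBall z (4 * r) ⊆ e.target)
    (hballΩ : e.symm '' Metric.closedBall z (4 * r) ⊆ Ω)
    (hballF : MapsTo F (e.symm '' Metric.closedBall z (4 * r)) e'.source) :
    ∃ G : ℕ → X → Y, (∀ k, ContMDiffOn (𝓡 n) (𝓡 n) 1 (G k) Ω) ∧
      (∀ x ∈ Ω, TendstoC1At n G F x) ∧
      (∀ k, ContMDiffOn (𝓡 n) (𝓡 n) ∞ (G k) (e.symm '' Metric.ball z r)) ∧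
      ∀ k, ∀ S ⊆ Ω, IsOpen S → ContMDiffOn (𝓡 n) (𝓡 n) ∞ F S →
        ContMDiffOn (𝓡 n) (𝓡 n) ∞ (G k) S := by
  classical
  have hΩ' : IsOpen (Ω ∩ F ⁻¹' e'.source) :=
    hF.continuousOn.isOpen_inter_preimage hΩ e'.open_source
  let T : Set (EuclideanSpace ℝ (Fin n)) := e.target ∩ e.symm ⁻¹' (Ω ∩ F ⁻¹' e'.source)
  have hT : IsOpen T := e.isOpen_inter_preimage_symm hΩ'
  let f : EuclideanSpace ℝ (Fin n) → EuclideanSpace ℝ (Fin n) := e' ∘ F ∘ e.symm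
  have hfat : ∀ (j : ℕ∞ω) (y : EuclideanSpace ℝ (Fin n)), j ≤ (∞ : ℕ∞ω) → y ∈ T →
      ContMDiffAt (𝓡 n) (𝓡 n) j F (e.symm y) → ContDiffAt ℝ j f y := fun j y hj hy h =>
    contDiffAt_comp_charts he he' hy.1 hy.2.2 hj h
  have hf : ContDiffOn ℝ 1 f T := fun y hy =>
    (hfat 1 y (by simp) hy (hF.contMDiffAt (hΩ.mem_nhds hy.2.1))).contDiffWithinAt
  have hballT : Metric.closedBall z (4 * r) ⊆ T := fun y hy =>
    ⟨hball hy, hballΩ (mem_image_of_mem _ hy), hballF (mem_image_of_mem _ hy)⟩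
  have hsub : ∀ {s}, s ≤ 4 * r → Metric.closedBall z s ⊆ T := fun hs =>
    (Metric.closedBall_subset_closedBall hs).trans hballT
  -- perturbations of size at most `δ` stay in the target of the chart
  obtain ⟨δ, hδ, hδt⟩ : ∃ δ > 0, Metric.cthickening δ (f '' Metric.closedBall z (2 * r))
      ⊆ e'.target := by
    refine IsCompact.exists_cthickening_subset_open ?_ e'.open_target ?_
    · exact (isCompact_closedBall _ _).image_of_continuousOn
        (hf.continuousOn.mono (hsub (by linarith)))
    · rintro _ ⟨y, hy, rfl⟩
      exact e'.map_source (hsub (by linarith) hy).2.2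
  obtain ⟨h, hh1, hh0, hhδ, hhlim, hhs, hhT⟩ := exists_smoothing_perturbation hT hf hr hballT hδ
  let B : Set X := e.source ∩ e ⁻¹' Metric.closedBall z (2 * r)
  let U : Set X := e.source ∩ e ⁻¹' Metric.ball z (3 * r)
  have hBc : IsClosed B := by
    have : B = e.symm '' Metric.closedBall z (2 * r) :=
      (e.symm_image_eq_source_inter_preimage ((hsub (by linarith)).trans inter_subset_left)).symm
    rw [this]
    exact ((isCompact_closedBall _ _).image_of_continuousOn (e.continuousOn_symm.mono
      ((hsub (by linarith)).trans inter_subset_left))).isClosed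
  have hU : IsOpen U := e.isOpen_inter_preimage Metric.isOpen_ball
  have hUT : ∀ x ∈ U, e x ∈ T := fun x hx =>
    hsub (by linarith) (Metric.ball_subset_closedBall hx.2)
  have htgt : ∀ k, ∀ x ∈ U, f (e x) + h k (e x) ∈ e'.target := by
    intro k x hx
    by_cases hxB : e x ∈ Metric.closedBall z (2 * r)
    · refine hδt (Metric.mem_cthickening_of_dist_le _ (f (e x)) _ _ (mem_image_of_mem _ hxB) ?_)
      simpa using hhδ k (e x)
    · rw [hh0 k _ hxB, add_zero]
      exact e'.map_source (hUT x hx).2.2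
  let G : ℕ → X → Y := fun k x => if x ∈ B then e'.symm (f (e x) + h k (e x)) else F x
  have hGU : ∀ k, ∀ x ∈ U, G k x = e'.symm (f (e x) + h k (e x)) := by
    intro k x hx
    by_cases hxB : x ∈ B
    · simp only [G, if_pos hxB]
    · have h1 : e x ∉ Metric.closedBall z (2 * r) := fun h => hxB ⟨hx.1, h⟩
      have h2 := (hUT x hx).2.2
      simp only [mem_preimage, e.left_inv hx.1] at h2
      simp only [G, if_neg hxB, hh0 k _ h1, add_zero, f, Function.comp, e.left_inv hx.1,
        e'.left_inv h2]
  have hGB : ∀ k, ∀ x ∉ B, G k x = F x := fun k x hx => by simp only [G, if_neg hx]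
  have hBU : B ⊆ U := fun x hx => ⟨hx.1, Metric.closedBall_subset_ball (by linarith) hx.2⟩
  -- regularity of `G k` on `U` in terms of the regularity of its expression in the charts
  have hGUat : ∀ (j : ℕ∞ω) (k : ℕ) (x : X), j ≤ (∞ : ℕ∞ω) → x ∈ U →
      ContDiffAt ℝ j (fun y => f y + h k y) (e x) → ContMDiffAt (𝓡 n) (𝓡 n) j (G k) x := by
    intro j k x hj hx hreg
    have h1 : ContMDiffAt (𝓡 n) (𝓡 n) j e x := (contMDiffAt_of_mem_maximalAtlas he hx.1).of_le hj
    have h2 : ContMDiffAt (𝓡 n) (𝓡 n) j e'.symm (f (e x) + h k (e x)) :=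
      (contMDiffAt_symm_of_mem_maximalAtlas he' (htgt k x hx)).of_le hj
    have h3 : ContMDiffAt (𝓡 n) (𝓡 n) j (e'.symm ∘ (fun y => f y + h k y) ∘ e) x :=
      ContMDiffAt.comp x h2 (ContMDiffAt.comp x hreg.contMDiffAt h1)
    refine h3.congr_of_eventuallyEq ?_
    filter_upwards [hU.mem_nhds hx] with y hy using hGU k y hy
  have hGBat : ∀ (j : ℕ∞ω) (k : ℕ) (x : X), x ∉ B → ContMDiffAt (𝓡 n) (𝓡 n) j F x →
      ContMDiffAt (𝓡 n) (𝓡 n) j (G k) x := by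
    intro j k x hx hFx
    refine hFx.congr_of_eventuallyEq ?_
    filter_upwards [hBc.isOpen_compl.mem_nhds hx] with y hy using hGB k y hy
  have hfe : ∀ (j : ℕ∞ω) (x : X), j ≤ (∞ : ℕ∞ω) → x ∈ U → ContMDiffAt (𝓡 n) (𝓡 n) j F x →
      ContDiffAt ℝ j f (e x) := fun j x hj hx hFx =>
    hfat j (e x) hj (hUT x hx) (by rwa [e.left_inv hx.1])
  have hC1 : ∀ k, ∀ x ∈ Ω, ContMDiffAt (𝓡 n) (𝓡 n) 1 (G k) x := by
    intro k x hx
    have hFx := hF.contMDiffAt (hΩ.mem_nhds hx)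
    by_cases hxB : x ∈ B
    · exact hGUat 1 k x (by simp) (hBU hxB)
        ((hfe 1 x (by simp) (hBU hxB) hFx).add (hh1 k).contDiffAt)
    · exact hGBat 1 k x hxB hFx
  refine ⟨G, fun k x hx => (hC1 k x hx).contMDiffWithinAt, fun x hx => ?_, fun k => ?_,
    fun k S hSΩ hS hFS x hx => ?_⟩
  · by_cases hxB : x ∈ B
    swap
    · exact tendstoC1At_of_eventuallyEq hΩ hF hx (hBc.isOpen_compl.mem_nhds hxB)
        fun k y hy => hGB k y hy
    have hxU := hBU hxB
    have hxe : x ∈ e.source := hxU.1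
    have hFe : F x ∈ e'.source := by
      have := (hUT x hxU).2.2
      rwa [mem_preimage, e.left_inv hxe] at this
    have hfx : ContDiffAt ℝ 1 f (e x) :=
      hfe 1 x (by simp) hxU (hF.contMDiffAt (hΩ.mem_nhds hx))
    have hlim0 : ∀ l : Filter (EuclideanSpace ℝ (Fin n)),
        Tendsto (fun p : ℕ × EuclideanSpace ℝ (Fin n) => h p.1 p.2) (atTop ×ˢ l) (𝓝 0) ∧
        Tendsto (fun p : ℕ × EuclideanSpace ℝ (Fin n) => fderiv ℝ (h p.1) p.2) (atTop ×ˢ l)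
          (𝓝 0) := by
      intro l
      constructor <;> refine Metric.tendsto_nhds.2 fun ε hε => ?_ <;>
        filter_upwards [tendsto_fst.eventually (hhlim (ε / 2) (half_pos hε))] with p hp <;>
        rw [dist_zero_right]
      · exact (hp p.2).1.trans_lt (half_lt_self hε)
      · exact (hp p.2).2.trans_lt (half_lt_self hε)
    refine ⟨?_, ?_, e, he, e', he', hxe, hFe, ?_⟩
    · filter_upwards [tendsto_snd.eventually (hΩ.mem_nhds hx)] with p hp
      exact (hC1 p.1 p.2 hp).mdifferentiableAt one_ne_zero
    · have h1 : Tendsto (fun p : ℕ × X => f (e p.2) + h p.1 (e p.2)) (atTop ×ˢ 𝓝 x)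
          (𝓝 (e' (F x))) := by
        have h2 : Tendsto (fun p : ℕ × X => f (e p.2)) (atTop ×ˢ 𝓝 x) (𝓝 (f (e x))) :=
          (hfx.continuousAt.tendsto.comp (e.continuousAt hxe).tendsto).comp tendsto_snd
        have h3 : Tendsto (fun p : ℕ × X => h p.1 (e p.2)) (atTop ×ˢ 𝓝 x) (𝓝 0) :=
          (hlim0 (𝓝 (e x))).1.comp (tendsto_id.prodMap (e.continuousAt hxe).tendsto)
        have h4 : f (e x) + 0 = e' (F x) := by
          simp only [add_zero, f, Function.comp, e.left_inv hxe]
        exact h4 ▸ h2.add h3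
      have h5 := ((e'.continuousAt_symm (e'.map_source hFe)).tendsto.comp h1)
      rw [e'.left_inv hFe] at h5
      refine h5.congr' ?_
      filter_upwards [tendsto_snd.eventually (hU.mem_nhds hxU)] with p hp
      exact (hGU p.1 p.2 hp).symm
    · have h1 : Tendsto (fun p : ℕ × EuclideanSpace ℝ (Fin n) => fderiv ℝ f p.2 + fderiv ℝ
      (h p.1) p.2)
          (atTop ×ˢ 𝓝 (e x)) (𝓝 (fderiv ℝ f (e x))) := by
        have h2 : Tendsto (fun p : ℕ × EuclideanSpace ℝ (Fin n) => fderiv ℝ f p.2)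
          (atTop ×ˢ 𝓝 (e x))
            (𝓝 (fderiv ℝ f (e x))) :=
          ((hfx.fderiv_right (m := 0) (by simp)).continuousAt).tendsto.comp tendsto_snd
        have h3 := h2.add (hlim0 (𝓝 (e x))).2
        rwa [add_zero] at h3
      refine h1.congr' ?_
      have hU' : IsOpen (e.target ∩ e.symm ⁻¹' U) := e.isOpen_inter_preimage_symm hU
      have hxU' : e x ∈ e.target ∩ e.symm ⁻¹' U :=
        ⟨e.map_source hxe, by rwa [mem_preimage, e.left_inv hxe]⟩
      have hTU : ∀ᶠ y in 𝓝 (e x), y ∈ (e.target ∩ e.symm ⁻¹' U) ∩ T :=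
        (hU'.inter hT).mem_nhds ⟨hxU', hUT x hxU⟩
      filter_upwards [tendsto_snd.eventually hTU] with p hp
      have hfd : DifferentiableAt ℝ f p.2 :=
        (hf.contDiffAt (hT.mem_nhds hp.2)).differentiableAt one_ne_zero
      have hhd : DifferentiableAt ℝ (h p.1) p.2 := (hh1 p.1).differentiable one_ne_zero p.2
      rw [← fderiv_fun_add hfd hhd]
      refine Filter.EventuallyEq.fderiv_eq ?_
      filter_upwards [hU'.mem_nhds hp.1] with w hw
      have h6 := htgt p.1 (e.symm w) hw.2
      rw [e.right_inv hw.1] at h6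
      simp only [Function.comp]
      rw [hGU p.1 _ hw.2, e.right_inv hw.1, e'.right_inv h6]
  · rintro _ ⟨y, hy, rfl⟩
    have hyt : y ∈ e.target := hball (Metric.ball_subset_closedBall
      (Metric.ball_subset_ball (by linarith) hy))
    have hyU : e.symm y ∈ U := ⟨e.map_target hyt, by
      simp only [mem_preimage, e.right_inv hyt]
      exact Metric.ball_subset_ball (by linarith) hy⟩
    refine (hGUat ∞ k _ le_rfl hyU ?_).contMDiffWithinAt
    rw [e.right_inv hyt]
    exact (hhs k).contDiffAt (Metric.isOpen_ball.mem_nhds hy)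
  · have hFx := hFS.contMDiffAt (hS.mem_nhds hx)
    apply ContMDiffAt.contMDiffWithinAt
    by_cases hxB : x ∈ B
    · have hfx := hfe ∞ x le_rfl (hBU hxB) hFx
      exact hGUat ∞ k x le_rfl (hBU hxB) (hfx.add (hhT k _ (hUT x (hBU hxB)) hfx))
    · exact hGBat ∞ k x hxB hFx

/-- Near a compact set, a `C^1` map can be replaced by a smooth one, keeping any condition that is
stable under small `C^1` perturbations: it is smoothed successively in finitely many charts. -/
theorem exists_smooth_of_isC1Stable [T2Space X] {Ω K : Set X} (hΩ : IsOpen Ω) (hK : IsCompact K)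
    (hKΩ : K ⊆ Ω) {P : (X → Y) → Prop} (hP : IsC1Stable n Ω P) {F : X → Y}
    (hF : ContMDiffOn (𝓡 n) (𝓡 n) 1 F Ω) (hPF : P F) :
    ∃ G : X → Y, P G ∧ ContMDiffOn (𝓡 n) (𝓡 n) 1 G Ω ∧
      ∃ S : Set X, IsOpen S ∧ K ⊆ S ∧ S ⊆ Ω ∧ ContMDiffOn (𝓡 n) (𝓡 n) ∞ G S := by
  classical
  let e : X → OpenPartialHomeomorph X (EuclideanSpace ℝ (Fin n)) :=
    fun x => chartAt (EuclideanSpace ℝ (Fin n)) x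
  let e' : X → OpenPartialHomeomorph Y (EuclideanSpace ℝ (Fin n)) :=
    fun x => chartAt (EuclideanSpace ℝ (Fin n)) (F x)
  have hr : ∀ x ∈ K, ∃ r : ℝ, 0 < r ∧ Metric.closedBall (e x x) (4 * r) ⊆
      (e x).target ∩ (e x).symm ⁻¹' (Ω ∩ F ⁻¹' (e' x).source) := by
    intro x hx
    have hopen : IsOpen ((e x).target ∩ (e x).symm ⁻¹' (Ω ∩ F ⁻¹' (e' x).source)) :=
      (e x).isOpen_inter_preimage_symm
        (hF.continuousOn.isOpen_inter_preimage hΩ (e' x).open_source)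
    have hmem : e x x ∈ (e x).target ∩ (e x).symm ⁻¹' (Ω ∩ F ⁻¹' (e' x).source) := by
      refine ⟨mem_chart_target _ x, ?_⟩
      rw [mem_preimage, (e x).left_inv (mem_chart_source _ x)]
      exact ⟨hKΩ hx, mem_chart_source _ (F x)⟩
    obtain ⟨s, hs, hsub⟩ := Metric.nhds_basis_closedBall.mem_iff.1 (hopen.mem_nhds hmem)
    exact ⟨s / 4, by positivity, by rwa [mul_div_cancel₀ s (by norm_num : (4 : ℝ) ≠ 0)]⟩
  choose! r hr0 hr using hr
  let L : X → Set X := fun x => (e x).symm '' Metric.closedBall (e x x) (4 * r x)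
  let O : X → Set X := fun x => (e x).symm '' Metric.ball (e x x) (r x)
  have hLc : ∀ x ∈ K, IsCompact (L x) := fun x hx =>
    (isCompact_closedBall _ _).image_of_continuousOn
      ((e x).continuousOn_symm.mono ((hr x hx).trans inter_subset_left))
  have hLΩ : ∀ x ∈ K, L x ⊆ Ω := by
    rintro x hx _ ⟨y, hy, rfl⟩
    exact (hr x hx hy).2.1
  have hOL : ∀ x ∈ K, O x ⊆ L x := fun x hx => image_mono
    (Metric.ball_subset_closedBall.trans
      (Metric.closedBall_subset_closedBall (by linarith [hr0 x hx])))
  have hOo : ∀ x ∈ K, IsOpen (O x) := fun x hx =>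
    (e x).isOpen_image_symm_of_subset_target Metric.isOpen_ball
      ((Metric.ball_subset_closedBall.trans
        (Metric.closedBall_subset_closedBall (by linarith [hr0 x hx]))).trans
        ((hr x hx).trans inter_subset_left))
  have hxO : ∀ x ∈ K, x ∈ O x := fun x hx =>
    ⟨e x x, Metric.mem_ball_self (hr0 x hx), (e x).left_inv (mem_chart_source _ x)⟩
  obtain ⟨t, htK, hcov⟩ := hK.elim_nhds_subcover O fun x hx => (hOo x hx).mem_nhds (hxO x hx)
  have hQ : IsC1Stable n Ω fun F : X → Y => P F ∧ ∀ x ∈ t, MapsTo F (L x) (e' x).source :=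
    hP.and (IsC1Stable.forall_finset t fun x hx =>
      isC1Stable_mapsTo (hLc x (htK x hx)) (hLΩ x (htK x hx)) (e' x).open_source)
  have key : ∀ s ⊆ t, ∃ G : X → Y, (P G ∧ ∀ x ∈ t, MapsTo G (L x) (e' x).source) ∧
      ContMDiffOn (𝓡 n) (𝓡 n) 1 G Ω ∧ ∀ x ∈ s, ContMDiffOn (𝓡 n) (𝓡 n) ∞ G (O x) := by
    intro s
    induction s using Finset.induction_on with
    | empty =>
      refine fun _ => ⟨F, ⟨hPF, fun x hx => ?_⟩, hF, by simp⟩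
      rintro _ ⟨y, hy, rfl⟩
      exact (hr x (htK x hx) hy).2.2
    | insert x s hxs ih =>
      intro hst
      have hxt : x ∈ t := hst (Finset.mem_insert_self _ _)
      have hxK := htK x hxt
      obtain ⟨G, hG, hG1, hGs⟩ := ih ((Finset.subset_insert _ _).trans hst)
      obtain ⟨H, hH1, hHlim, hHx, hHS⟩ := exists_smoothing_in_chart hΩ hG1
        (IsManifold.chart_mem_maximalAtlas x) (IsManifold.chart_mem_maximalAtlas (F x))
        (hr0 x hxK) ((hr x hxK).trans inter_subset_left) (hLΩ x hxK) (hG.2 x hxt)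
      obtain ⟨k, hk⟩ := (hQ G hG1 hG H hHlim).exists
      refine ⟨H k, hk, hH1 k, fun y hy => ?_⟩
      rcases Finset.mem_insert.1 hy with rfl | hy
      · exact hHx k
      · have hyK := htK y (hst (Finset.mem_insert_of_mem hy))
        exact hHS k _ ((hOL y hyK).trans (hLΩ y hyK)) (hOo y hyK) (hGs y hy)
  obtain ⟨G, hG, hG1, hGs⟩ := key t subset_rfl
  refine ⟨G, hG.1, hG1, ⋃ x ∈ t, O x, isOpen_biUnion fun x hx => hOo x (htK x hx), hcov,
    iUnion₂_subset fun x hx => (hOL x (htK x hx)).trans (hLΩ x (htK x hx)), ?_⟩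
  intro y hy
  obtain ⟨x, hx, hyx⟩ := mem_iUnion₂.1 hy
  exact ((hGs x hx).contMDiffAt ((hOo x (htK x hx)).mem_nhds hyx)).contMDiffWithinAt

end Smoothing

/-! ### Smooth embeddings with bounded distortion -/

section Embedding

section Inverse

variable {n : ℕ}
  {X : Type*} [TopologicalSpace X] [ChartedSpace (EuclideanSpace ℝ (Fin n)) X]
    [IsManifold (𝓡 n) ∞ X]
  {Y : Type*} [TopologicalSpace Y] [ChartedSpace (EuclideanSpace ℝ (Fin n)) Y]
    [IsManifold (𝓡 n) ∞ Y]

/-- The inverse function theorem on manifolds of equal dimension. -/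
theorem exists_contMDiffAt_rightInverse {G : X → Y} {x : X}
    (hG : ContMDiffAt (𝓡 n) (𝓡 n) ∞ G x)
    (hinj : Function.Injective (mfderiv (𝓡 n) (𝓡 n) G x)) :
    ∃ H : Y → X, ContMDiffAt (𝓡 n) (𝓡 n) ∞ H (G x) ∧ H (G x) = x ∧
      ∀ᶠ y in 𝓝 (G x), G (H y) = y := by
  let e := chartAt (EuclideanSpace ℝ (Fin n)) x
  let e' := chartAt (EuclideanSpace ℝ (Fin n)) (G x)
  have hx : x ∈ e.source := mem_chart_source _ x
  have hGx : G x ∈ e'.source := mem_chart_source _ (G x)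
  have he : e ∈ IsManifold.maximalAtlas (𝓡 n) ∞ X := IsManifold.chart_mem_maximalAtlas x
  have he' : e' ∈ IsManifold.maximalAtlas (𝓡 n) ∞ Y := IsManifold.chart_mem_maximalAtlas (G x)
  let f : EuclideanSpace ℝ (Fin n) → EuclideanSpace ℝ (Fin n) := e' ∘ G ∘ e.symm
  have hfx : f (e x) = e' (G x) := by simp only [f, Function.comp, e.left_inv hx]
  have hf : ContDiffAt ℝ ∞ f (e x) := by
    refine contDiffAt_comp_charts he he' (e.map_source hx) ?_ le_rfl ?_ <;> rwa [e.left_inv hx]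
  have hfinj : Function.Injective (fderiv ℝ f (e x)) :=
    injective_fderiv_comp_charts he he' hx hGx (hG.mdifferentiableAt (by simp)) hinj
  let A : (EuclideanSpace ℝ (Fin n)) ≃L[ℝ] EuclideanSpace ℝ (Fin n) :=
    (LinearEquiv.ofInjectiveEndo
    (fderiv ℝ f (e x) : EuclideanSpace ℝ (Fin n) →ₗ[ℝ] EuclideanSpace ℝ (Fin n))
    hfinj).toContinuousLinearEquiv
  have hA : (A : EuclideanSpace ℝ (Fin n) →L[ℝ] EuclideanSpace ℝ (Fin n)) = fderiv ℝ f (e x) := by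
    ext; rfl
  have hf' : HasFDerivAt f (A : EuclideanSpace ℝ (Fin n) →L[ℝ] EuclideanSpace ℝ (Fin n)) (e x) := by
    rw [hA]; exact (hf.differentiableAt (by simp)).hasFDerivAt
  let g : EuclideanSpace ℝ (Fin n) → EuclideanSpace ℝ (Fin n) := hf.localInverse hf' (by simp)
  have hg : ContDiffAt ℝ ∞ g (e' (G x)) := hfx ▸ hf.to_localInverse hf' (by simp)
  have hgx : g (e' (G x)) = e x := by
    rw [← hfx]
    exact hf.localInverse_apply_image hf' (by simp)
  have hfg : ∀ᶠ w in 𝓝 (e' (G x)), f (g w) = w := by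
    rw [← hfx]
    exact (hf.hasStrictFDerivAt' hf' (by simp)).eventually_right_inverse
  have hH : ContMDiffAt (𝓡 n) (𝓡 n) ∞ (e.symm ∘ g ∘ e') (G x) := by
    have h1 : ContMDiffAt (𝓡 n) (𝓡 n) ∞ e' (G x) := contMDiffAt_of_mem_maximalAtlas he' hGx
    have h2 : ContMDiffAt (𝓡 n) (𝓡 n) ∞ e.symm (g (e' (G x))) :=
      contMDiffAt_symm_of_mem_maximalAtlas he (hgx ▸ e.map_source hx)
    exact ContMDiffAt.comp (G x) h2 (ContMDiffAt.comp (G x) hg.contMDiffAt h1)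
  have hHx : (e.symm ∘ g ∘ e') (G x) = x := by
    simp only [Function.comp, hgx, e.left_inv hx]
  refine ⟨e.symm ∘ g ∘ e', hH, hHx, ?_⟩
  have hGH : Tendsto (fun y => G ((e.symm ∘ g ∘ e') y)) (𝓝 (G x)) (𝓝 (G x)) := by
    have h1 : ContinuousAt G ((e.symm ∘ g ∘ e') (G x)) := hHx.symm ▸ hG.continuousAt
    have h2 := h1.tendsto.comp hH.continuousAt.tendsto
    rwa [hHx] at h2
  filter_upwards [(e'.continuousAt hGx).eventually hfg, e'.open_source.mem_nhds hGx,
    hGH.eventually (e'.open_source.mem_nhds hGx)] with y hy1 hy2 hy3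
  exact e'.injOn hy3 hy2 hy1

theorem isOpen_image_of_injective_mfderiv {G : X → Y} {W : Set X} (hW : IsOpen W)
    (hG : ContMDiffOn (𝓡 n) (𝓡 n) ∞ G W)
    (himm : ∀ x ∈ W, Function.Injective (mfderiv (𝓡 n) (𝓡 n) G x)) {V : Set X} (hV : IsOpen V)
    (hVW : V ⊆ W) :
    IsOpen (G '' V) := by
  rw [isOpen_iff_mem_nhds]
  rintro _ ⟨x, hx, rfl⟩
  obtain ⟨H, hH, hHx, hGH⟩ := exists_contMDiffAt_rightInverse
    (hG.contMDiffAt (hW.mem_nhds (hVW hx))) (himm x (hVW hx))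
  have h1 : ∀ᶠ y in 𝓝 (G x), H y ∈ V :=
    hH.continuousAt.eventually (hHx.symm ▸ hV.mem_nhds hx)
  filter_upwards [h1, hGH] with y hy1 hy2
  exact ⟨H y, hy1, hy2⟩

theorem contMDiffOn_invFunOn [Nonempty X] {G : X → Y} {W : Set X} (hW : IsOpen W)
    (hG : ContMDiffOn (𝓡 n) (𝓡 n) ∞ G W)
    (himm : ∀ x ∈ W, Function.Injective (mfderiv (𝓡 n) (𝓡 n) G x)) (hinj : InjOn G W) :
    ContMDiffOn (𝓡 n) (𝓡 n) ∞ (Function.invFunOn G W) (G '' W) := by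
  rintro _ ⟨x, hx, rfl⟩
  obtain ⟨H, hH, hHx, hGH⟩ := exists_contMDiffAt_rightInverse
    (hG.contMDiffAt (hW.mem_nhds hx)) (himm x hx)
  refine (hH.congr_of_eventuallyEq ?_).contMDiffWithinAt
  have h1 : ∀ᶠ y in 𝓝 (G x), H y ∈ W :=
    hH.continuousAt.eventually (hHx.symm ▸ hW.mem_nhds hx)
  filter_upwards [h1, hGH] with y hy1 hy2
  have hy : y ∈ G '' W := ⟨H y, hy1, hy2⟩
  exact hinj (Function.invFunOn_mem hy) hy1 ((Function.invFunOn_eq hy).trans hy2.symm)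

end Inverse

section Distortion

variable {n : ℕ}
  {X : Type*} [TopologicalSpace X] [ChartedSpace (EuclideanSpace ℝ (Fin n)) X]
  [RiemannianBundle (fun x : X => TangentSpace (𝓡 n) x)]
  {Y : Type*} [TopologicalSpace Y] [ChartedSpace (EuclideanSpace ℝ (Fin n)) Y]
  [RiemannianBundle (fun x : Y => TangentSpace (𝓡 n) x)]

variable (n) in
/-- `G` restricts to a smooth embedding of the open set `W` whose differential changes lengths by
factors strictly between `c⁻¹` and `c`. Between manifolds of equal dimension, an injective
immersion is an open embedding. -/
structure IsQuasiIsometryOn (c : ℝ≥0) (G : X → Y) (W : Set X) : Prop where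
  isOpen : IsOpen W
  contMDiffOn : ContMDiffOn (𝓡 n) (𝓡 n) ∞ G W
  injOn : InjOn G W
  distortionLT : ∀ x ∈ W, DistortionLT n c G x

variable {c : ℝ≥0} {G : X → Y} {W : Set X}

theorem IsQuasiIsometryOn.mdifferentiableAt (h : IsQuasiIsometryOn n c G W) {x : X} (hx : x ∈ W) :
    MDifferentiableAt (𝓡 n) (𝓡 n) G x :=
  (h.contMDiffOn.contMDiffAt (h.isOpen.mem_nhds hx)).mdifferentiableAt (by simp)

variable [IsManifold (𝓡 n) ∞ X] [IsManifold (𝓡 n) ∞ Y]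

theorem IsQuasiIsometryOn.isOpen_image (h : IsQuasiIsometryOn n c G W) {V : Set X}
    (hV : IsOpen V) (hVW : V ⊆ W) : IsOpen (G '' V) :=
  isOpen_image_of_injective_mfderiv h.isOpen h.contMDiffOn
    (fun x hx => (h.distortionLT x hx).injective) hV hVW

theorem IsQuasiIsometryOn.contMDiffOn_inverse [Nonempty X] (h : IsQuasiIsometryOn n c G W) :
    ContMDiffOn (𝓡 n) (𝓡 n) ∞ (Function.invFunOn G W) (G '' W) :=
  contMDiffOn_invFunOn h.isOpen h.contMDiffOn (fun x hx => (h.distortionLT x hx).injective) h.injOn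

theorem IsQuasiIsometryOn.inverse [Nonempty X] (h : IsQuasiIsometryOn n c G W) :
    IsQuasiIsometryOn n c (Function.invFunOn G W) (G '' W) := by
  have hopen := h.isOpen_image h.isOpen subset_rfl
  refine ⟨hopen, h.contMDiffOn_inverse, (Function.invFunOn_injOn_image G W), fun y hy v hv => ?_⟩
  let H := Function.invFunOn G W
  have hHy : H y ∈ W := Function.invFunOn_mem hy
  have hGHy : G (H y) = y := Function.invFunOn_eq hy
  have hH : MDifferentiableAt (𝓡 n) (𝓡 n) H y :=
    (h.contMDiffOn_inverse.contMDiffAt (hopen.mem_nhds hy)).mdifferentiableAt (by simp)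
  have h1 : HasMFDerivAt (𝓡 n) (𝓡 n) (G ∘ H) y
      ((mfderiv (𝓡 n) (𝓡 n) G (H y)).comp (mfderiv (𝓡 n) (𝓡 n) H y)) :=
    HasMFDerivAt.comp y (h.mdifferentiableAt hHy).hasMFDerivAt hH.hasMFDerivAt
  have h2 : HasMFDerivAt (𝓡 n) (𝓡 n) (G ∘ H) y
      (ContinuousLinearMap.id ℝ (TangentSpace (𝓡 n) y)) := by
    refine (hasMFDerivAt_id y).congr_of_eventuallyEq ?_
    filter_upwards [hopen.mem_nhds hy] with w hw using Function.invFunOn_eq hw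
  have h3 : mfderiv (𝓡 n) (𝓡 n) G (H y) (mfderiv (𝓡 n) (𝓡 n) H y v) = v :=
    congr($(hasMFDerivAt_unique h1 h2) v)
  have h4 : ‖mfderiv (𝓡 n) (𝓡 n) G (H y) (mfderiv (𝓡 n) (𝓡 n) H y v)‖ = ‖v‖ := by
    refine (norm_tangentSpace_congr hGHy _).trans ?_
    exact congrArg (fun v : TangentSpace (𝓡 n) y => ‖v‖) h3
  have hne : mfderiv (𝓡 n) (𝓡 n) H y v ≠ 0 := by
    intro h0
    rw [h0, map_zero, norm_zero] at h4
    exact hv (norm_eq_zero.1 h4.symm)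
  have h5 := h.distortionLT (H y) hHy _ hne
  rw [h4] at h5
  exact ⟨h5.2, h5.1⟩

end Distortion

section Measure

variable {n : ℕ}
  {X : Type*} [MetricSpace X] [MeasurableSpace X] [BorelSpace X]
    [ChartedSpace (EuclideanSpace ℝ (Fin n)) X]
  [RiemannianBundle (fun x : X => TangentSpace (𝓡 n) x)] [IsRiemannianManifold (𝓡 n) X]
  {Y : Type*} [MetricSpace Y] [MeasurableSpace Y] [BorelSpace Y]
    [ChartedSpace (EuclideanSpace ℝ (Fin n)) Y]
  [RiemannianBundle (fun x : Y => TangentSpace (𝓡 n) x)] [IsRiemannianManifold (𝓡 n) Y]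

theorem euclideanHausdorffMeasure_image_le_of_norm_mfderiv_le {c : ℝ≥0} {G : X → Y} {W : Set X}
    (hW : IsOpen W) (hG : ContMDiffOn (𝓡 n) (𝓡 n) 1 G W)
    (hc : ∀ x ∈ W, ∀ u : TangentSpace (𝓡 n) x, ‖mfderiv (𝓡 n) (𝓡 n) G x u‖ ≤ c * ‖u‖)
    {S : Set X} (hS : S ⊆ W) (d : ℕ) : μHE[d] (G '' S) ≤ (c : ℝ≥0∞) ^ d * μHE[d] S := by
  have := secondCountableTopology_of_isRiemannianManifold X n
  refine euclideanHausdorffMeasure_image_le_of_locally (fun x hx => ?_) d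
  obtain ⟨V, hV, -, hL⟩ := exists_lipschitzOnWith_of_norm_mfderiv_le hW hG hc (hS hx)
  exact ⟨V, hV, hL.mono inter_subset_left⟩

theorem IsQuasiIsometryOn.euclideanHausdorffMeasure_image_le {c : ℝ≥0} {G : X → Y} {W : Set X}
    (h : IsQuasiIsometryOn n c G W) {S : Set X} (hS : S ⊆ W) (d : ℕ) :
    μHE[d] (G '' S) ≤ (c : ℝ≥0∞) ^ d * μHE[d] S := by
  refine euclideanHausdorffMeasure_image_le_of_norm_mfderiv_le h.isOpen
    (h.contMDiffOn.of_le (by simp)) (fun x hx u => ?_) hS d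
  rcases eq_or_ne u 0 with rfl | hu
  · simp
  · exact (h.distortionLT x hx u hu).1.le

theorem IsQuasiIsometryOn.euclideanHausdorffMeasure_le_image
    [IsManifold (𝓡 n) ∞ X] [IsManifold (𝓡 n) ∞ Y] {c : ℝ≥0} {G : X → Y} {W : Set X}
    (h : IsQuasiIsometryOn n c G W) {S : Set X} (hS : S ⊆ W) (d : ℕ) :
    μHE[d] S ≤ (c : ℝ≥0∞) ^ d * μHE[d] (G '' S) := by
  rcases S.eq_empty_or_nonempty with rfl | ⟨x, hx⟩
  · simp
  have : Nonempty X := ⟨x⟩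
  have h1 := h.inverse.euclideanHausdorffMeasure_image_le (image_mono hS) d
  rwa [(h.injOn.invFunOn_image hS)] at h1

end Measure

section Domains

variable {n : ℕ}
  {X : Type*} [MetricSpace X] [ChartedSpace (EuclideanSpace ℝ (Fin n)) X] [IsManifold (𝓡 n) ∞ X]
  [RiemannianBundle (fun x : X => TangentSpace (𝓡 n) x)]
  {Y : Type*} [MetricSpace Y] [ChartedSpace (EuclideanSpace ℝ (Fin n)) Y] [IsManifold (𝓡 n) ∞ Y]
  [RiemannianBundle (fun x : Y => TangentSpace (𝓡 n) x)]

theorem IsQuasiIsometryOn.frontier_image {c : ℝ≥0} {G : X → Y} {W : Set X}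
    (h : IsQuasiIsometryOn n c G W) {D : Set X} (hD : IsOpen D) (hDc : IsCompact (closure D))
    (hDW : closure D ⊆ W) :
    closure (G '' D) = G '' closure D ∧ frontier (G '' D) = G '' frontier D := by
  have hcont : ContinuousOn G (closure D) := h.contMDiffOn.continuousOn.mono hDW
  have h1 : closure (G '' D) = G '' closure D := by
    refine Subset.antisymm ?_ hcont.image_closure
    exact closure_minimal (image_mono subset_closure) (hDc.image_of_continuousOn hcont).isClosed
  refine ⟨h1, ?_⟩
  rw [frontier, (h.isOpen_image hD (subset_closure.trans hDW)).interior_eq, h1, frontier,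
    hD.interior_eq, (h.injOn.mono hDW).image_sdiff_subset subset_closure]

/-- Smooth embeddings map smooth domains to smooth domains. -/
theorem IsSmoothDomain.image {c : ℝ≥0} {G : X → Y} {W : Set X}
    (h : IsQuasiIsometryOn n c G W) {D : Set X} (hD : IsSmoothDomain n D)
    (hDW : closure D ⊆ W) : IsSmoothDomain n (G '' D) := by
  obtain ⟨hDo, hDc, hDf⟩ := hD
  obtain ⟨h1, h2⟩ := h.frontier_image hDo hDc hDW
  refine ⟨h.isOpen_image hDo (subset_closure.trans hDW), ?_, ?_⟩
  · rw [h1]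
    exact hDc.image_of_continuousOn (h.contMDiffOn.continuousOn.mono hDW)
  rw [h2]
  rintro _ ⟨x, hx, rfl⟩
  have : Nonempty X := ⟨x⟩
  obtain ⟨U, f, hU, hxU, hf, hfx, hfD⟩ := hDf x hx
  have hxW : x ∈ W := hDW (frontier_subset_closure hx)
  let H := Function.invFunOn G W
  have hHG : ∀ w ∈ W, H (G w) = w := fun w hw => h.injOn.leftInvOn_invFunOn hw
  have hopen : IsOpen (G '' (U ∩ W)) := h.isOpen_image (hU.inter h.isOpen) inter_subset_right
  have hfH : ContMDiffOn (𝓡 n) 𝓘(ℝ, ℝ) ∞ (f ∘ H) (G '' (U ∩ W)) := by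
    refine hf.comp (h.contMDiffOn_inverse.mono (image_mono inter_subset_right)) ?_
    rintro _ ⟨w, hw, rfl⟩
    rw [mem_preimage, hHG w hw.2]
    exact hw.1
  refine ⟨G '' (U ∩ W), f ∘ H, hopen, ⟨x, ⟨hxU, hxW⟩, rfl⟩, hfH, fun h0 => hfx ?_, ?_⟩
  · have h3 : mfderiv (𝓡 n) 𝓘(ℝ, ℝ) ((f ∘ H) ∘ G) x = 0 := by
      rw [mfderiv_comp x ((hfH.contMDiffAt (hopen.mem_nhds ⟨x, ⟨hxU, hxW⟩, rfl⟩)).mdifferentiableAt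
        (by simp)) (h.mdifferentiableAt hxW), h0]
      exact ContinuousLinearMap.zero_comp _
    have h4 : f =ᶠ[𝓝 x] (f ∘ H) ∘ G := by
      filter_upwards [h.isOpen.mem_nhds hxW] with w hw
      simp only [Function.comp]
      rw [hHG w hw]
    exact h4.mfderiv_eq.trans h3
  · rintro _ ⟨w, hw, rfl⟩
    rw [Function.comp, hHG w hw.2, ← hfD w hw.1]
    exact h.injOn.mem_image_iff (subset_closure.trans hDW) hw.2

end Domains

end Embedding

/-! ### Spheres and balls in Euclidean space -/

section Euclidean

open scoped RealInnerProductSpace Pointwise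

/-- The inverse stereographic projection from `v` maps a disc of the hyperplane `v^⊥` onto the
hemisphere opposite to `v`. -/
theorem hemisphere_subset_stereoInvFunAux_image {E : Type*} [NormedAddCommGroup E]
    [InnerProductSpace ℝ E] {v : E} (hv : ‖v‖ = 1) :
    {x ∈ Metric.sphere (0 : E) 1 | ⟪v, x⟫ ≤ 0} ⊆
      stereoInvFunAux v '' (Subtype.val '' Metric.closedBall (0 : (ℝ ∙ v)ᗮ) 2) := by
  rintro x ⟨hx, hvx⟩
  have hx1 : ‖x‖ = 1 := by simpa using hx
  have hne : x ≠ v := by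
    rintro rfl
    rw [real_inner_self_eq_norm_sq, hx1] at hvx
    norm_num at hvx
  have h1 := stereo_left_inv hv (x := ⟨x, hx⟩) hne
  refine ⟨stereoToFun v x, mem_image_of_mem _ ?_, congrArg Subtype.val h1⟩
  rw [mem_closedBall_zero_iff, stereoToFun_apply, norm_smul, innerSL_apply_apply]
  have h2 : ‖(ℝ ∙ v)ᗮ.orthogonalProjectionOnto x‖ ≤ 1 := by
    refine ((ℝ ∙ v)ᗮ.norm_orthogonalProjectionOnto_apply_le x).trans hx1.le
  have h3 : ‖2 / (1 - ⟪v, x⟫)‖ ≤ 2 := by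
    rw [Real.norm_eq_abs, abs_of_nonneg (div_nonneg zero_le_two (by linarith))]
    exact div_le_self zero_le_two (by linarith)
  nlinarith [norm_nonneg ((ℝ ∙ v)ᗮ.orthogonalProjectionOnto x), norm_nonneg (2 / (1 - ⟪v, x⟫))]

theorem euclideanHausdorffMeasure_hemisphere_lt_top {n : ℕ} {v : EuclideanSpace ℝ (Fin n)}
    (hv : ‖v‖ = 1) :
    μHE[n - 1] {x ∈ Metric.sphere (0 : EuclideanSpace ℝ (Fin n)) 1 | ⟪v, x⟫ ≤ 0} < ⊤ := by
  have hv0 : v ≠ 0 := norm_ne_zero_iff.1 (hv ▸ one_ne_zero)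
  have hrank : Module.finrank ℝ (ℝ ∙ v)ᗮ = n - 1 := by
    have h1 := (ℝ ∙ v).finrank_add_finrank_orthogonal
    rw [finrank_span_singleton hv0, finrank_euclideanSpace_fin] at h1
    omega
  have hdisc : μHE[n - 1]
      (Subtype.val '' Metric.closedBall (0 : (ℝ ∙ v)ᗮ) 2 : Set (EuclideanSpace ℝ (Fin n))) < ⊤ := by
    rw [isometry_subtype_coe.euclideanHausdorffMeasure_image, ← hrank]
    exact (isCompact_closedBall _ _).measure_lt_top
  obtain ⟨C, hC⟩ : ∃ C : ℝ≥0, LipschitzOnWith C (stereoInvFunAux v)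
      (Metric.closedBall (0 : EuclideanSpace ℝ (Fin n)) 2) :=
    ((contDiff_stereoInvFunAux (v := v) (m := 1)).contDiffOn).exists_lipschitzOnWith one_ne_zero
      (convex_closedBall _ _) (isCompact_closedBall _ _)
  have hsub : (Subtype.val '' Metric.closedBall (0 : (ℝ ∙ v)ᗮ) 2 : Set (EuclideanSpace ℝ (Fin n)))
      ⊆ Metric.closedBall (0 : EuclideanSpace ℝ (Fin n)) 2 := by
    rintro _ ⟨w, hw, rfl⟩
    simpa using hw
  refine (measure_mono (hemisphere_subset_stereoInvFunAux_image hv)).trans_lt ?_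
  refine (LipschitzOnWith.euclideanHausdorffMeasure_image_le (hC.mono hsub) (n - 1)).trans_lt ?_
  exact ENNReal.mul_lt_top (ENNReal.pow_lt_top ENNReal.coe_lt_top) hdisc

theorem euclideanHausdorffMeasure_unitSphere_lt_top {n : ℕ} :
    μHE[n - 1] (Metric.sphere (0 : EuclideanSpace ℝ (Fin n)) 1) < ⊤ := by
  rcases (Metric.sphere (0 : EuclideanSpace ℝ (Fin n)) 1).eq_empty_or_nonempty with h | ⟨v, hv⟩
  · simp [h]
  have hv1 : ‖v‖ = 1 := by simpa using hv
  refine (measure_mono (t := {x ∈ Metric.sphere (0 : EuclideanSpace ℝ (Fin n)) 1 | ⟪v, x⟫ ≤ 0} ∪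
    {x ∈ Metric.sphere (0 : EuclideanSpace ℝ (Fin n)) 1 | ⟪-v, x⟫ ≤ 0}) fun x hx => ?_).trans_lt
      ((measure_union_le _ _).trans_lt (ENNReal.add_lt_top.2
        ⟨euclideanHausdorffMeasure_hemisphere_lt_top hv1,
          euclideanHausdorffMeasure_hemisphere_lt_top (by rwa [norm_neg])⟩))
  rcases le_total ⟪v, x⟫ 0 with h | h
  · exact Or.inl ⟨hx, h⟩
  · exact Or.inr ⟨hx, by rw [inner_neg_left]; linarith⟩

/-- The area of a Euclidean sphere of dimension at least one tends to `0` with its radius. -/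
theorem tendsto_euclideanHausdorffMeasure_sphere {n : ℕ} (hn : 2 ≤ n)
    (z : EuclideanSpace ℝ (Fin n)) :
    Tendsto (fun s => μHE[n - 1] (Metric.sphere z s)) (𝓝[>] 0) (𝓝 0) := by
  have h1 : ∀ s ∈ Ioi (0 : ℝ), ENNReal.ofReal (s ^ (n - 1)) *
      μHE[n - 1] (Metric.sphere (0 : EuclideanSpace ℝ (Fin n)) 1)
      = μHE[n - 1] (Metric.sphere z s) := by
    intro s hs
    have hs' : (0 : ℝ) < s := hs
    have h2 : Metric.sphere z s = (fun x => x + z) ''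
      (s • Metric.sphere (0 : EuclideanSpace ℝ (Fin n)) 1) := by
      rw [smul_sphere' hs'.ne']
      ext y
      simp [abs_of_pos hs', mem_sphere_iff_norm, sub_eq_add_neg]
    rw [h2, (isometry_add_right z).euclideanHausdorffMeasure_image,
      Measure.euclideanHausdorffMeasure_smul₀ _ hs'.ne', ENNReal.smul_def, smul_eq_mul]
    congr 1
    rw [ENNReal.ofReal_pow hs'.le, ENNReal.coe_pow]
    congr 1
    rw [ENNReal.ofReal, Real.nnnorm_of_nonneg hs'.le, Real.toNNReal_of_nonneg hs'.le]
  refine Tendsto.congr' (eventually_nhdsWithin_of_forall h1) ?_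
  have h3 : Tendsto (fun s : ℝ => ENNReal.ofReal (s ^ (n - 1))) (𝓝[>] 0) (𝓝 0) := by
    have : Continuous fun s : ℝ => ENNReal.ofReal (s ^ (n - 1)) :=
      ENNReal.continuous_ofReal.comp (continuous_pow _)
    have h4 := this.tendsto 0
    rw [zero_pow (by omega), ENNReal.ofReal_zero] at h4
    exact h4.mono_left nhdsWithin_le_nhds
  have h5 := ENNReal.Tendsto.mul_const h3
    (Or.inr (euclideanHausdorffMeasure_unitSphere_lt_top (n := n)).ne)
  rwa [zero_mul] at h5

end Euclidean

/-! ### Adding and removing small balls -/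

section Surgery

section Charts

variable {n : ℕ} {X : Type*} [TopologicalSpace X]
  {e : OpenPartialHomeomorph X (EuclideanSpace ℝ (Fin n))} {z : EuclideanSpace ℝ (Fin n)} {r s : ℝ}

theorem isCompact_symm_image_closedBall (hr : Metric.ball z r ⊆ e.target) (hsr : s < r) :
    IsCompact (e.symm '' Metric.closedBall z s) :=
  (isCompact_closedBall _ _).image_of_continuousOn
    (e.continuousOn_symm.mono ((Metric.closedBall_subset_ball hsr).trans hr))

theorem mem_symm_image_iff {A : Set (EuclideanSpace ℝ (Fin n))} (hA : A ⊆ e.target) {y : X}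
    (hy : y ∈ e.source) :
    y ∈ e.symm '' A ↔ e y ∈ A := by
  constructor
  · rintro ⟨w, hw, rfl⟩
    rwa [e.right_inv (hA hw)]
  · exact fun h => ⟨e y, h, e.left_inv hy⟩

theorem symm_image_subset_source {A : Set (EuclideanSpace ℝ (Fin n))} (hA : A ⊆ e.target) :
    e.symm '' A ⊆ e.source := by
  rintro _ ⟨w, hw, rfl⟩
  exact e.map_target (hA hw)

theorem symm_image_closedBall_diff {y : X}
    (hy : y ∈ e.symm '' Metric.closedBall z s) (hy' : y ∉ e.symm '' Metric.ball z s) :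
    y ∈ e.symm '' Metric.sphere z s := by
  obtain ⟨w, hw, rfl⟩ := hy
  refine ⟨w, ?_, rfl⟩
  rcases (Metric.mem_closedBall.1 hw).lt_or_eq with h | h
  · exact absurd ⟨w, h, rfl⟩ hy'
  · exact h

end Charts

variable {n : ℕ} {X : Type*} [MetricSpace X] [ChartedSpace (EuclideanSpace ℝ (Fin n)) X]

/-- The squared distance to `z` in a chart, minus `s ^ 2`, is a smooth defining function of the
coordinate sphere of radius `s` about `z`; so is its negative. -/
theorem mfderiv_sq_norm_chart_ne_zero {e : OpenPartialHomeomorph X (EuclideanSpace ℝ (Fin n))}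
    (he : e ∈ IsManifold.maximalAtlas (𝓡 n) ∞ X) (z : EuclideanSpace ℝ (Fin n)) {s σ : ℝ}
    (hs : 0 < s) (hσ : σ ≠ 0)
    {x : X} (hx : x ∈ e.source) (hxs : ‖e x - z‖ = s) :
    ContMDiffOn (𝓡 n) 𝓘(ℝ, ℝ) ∞ (fun y => σ * (‖e y - z‖ ^ 2 - s ^ 2)) e.source ∧
      mfderiv (𝓡 n) 𝓘(ℝ, ℝ) (fun y => σ * (‖e y - z‖ ^ 2 - s ^ 2)) x ≠ 0 := by
  let φ : EuclideanSpace ℝ (Fin n) → ℝ := fun w => σ * (‖w - z‖ ^ 2 - s ^ 2)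
  have hφ : ContDiff ℝ ∞ φ :=
    contDiff_const.mul (((contDiff_id.sub contDiff_const).norm_sq ℝ).sub contDiff_const)
  refine ⟨hφ.contMDiff.comp_contMDiffOn (contMDiffOn_of_mem_maximalAtlas he), fun h0 => ?_⟩
  have h1 : HasMFDerivAt (𝓡 n) 𝓘(ℝ, ℝ) (φ ∘ e) x
      ((mfderiv (𝓡 n) 𝓘(ℝ, ℝ) φ (e x)).comp (mfderiv (𝓡 n) (𝓡 n) e x)) :=
    HasMFDerivAt.comp x (hφ.contMDiff.mdifferentiable (by simp) (e x)).hasMFDerivAt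
      ((mdifferentiable_of_mem_maximalAtlas he).mdifferentiableAt hx).hasMFDerivAt
  have h2 : mfderiv (𝓡 n) 𝓘(ℝ, ℝ) φ (e x) (mfderiv (𝓡 n) (𝓡 n) e x
      (mfderiv (𝓡 n) (𝓡 n) e.symm (e x) (e x - z))) = 0 := by
    have h3 := h1.mfderiv.symm.trans h0
    exact congr($h3 (mfderiv (𝓡 n) (𝓡 n) e.symm (e x) (e x - z)))
  rw [mfderiv_mfderiv_symm he hx, mfderiv_eq_fderiv] at h2
  have h4 : HasFDerivAt φ (σ • (2 • (innerSL ℝ (e x - z)))) (e x) := by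
    have h5 := (((hasFDerivAt_id (𝕜 := ℝ) (e x)).sub_const z).norm_sq.sub_const (s ^ 2)).const_mul σ
    simpa using h5
  have h6 : fderiv ℝ φ (e x) (e x - z) = σ * (2 * s ^ 2) := by
    rw [h4.fderiv]
    simp only [_root_.smul_apply, innerSL_apply_apply, real_inner_self_eq_norm_sq, hxs,
      smul_eq_mul, nsmul_eq_mul, Nat.cast_ofNat]
  have h7 : σ * (2 * s ^ 2) = 0 := h6.symm.trans h2
  have : (2 * s ^ 2) ≠ 0 := by positivity
  exact (mul_ne_zero hσ this) h7

variable {e : OpenPartialHomeomorph X (EuclideanSpace ℝ (Fin n))} {z : EuclideanSpace ℝ (Fin n)}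
  {r s : ℝ}

/-- Removing from a smooth domain a small closed ball contained in it. -/
theorem IsSmoothDomain.diff_closedBall (he : e ∈ IsManifold.maximalAtlas (𝓡 n) ∞ X) {D : Set X}
    (hD : IsSmoothDomain n D) (hr : Metric.ball z r ⊆ e.target)
    (hrD : e.symm '' Metric.ball z r ⊆ D) (hs : 0 < s) (hsr : s < r) :
    IsSmoothDomain n (D \ e.symm '' Metric.closedBall z s) ∧
      frontier (D \ e.symm '' Metric.closedBall z s)
        ⊆ frontier D ∪ e.symm '' Metric.sphere z s := by
  obtain ⟨hDo, hDc, hDf⟩ := hD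
  have hB : IsClosed (e.symm '' Metric.closedBall z s) :=
    (isCompact_symm_image_closedBall hr hsr).isClosed
  have hopen : IsOpen (D \ e.symm '' Metric.closedBall z s) := hDo.sdiff hB
  have hbo : IsOpen (e.symm '' Metric.ball z s) :=
    e.isOpen_image_symm_of_subset_target Metric.isOpen_ball
      ((Metric.ball_subset_ball hsr.le).trans hr)
  have hUo : IsOpen (e.symm '' Metric.ball z r) :=
    e.isOpen_image_symm_of_subset_target Metric.isOpen_ball hr
  have hsub : frontier (D \ e.symm '' Metric.closedBall z s)
      ⊆ (frontier D \ e.symm '' Metric.closedBall z s) ∪ e.symm '' Metric.sphere z s := by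
    intro y hy
    rw [frontier, hopen.interior_eq] at hy
    by_cases hyB : y ∈ e.symm '' Metric.closedBall z s
    · refine Or.inr (symm_image_closedBall_diff hyB fun hyb => ?_)
      obtain ⟨w, hw, hwD⟩ := mem_closure_iff.1 hy.1 _ hbo hyb
      exact hwD.2 (image_mono Metric.ball_subset_closedBall hw)
    · refine Or.inl ⟨?_, hyB⟩
      rw [frontier, hDo.interior_eq]
      exact ⟨closure_mono sdiff_subset hy.1, fun h => hy.2 ⟨h, hyB⟩⟩
  refine ⟨⟨hopen, hDc.of_isClosed_subset isClosed_closure (closure_mono sdiff_subset),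
    fun y hy => ?_⟩, hsub.trans (union_subset_union_left _ sdiff_subset)⟩
  rcases hsub hy with ⟨hyD, hyB⟩ | ⟨w, hw, rfl⟩
  · obtain ⟨U, f, hU, hyU, hf, hfy, hfD⟩ := hDf y hyD
    refine ⟨U ∩ (e.symm '' Metric.closedBall z s)ᶜ, f, hU.inter hB.isOpen_compl, ⟨hyU, hyB⟩,
      hf.mono inter_subset_left, hfy, fun u hu => ?_⟩
    rw [← hfD u hu.1]
    exact ⟨fun h => h.1, fun h => ⟨h, hu.2⟩⟩
  · have hwr : w ∈ Metric.ball z r := Metric.sphere_subset_closedBall.trans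
      (Metric.closedBall_subset_ball hsr) hw
    have hwe := e.map_target (hr hwr)
    obtain ⟨h1, h2⟩ := mfderiv_sq_norm_chart_ne_zero he z hs (σ := -1) (by norm_num) hwe
      (by rw [e.right_inv (hr hwr)]; exact mem_sphere_iff_norm.1 hw)
    refine ⟨e.symm '' Metric.ball z r, _, hUo, mem_image_of_mem _ hwr,
      h1.mono (symm_image_subset_source hr), h2, fun u hu => ?_⟩
    have hue := symm_image_subset_source hr hu
    have hmem := mem_symm_image_iff ((Metric.closedBall_subset_ball hsr).trans hr) hue
    rw [Set.mem_sdiff, hmem, mem_closedBall_iff_norm, not_le]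
    constructor
    · rintro ⟨-, h⟩
      nlinarith
    · intro h
      exact ⟨hrD hu, lt_of_pow_lt_pow_left₀ 2 (norm_nonneg _) (by linarith)⟩

/-- Adding to a smooth domain a small ball away from it. -/
theorem IsSmoothDomain.union_ball (he : e ∈ IsManifold.maximalAtlas (𝓡 n) ∞ X) {D : Set X}
    (hD : IsSmoothDomain n D) (hr : Metric.ball z r ⊆ e.target)
    (hrD : e.symm '' Metric.ball z r ⊆ (closure D)ᶜ) (hs : 0 < s) (hsr : s < r) :
    IsSmoothDomain n (D ∪ e.symm '' Metric.ball z s) ∧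
      closure (D ∪ e.symm '' Metric.ball z s) ⊆ closure D ∪ e.symm '' Metric.closedBall z s ∧
      frontier (D ∪ e.symm '' Metric.ball z s)
        ⊆ frontier D ∪ e.symm '' Metric.sphere z s := by
  obtain ⟨hDo, hDc, hDf⟩ := hD
  have hBc := isCompact_symm_image_closedBall hr hsr
  have hB : IsClosed (e.symm '' Metric.closedBall z s) := hBc.isClosed
  have hbo : IsOpen (e.symm '' Metric.ball z s) :=
    e.isOpen_image_symm_of_subset_target Metric.isOpen_ball
      ((Metric.ball_subset_ball hsr.le).trans hr)
  have hUo : IsOpen (e.symm '' Metric.ball z r) :=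
    e.isOpen_image_symm_of_subset_target Metric.isOpen_ball hr
  have hBr : e.symm '' Metric.closedBall z s ⊆ e.symm '' Metric.ball z r :=
    image_mono (Metric.closedBall_subset_ball hsr)
  have hcl : closure (D ∪ e.symm '' Metric.ball z s)
      ⊆ closure D ∪ e.symm '' Metric.closedBall z s := by
    rw [closure_union]
    exact union_subset_union_right _ (closure_minimal (image_mono Metric.ball_subset_closedBall) hB)
  have hsub : frontier (D ∪ e.symm '' Metric.ball z s)
      ⊆ frontier D ∪ e.symm '' Metric.sphere z s := by
    intro y hy
    rw [frontier, (hDo.union hbo).interior_eq] at hy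
    rcases hcl hy.1 with h | h
    · refine Or.inl ?_
      rw [frontier, hDo.interior_eq]
      exact ⟨h, fun h' => hy.2 (Or.inl h')⟩
    · exact Or.inr (symm_image_closedBall_diff h fun hyb => hy.2 (Or.inr hyb))
  refine ⟨⟨hDo.union hbo, (hDc.union hBc).of_isClosed_subset isClosed_closure hcl,
    fun y hy => ?_⟩, hcl, hsub⟩
  rcases hsub hy with hyD | ⟨w, hw, rfl⟩
  · obtain ⟨U, f, hU, hyU, hf, hfy, hfD⟩ := hDf y hyD
    have hyB : y ∉ e.symm '' Metric.closedBall z s := fun h =>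
      hrD (hBr h) (frontier_subset_closure hyD)
    refine ⟨U ∩ (e.symm '' Metric.closedBall z s)ᶜ, f, hU.inter hB.isOpen_compl, ⟨hyU, hyB⟩,
      hf.mono inter_subset_left, hfy, fun u hu => ?_⟩
    rw [← hfD u hu.1]
    exact ⟨fun h => h.resolve_right fun h' =>
      hu.2 (image_mono Metric.ball_subset_closedBall h'), Or.inl⟩
  · have hwr : w ∈ Metric.ball z r := Metric.sphere_subset_closedBall.trans
      (Metric.closedBall_subset_ball hsr) hw
    have hwe := e.map_target (hr hwr)
    obtain ⟨h1, h2⟩ := mfderiv_sq_norm_chart_ne_zero he z hs (σ := 1) (by norm_num) hwe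
      (by rw [e.right_inv (hr hwr)]; exact mem_sphere_iff_norm.1 hw)
    refine ⟨e.symm '' Metric.ball z r, _, hUo, mem_image_of_mem _ hwr,
      h1.mono (symm_image_subset_source hr), h2, fun u hu => ?_⟩
    have hue := symm_image_subset_source hr hu
    have hmem := mem_symm_image_iff ((Metric.ball_subset_ball hsr.le).trans hr) hue
    rw [mem_union, hmem, mem_ball_iff_norm]
    constructor
    · rintro (h | h)
      · exact absurd (subset_closure h) (hrD hu)
      · nlinarith [norm_nonneg (e u - z)]
    · intro h
      exact Or.inr (lt_of_pow_lt_pow_left₀ 2 hs.le (by linarith))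

end Surgery

/-! ### Coordinate balls of prescribed volume -/

section Balls

section Composition

variable {n : ℕ}
  {X : Type*} [TopologicalSpace X] [ChartedSpace (EuclideanSpace ℝ (Fin n)) X]
  [RiemannianBundle (fun x : X => TangentSpace (𝓡 n) x)]
  {Y : Type*} [TopologicalSpace Y] [ChartedSpace (EuclideanSpace ℝ (Fin n)) Y]
  [RiemannianBundle (fun x : Y => TangentSpace (𝓡 n) x)]
  {Z : Type*} [TopologicalSpace Z] [ChartedSpace (EuclideanSpace ℝ (Fin n)) Z]
  [RiemannianBundle (fun x : Z => TangentSpace (𝓡 n) x)]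

theorem IsQuasiIsometryOn.mono {c : ℝ≥0} {G : X → Y} {W V : Set X}
    (h : IsQuasiIsometryOn n c G W) (hV : IsOpen V) (hVW : V ⊆ W) : IsQuasiIsometryOn n c G V :=
  ⟨hV, h.contMDiffOn.mono hVW, h.injOn.mono hVW, fun x hx => h.distortionLT x (hVW hx)⟩

theorem IsQuasiIsometryOn.comp {c d : ℝ≥0} {G : Y → Z} {F : X → Y} {W : Set Y} {V : Set X}
    (hG : IsQuasiIsometryOn n c G W) (hF : IsQuasiIsometryOn n d F V) (hFV : MapsTo F V W) :
    IsQuasiIsometryOn n (c * d) (G ∘ F) V := by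
  refine ⟨hF.isOpen, hG.contMDiffOn.comp hF.contMDiffOn hFV, hG.injOn.comp hF.injOn hFV,
    fun x hx u hu => ?_⟩
  have h1 : mfderiv (𝓡 n) (𝓡 n) (G ∘ F) x u
      = mfderiv (𝓡 n) (𝓡 n) G (F x) (mfderiv (𝓡 n) (𝓡 n) F x u) := by
    rw [mfderiv_comp x (hG.mdifferentiableAt (hFV hx)) (hF.mdifferentiableAt hx)]
    rfl
  have h2 := hF.distortionLT x hx u hu
  have h3 : mfderiv (𝓡 n) (𝓡 n) F x u ≠ 0 := fun h0 =>
    hu ((hF.distortionLT x hx).injective (h0.trans (map_zero _).symm))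
  have h4 := hG.distortionLT (F x) (hFV hx) _ h3
  rw [h1, NNReal.coe_mul]
  constructor
  · calc _ < c * ‖mfderiv (𝓡 n) (𝓡 n) F x u‖ := h4.1
      _ ≤ c * (d * ‖u‖) := by gcongr; exact h2.1.le
      _ = c * d * ‖u‖ := by ring
  · calc _ < d * ‖mfderiv (𝓡 n) (𝓡 n) F x u‖ := h2.2
      _ ≤ d * (c * ‖mfderiv (𝓡 n) (𝓡 n) G (F x) (mfderiv (𝓡 n) (𝓡 n) F x u)‖) := by
        gcongr; exact h4.2.le
      _ = c * d * _ := by ring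

/-- Around every point, the inverse of a chart has bounded distortion on a small ball. -/
theorem exists_isQuasiIsometryOn_chart_symm [IsManifold (𝓡 n) ∞ X]
    [IsContinuousRiemannianBundle (EuclideanSpace ℝ (Fin n))
      (fun x : X => TangentSpace (𝓡 n) x)] {x : X} {O : Set X} (hO : O ∈ 𝓝 x) :
    ∃ r > 0, ∃ C : ℝ≥0,
      Metric.ball (chartAt (EuclideanSpace ℝ (Fin n)) x x) r ⊆
        (chartAt (EuclideanSpace ℝ (Fin n)) x).target ∧
      (chartAt (EuclideanSpace ℝ (Fin n)) x).symm '' Metric.ball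
        (chartAt (EuclideanSpace ℝ (Fin n)) x x) r
        ⊆ O ∧
      IsQuasiIsometryOn n C (chartAt (EuclideanSpace ℝ (Fin n)) x).symm
        (Metric.ball (chartAt (EuclideanSpace ℝ (Fin n)) x x) r) := by
  let e := chartAt (EuclideanSpace ℝ (Fin n)) x
  have hx : x ∈ e.source := mem_chart_source _ x
  have he : e ∈ IsManifold.maximalAtlas (𝓡 n) ∞ X := IsManifold.chart_mem_maximalAtlas x
  have h1 : e.target ∩ e.symm ⁻¹' O ∈ 𝓝 (e x) := by
    refine inter_mem (e.open_target.mem_nhds (e.map_source hx)) ?_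
    refine (e.continuousAt_symm (e.map_source hx)).preimage_mem_nhds ?_
    rwa [e.left_inv hx]
  obtain ⟨r, hr, hrO⟩ := Metric.nhds_basis_closedBall.mem_iff.1 h1
  have hsub : Metric.ball (e x) r ⊆ e.target := fun w hw =>
    (hrO (Metric.ball_subset_closedBall hw)).1
  obtain ⟨C, hC, hb⟩ := exists_chartNorm_bounds he (isCompact_closedBall (e x) r)
    (fun w hw => (hrO hw).1)
  refine ⟨r, hr, ⟨C + 1, by positivity⟩, hsub, ?_, Metric.isOpen_ball,
    (contMDiffOn_symm_of_mem_maximalAtlas he).mono hsub,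
    e.symm.injOn.mono hsub, fun z hz u hu => ?_⟩
  · rintro _ ⟨w, hw, rfl⟩
    exact (hrO (Metric.ball_subset_closedBall hw)).2
  have h2 := hb z (Metric.ball_subset_closedBall hz) u
  have h3 : ‖u‖ = ‖(show EuclideanSpace ℝ (Fin n) from u)‖ := norm_tangentSpace_vectorSpace
  have h4 : 0 < ‖u‖ := norm_pos_iff.2 hu
  rw [← h3] at h2
  have h5 : ‖mfderiv (𝓡 n) (𝓡 n) e.symm z u‖ = chartNorm e z u := rfl
  have h6 : 0 < chartNorm e z u := by
    by_contra h0
    nlinarith [h2.2]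
  rw [h5]
  change chartNorm e z u < (C + 1) * ‖u‖ ∧ ‖u‖ < (C + 1) * chartNorm e z u
  constructor <;> nlinarith [h2.1, h2.2]

end Composition

/-- The volume of the image of a ball depends continuously on the radius, and so takes all
intermediate values. -/
theorem IsQuasiIsometryOn.exists_euclideanHausdorffMeasure_image_closedBall_eq {n : ℕ} (hn : n ≠ 0)
    {Y : Type*} [MetricSpace Y] [MeasurableSpace Y] [BorelSpace Y]
    [ChartedSpace (EuclideanSpace ℝ (Fin n)) Y]
    [RiemannianBundle (fun x : Y => TangentSpace (𝓡 n) x)] [IsRiemannianManifold (𝓡 n) Y]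
    {C : ℝ≥0} {H : EuclideanSpace ℝ (Fin n) → Y} {z : EuclideanSpace ℝ (Fin n)} {r s₀ : ℝ}
    (h : IsQuasiIsometryOn n C H (Metric.ball z r)) (hs : 0 ≤ s₀) (hsr : s₀ < r) {w : ℝ≥0∞}
    (hw : w ≠ 0) (hw' : w ≤ μHE[n] (H '' Metric.closedBall z s₀)) :
    ∃ s, 0 < s ∧ s ≤ s₀ ∧ μHE[n] (H '' Metric.closedBall z s) = w := by
  let b : ℝ := (C : ℝ) ^ n * (volume (Metric.ball (0 : EuclideanSpace ℝ (Fin n)) 1)).toReal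
  have hball : ∀ s, 0 ≤ s → volume (Metric.closedBall z s)
      = ENNReal.ofReal (s ^ n) * volume (Metric.ball (0 : EuclideanSpace ℝ (Fin n)) 1) := by
    intro s h0
    rw [Measure.addHaar_closedBall _ _ h0, finrank_euclideanSpace_fin]
  have hle : ∀ S ⊆ Metric.ball z r, μHE[n] (H '' S) ≤ (C : ℝ≥0∞) ^ n * volume S := fun S hS => by
    have := h.euclideanHausdorffMeasure_image_le hS n
    rwa [EuclideanSpace.euclideanHausdorffMeasure_eq_volume] at this
  have hsub : ∀ {s}, s ≤ s₀ → Metric.closedBall z s ⊆ Metric.ball z r := fun h0 =>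
    Metric.closedBall_subset_ball (h0.trans_lt hsr)
  have hfin : ∀ s ≤ s₀, μHE[n] (H '' Metric.closedBall z s) ≠ ⊤ := fun s h0 =>
    ((hle _ (hsub h0)).trans_lt (ENNReal.mul_lt_top (by finiteness)
      measure_closedBall_lt_top)).ne
  let κ : ℝ → ℝ := fun s => (μHE[n] (H '' Metric.closedBall z s)).toReal
  have hmono : ∀ s t, s ≤ t → t ≤ s₀ → κ s ≤ κ t := fun s t hst ht =>
    ENNReal.toReal_mono (hfin t ht)
      (measure_mono (image_mono (Metric.closedBall_subset_closedBall hst)))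
  have hlip : ∀ s t, 0 ≤ s → s ≤ t → t ≤ s₀ → κ t - κ s ≤ b * t ^ n - b * s ^ n := by
    intro s t h0 hst ht
    have h1 : μHE[n] (H '' Metric.closedBall z t) ≤ μHE[n] (H '' Metric.closedBall z s)
        + (C : ℝ≥0∞) ^ n * volume (Metric.closedBall z t \ Metric.closedBall z s) := by
      calc _ ≤ μHE[n] (H '' Metric.closedBall z s
            ∪ H '' (Metric.closedBall z t \ Metric.closedBall z s)) := by
            rw [← image_union, union_sdiff_self]
            exact measure_mono (image_mono subset_union_right)
        _ ≤ _ := (measure_union_le _ _).trans (by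
            gcongr
            exact hle _ (sdiff_subset.trans (hsub ht)))
    have h2 : (volume (Metric.closedBall z t \ Metric.closedBall z s)).toReal
        = (t ^ n - s ^ n) * (volume (Metric.ball (0 : EuclideanSpace ℝ (Fin n)) 1)).toReal := by
      rw [measure_sdiff (Metric.closedBall_subset_closedBall hst)
        Metric.isClosed_closedBall.measurableSet.nullMeasurableSet measure_closedBall_lt_top.ne,
        ENNReal.toReal_sub_of_le (measure_mono (Metric.closedBall_subset_closedBall hst))
          measure_closedBall_lt_top.ne, hball t (h0.trans hst), hball s h0, ENNReal.toReal_mul,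
        ENNReal.toReal_mul, ENNReal.toReal_ofReal (pow_nonneg (h0.trans hst) n),
        ENNReal.toReal_ofReal (pow_nonneg h0 n)]
      ring
    have h4 : volume (Metric.closedBall z t \ Metric.closedBall z s) ≠ ⊤ :=
      ((measure_mono sdiff_subset).trans_lt measure_closedBall_lt_top).ne
    have h3 := ENNReal.toReal_mono (ENNReal.add_ne_top.2 ⟨hfin s (hst.trans ht),
      ENNReal.mul_ne_top (by finiteness) h4⟩) h1
    rw [ENNReal.toReal_add (hfin s (hst.trans ht)) (ENNReal.mul_ne_top (by finiteness) h4),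
      ENNReal.toReal_mul, h2, ENNReal.toReal_pow, ENNReal.coe_toReal] at h3
    simp only [κ, b]
    linarith
  have hcont : ContinuousOn κ (Icc 0 s₀) := by
    intro s hs'
    have h1 : Tendsto (fun t => |b * t ^ n - b * s ^ n|) (𝓝[Icc 0 s₀] s) (𝓝 0) := by
      have : Continuous fun t : ℝ => |b * t ^ n - b * s ^ n| := by fun_prop
      simpa using (this.tendsto s).mono_left nhdsWithin_le_nhds
    rw [ContinuousWithinAt, tendsto_iff_dist_tendsto_zero]
    refine squeeze_zero' (Eventually.of_forall fun t => dist_nonneg) ?_ h1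
    filter_upwards [self_mem_nhdsWithin] with t ht
    rw [Real.dist_eq]
    rcases le_total s t with hst | hst
    · rw [abs_of_nonneg (sub_nonneg.2 (hmono s t hst ht.2))]
      exact (hlip s t hs'.1 hst ht.2).trans (le_abs_self _)
    · rw [abs_sub_comm, abs_of_nonneg (sub_nonneg.2 (hmono t s hst hs'.2)), abs_sub_comm]
      exact (hlip t s ht.1 hst hs'.2).trans (le_abs_self _)
  have hκ0 : κ 0 = 0 := by
    have h1 := hle _ (hsub hs)
    rw [hball 0 le_rfl, zero_pow hn, ENNReal.ofReal_zero, zero_mul, mul_zero,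
      nonpos_iff_eq_zero] at h1
    simp only [κ, h1, ENNReal.toReal_zero]
  have hwtop : w ≠ ⊤ := ne_top_of_le_ne_top (hfin s₀ le_rfl) hw'
  obtain ⟨s, hs', hsw⟩ := intermediate_value_Icc hs hcont
    (show w.toReal ∈ Icc (κ 0) (κ s₀) from
      ⟨hκ0.le.trans ENNReal.toReal_nonneg, ENNReal.toReal_mono (hfin s₀ le_rfl) hw'⟩)
  refine ⟨s, hs'.1.lt_of_ne ?_, hs'.2, (ENNReal.toReal_eq_toReal_iff' (hfin s hs'.2) hwtop).1 hsw⟩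
  rintro rfl
  rw [hκ0] at hsw
  exact (ENNReal.toReal_pos hw hwtop).ne hsw

end Balls

/-! ### Comparison of profiles through quasi-isometries close to isometries -/

section Comparison

section Dense

variable {n : ℕ} {X : Type*} [TopologicalSpace X] [ChartedSpace (EuclideanSpace ℝ (Fin n)) X]

theorem mfderiv_eq_zero_of_isLocalMax {f : X → ℝ} {x : X} (h : IsLocalMax f x) :
    mfderiv (𝓡 n) 𝓘(ℝ, ℝ) f x = 0 := by
  by_cases hf : MDifferentiableAt (𝓡 n) 𝓘(ℝ, ℝ) f x
  swap
  · exact mfderiv_zero_of_not_mdifferentiableAt hf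
  have h1 : IsLocalMax (f ∘ (extChartAt (𝓡 n) x).symm) (extChartAt (𝓡 n) x x) := by
    refine IsLocalMax.comp_continuous ?_ (continuousAt_extChartAt_symm x)
    rwa [extChartAt_to_inv]
  have h2 : fderiv ℝ (writtenInExtChartAt (𝓡 n) 𝓘(ℝ, ℝ) x f) (extChartAt (𝓡 n) x x) = 0 :=
    IsLocalMax.fderiv_eq_zero h1
  have h3 : fderivWithin ℝ (writtenInExtChartAt (𝓡 n) 𝓘(ℝ, ℝ) x f) (range (𝓡 n))
      (extChartAt (𝓡 n) x x) = 0 := by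
    rwa [ModelWithCorners.range_eq_univ, fderivWithin_univ]
  exact hf.mfderiv.trans h3

end Dense

section

variable {n : ℕ} {X : Type*} [MetricSpace X] [ChartedSpace (EuclideanSpace ℝ (Fin n)) X]

/-- A dense smooth domain has no boundary: at a boundary point, a defining function would have a
local maximum. -/
theorem IsSmoothDomain.eq_univ_of_dense {D : Set X} (hD : IsSmoothDomain n D) (hd : Dense D) :
    D = univ := by
  obtain ⟨hDo, -, hDf⟩ := hD
  rcases (frontier D).eq_empty_or_nonempty with h | ⟨x, hx⟩
  · rw [frontier, hDo.interior_eq, hd.closure_eq, sdiff_eq_empty] at h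
    exact univ_subset_iff.1 h
  obtain ⟨U, f, hU, hxU, hf, hfx, hfD⟩ := hDf x hx
  refine absurd (mfderiv_eq_zero_of_isLocalMax ?_) hfx
  have h1 : ∀ y ∈ U, f y ≤ 0 := by
    intro y hy
    by_contra! h0
    have h2 : ∀ᶠ w in 𝓝 y, 0 < f w :=
      (hf.continuousOn.continuousAt (hU.mem_nhds hy)).eventually (lt_mem_nhds h0)
    obtain ⟨w, hwD, hw, hwU⟩ := mem_closure_iff_frequently.1 (hd y) |>.and_eventually
      (h2.and (hU.mem_nhds hy)) |>.exists
    exact ((hfD w hwU).1 hwD).not_gt hw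
  have h3 : f x = 0 := by
    refine le_antisymm (h1 x hxU) (not_lt.1 fun h => ?_)
    rw [frontier, hDo.interior_eq] at hx
    exact hx.2 ((hfD x hxU).2 h)
  filter_upwards [hU.mem_nhds hxU] with y hy
  rw [h3]
  exact h1 y hy

end

theorem tendsto_coe_pow_mul (k : ℕ) (a : ℝ≥0∞) :
    Tendsto (fun c : ℝ≥0 => (c : ℝ≥0∞) ^ k * a) (𝓝[>] 1) (𝓝 a) := by
  have h1 : Tendsto (fun c : ℝ≥0 => ((c ^ k : ℝ≥0) : ℝ≥0∞)) (𝓝[>] 1) (𝓝 ((1 ^ k : ℝ≥0) : ℝ≥0∞)) :=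
    ENNReal.tendsto_coe.2 ((continuous_pow k).tendsto 1 |>.mono_left nhdsWithin_le_nhds)
  have h2 := ENNReal.Tendsto.mul_const (b := a) h1 (Or.inl (by simp))
  simpa using h2

section Spheres

variable {n : ℕ}
  {X : Type*} [MetricSpace X] [MeasurableSpace X] [BorelSpace X]
    [ChartedSpace (EuclideanSpace ℝ (Fin n)) X]
  [RiemannianBundle (fun x : X => TangentSpace (𝓡 n) x)] [IsRiemannianManifold (𝓡 n) X]

theorem IsQuasiIsometryOn.eventually_area_image_sphere_le (hn : 2 ≤ n) {C : ℝ≥0}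
    {H : EuclideanSpace ℝ (Fin n) → X}
    {z : EuclideanSpace ℝ (Fin n)} {r : ℝ} (h : IsQuasiIsometryOn n C H (Metric.ball z r))
    (hr : 0 < r) {ε : ℝ≥0∞}
    (hε : ε ≠ 0) :
    ∀ᶠ s in 𝓝[>] (0 : ℝ), s < r ∧ area n (H '' Metric.sphere z s) ≤ ε := by
  have h1 := ENNReal.Tendsto.const_mul (a := (C : ℝ≥0∞) ^ (n - 1))
    (tendsto_euclideanHausdorffMeasure_sphere hn z) (Or.inr (by finiteness))
  rw [mul_zero] at h1
  filter_upwards [h1.eventually (gt_mem_nhds (pos_iff_ne_zero.2 hε)),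
    mem_nhdsWithin_of_mem_nhds (gt_mem_nhds hr)] with s hs hsr
  refine ⟨hsr, (h.euclideanHausdorffMeasure_image_le ?_ _).trans hs.le⟩
  exact Metric.sphere_subset_closedBall.trans (Metric.closedBall_subset_ball hsr)

theorem IsQuasiIsometryOn.euclideanHausdorffMeasure_image_closedBall_ne_zero
    [IsManifold (𝓡 n) ∞ X] {C : ℝ≥0} {H : EuclideanSpace ℝ (Fin n) → X}
    {z : EuclideanSpace ℝ (Fin n)} {r s : ℝ} (h : IsQuasiIsometryOn n C H (Metric.ball z r))
    (hs : 0 < s) (hsr : s < r) :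
    μHE[n] (H '' Metric.closedBall z s) ≠ 0 := by
  intro h0
  have h1 := h.euclideanHausdorffMeasure_le_image (Metric.closedBall_subset_ball hsr) n
  rw [h0, mul_zero, EuclideanSpace.euclideanHausdorffMeasure_eq_volume] at h1
  exact ((Metric.measure_closedBall_pos volume z hs).trans_le h1).ne rfl

end Spheres

variable {n : ℕ}
  {X : Type*} [MetricSpace X] [MeasurableSpace X] [BorelSpace X]
    [ChartedSpace (EuclideanSpace ℝ (Fin n)) X]
  [IsManifold (𝓡 n) ∞ X]
  [RiemannianBundle (fun x : X => TangentSpace (𝓡 n) x)] [IsRiemannianManifold (𝓡 n) X]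
  {Y : Type*} [MetricSpace Y] [MeasurableSpace Y] [BorelSpace Y]
    [ChartedSpace (EuclideanSpace ℝ (Fin n)) Y]
  [IsManifold (𝓡 n) ∞ Y]
  [RiemannianBundle (fun x : Y => TangentSpace (𝓡 n) x)] [IsRiemannianManifold (𝓡 n) Y]

theorem IsQuasiIsometryOn.isoperimetricProfile_le {c : ℝ≥0} {G : X → Y} {W D : Set X}
    (h : IsQuasiIsometryOn n c G W) (hD : IsSmoothDomain n D) (hDW : closure D ⊆ W) {v : ℝ≥0∞}
    (hv : vol n (G '' D) = v) :
    isoperimetricProfile n Y v ≤ (c : ℝ≥0∞) ^ (n - 1) * area n (frontier D) := by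
  refine (iInf₂_le_of_le (G '' D) (IsSmoothDomain.image h hD hDW) (iInf_le _ hv)).trans ?_
  rw [(h.frontier_image hD.1 hD.2.1 hDW).2]
  exact h.euclideanHausdorffMeasure_image_le (frontier_subset_closure.trans hDW) _

/-- A smooth domain `D` of `X` is transplanted to `Y` by a quasi-isometry `G` whose distortion `c`
is close to `1`. Its volume changes a little; this is corrected by removing a small coordinate ball
inside `D`, or by adding one outside, at the cost of a small boundary area `ε`. -/
theorem IsSmoothDomain.eventually_isoperimetricProfile_le
    [IsContinuousRiemannianBundle (EuclideanSpace ℝ (Fin n)) (fun x : X => TangentSpace (𝓡 n) x)]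
    (hn : 2 ≤ n) {D : Set X} (hD : IsSmoothDomain n D) (hv0 : vol n D ≠ 0)
    (hv : vol n D < vol n (univ : Set X)) {ε : ℝ≥0∞} (hε : ε ≠ 0) :
    ∀ᶠ c in 𝓝[>] (1 : ℝ≥0),
      (∀ K : Set X, IsCompact K → ∃ (G : X → Y) (W : Set X), K ⊆ W ∧ IsQuasiIsometryOn n c G W) →
      isoperimetricProfile n Y (vol n D)
        ≤ (c : ℝ≥0∞) ^ (n - 1) * (area n (frontier D) + ε) := by
  have hn0 : n ≠ 0 := by omega
  have : Nontrivial (EuclideanSpace ℝ (Fin n)) := by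
    have : Nonempty (Fin n) := ⟨⟨0, by omega⟩⟩
    infer_instance
  obtain ⟨x, hx⟩ : D.Nonempty := nonempty_iff_ne_empty.2 fun h => hv0 (by simp [h, vol])
  obtain ⟨y, hy⟩ : ∃ y, y ∉ closure D := by
    by_contra! h
    exact hv.ne (congrArg _ (hD.eq_univ_of_dense h))
  have hvtop : vol n D ≠ ⊤ := hv.ne_top
  obtain ⟨r₁, hr₁, C₁, hrt₁, hrD₁, hq₁⟩ := exists_isQuasiIsometryOn_chart_symm (n := n)
    (hD.1.mem_nhds hx)
  obtain ⟨r₂, hr₂, C₂, hrt₂, hrD₂, hq₂⟩ :=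
    exists_isQuasiIsometryOn_chart_symm (n := n) (isClosed_closure.isOpen_compl.mem_nhds hy)
  have he₁ : chartAt (EuclideanSpace ℝ (Fin n)) x ∈ IsManifold.maximalAtlas (𝓡 n) ∞ X :=
    IsManifold.chart_mem_maximalAtlas x
  have he₂ : chartAt (EuclideanSpace ℝ (Fin n)) y ∈ IsManifold.maximalAtlas (𝓡 n) ∞ X :=
    IsManifold.chart_mem_maximalAtlas y
  set e₁ := chartAt (EuclideanSpace ℝ (Fin n)) x
  set e₂ := chartAt (EuclideanSpace ℝ (Fin n)) y
  set z₁ := e₁ x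
  set z₂ := e₂ y
  -- coordinate spheres of radius at most `s₀` about `x` and `y` have area at most `ε`
  obtain ⟨s₀, hs₀, hs₀'⟩ := mem_nhdsGT_iff_exists_Ioc_subset.1
    ((hq₁.eventually_area_image_sphere_le hn hr₁ hε).and
      (hq₂.eventually_area_image_sphere_le hn hr₂ hε))
  rw [mem_Ioi] at hs₀
  have hsr₁ : s₀ < r₁ := (hs₀' ⟨hs₀, le_rfl⟩).1.1
  have hsr₂ : s₀ < r₂ := (hs₀' ⟨hs₀, le_rfl⟩).2.1
  let B₁ : ℝ → Set X := fun s => e₁.symm '' Metric.closedBall z₁ s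
  let B₂ : ℝ → Set X := fun s => e₂.symm '' Metric.closedBall z₂ s
  have ha₁ : vol n (B₁ s₀) ≠ 0 := hq₁.euclideanHausdorffMeasure_image_closedBall_ne_zero hs₀ hsr₁
  have ha₂ : vol n (B₂ s₀) ≠ 0 := hq₂.euclideanHausdorffMeasure_image_closedBall_ne_zero hs₀ hsr₂
  have hBD₁ : ∀ s ≤ s₀, B₁ s ⊆ D := fun s hs =>
    (image_mono (Metric.closedBall_subset_ball (hs.trans_lt hsr₁))).trans hrD₁
  have hBD₂ : ∀ s ≤ s₀, Disjoint D (B₂ s) := fun s hs =>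
    (disjoint_compl_right.mono_right
      ((image_mono (Metric.closedBall_subset_ball (hs.trans_lt hsr₂))).trans hrD₂)).mono_left
      subset_closure
  have hBc₁ : ∀ s ≤ s₀, IsCompact (B₁ s) := fun s hs =>
    isCompact_symm_image_closedBall hrt₁ (hs.trans_lt hsr₁)
  have hBc₂ : ∀ s ≤ s₀, IsCompact (B₂ s) := fun s hs =>
    isCompact_symm_image_closedBall hrt₂ (hs.trans_lt hsr₂)
  -- for `c` close to `1`, the image of `D` with the largest ball removed, respectively added, has
  -- volume at most, respectively at least, that of `D`
  have hev₁ : ∀ᶠ c : ℝ≥0 in 𝓝[>] 1, (c : ℝ≥0∞) ^ n * (vol n D - vol n (B₁ s₀)) < vol n D :=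
    (tendsto_coe_pow_mul n _).eventually (gt_mem_nhds (ENNReal.sub_lt_self hvtop hv0 ha₁))
  have hev₂ : ∀ᶠ c : ℝ≥0 in 𝓝[>] 1, (c : ℝ≥0∞) ^ n * vol n D < vol n D + vol n (B₂ s₀) :=
    (tendsto_coe_pow_mul n _).eventually (gt_mem_nhds (ENNReal.lt_add_right hvtop ha₂))
  filter_upwards [hev₁, hev₂, self_mem_nhdsWithin] with c hc₁ hc₂ hc hG
  -- `G` is required on a ball slightly larger than the balls that may be added
  obtain ⟨t, hst, htr⟩ := exists_between hsr₂
  obtain ⟨G, W, hKW, hGW⟩ := hG (closure D ∪ B₂ t)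
    (hD.2.1.union (isCompact_symm_image_closedBall hrt₂ htr))
  have hDW : closure D ⊆ W := subset_union_left.trans hKW
  have hBW : B₂ t ⊆ W := subset_union_right.trans hKW
  have hGm : ∀ K : Set X, IsCompact K → K ⊆ W → MeasurableSet (G '' K) := fun K hK hKW =>
    (hK.image_of_continuousOn (hGW.contMDiffOn.continuousOn.mono hKW)).measurableSet
  have hdisj : ∀ A B : Set X, A ⊆ W → B ⊆ W → Disjoint A B → Disjoint (G '' A) (G '' B) :=
    fun A B hA hB hAB => disjoint_image_image fun a ha b hb hab =>
      disjoint_left.1 hAB ha (hGW.injOn (hA ha) (hB hb) hab ▸ hb)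
  have hc0 : (c : ℝ≥0∞) ^ n ≠ 0 := by
    have : c ≠ 0 := (zero_lt_one.trans hc).ne'
    positivity
  have hfin : vol n (G '' D) ≠ ⊤ :=
    ((hGW.euclideanHausdorffMeasure_image_le (subset_closure.trans hDW) n).trans_lt
      (ENNReal.mul_lt_top (by finiteness) hvtop.lt_top)).ne
  have hle : ∀ D' : Set X, IsSmoothDomain n D' → closure D' ⊆ W → vol n (G '' D') = vol n D →
      (∃ S, area n S ≤ ε ∧ frontier D' ⊆ frontier D ∪ S) →
      isoperimetricProfile n Y (vol n D)
        ≤ (c : ℝ≥0∞) ^ (n - 1) * (area n (frontier D) + ε) := by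
    rintro D' hD' hD'W hvol ⟨S, hS, hfr⟩
    refine (hGW.isoperimetricProfile_le hD' hD'W hvol).trans ?_
    gcongr
    exact (measure_mono hfr).trans ((measure_union_le _ _).trans (add_le_add_right hS _))
  have hGq₁ : IsQuasiIsometryOn n (c * C₁) (G ∘ e₁.symm) (Metric.ball z₁ r₁) :=
    hGW.comp hq₁ (mapsTo_iff_image_subset.2 (hrD₁.trans (subset_closure.trans hDW)))
  rcases lt_trichotomy (vol n (G '' D)) (vol n D) with hlt | heq | hgt
  · -- the volume is too small: add a ball
    have hBW₂ : ∀ s ≤ s₀, B₂ s ⊆ W := fun s hs =>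
      (image_mono (Metric.closedBall_subset_closedBall (hs.trans hst.le))).trans hBW
    have h1 : vol n D ≤ vol n (G '' D) + vol n (G '' B₂ s₀) := by
      have h2 := hGW.euclideanHausdorffMeasure_le_image
        (union_subset (subset_closure.trans hDW) (hBW₂ s₀ le_rfl)) n
      rw [measure_union (hBD₂ s₀ le_rfl) (hBc₂ s₀ le_rfl).measurableSet, image_union] at h2
      exact (ENNReal.mul_le_mul_iff_right hc0 (by finiteness)).1 (hc₂.le.trans (h2.trans
        (mul_le_mul_right (measure_union_le _ _) _)))
    have hGq₂ : IsQuasiIsometryOn n (c * C₂) (G ∘ e₂.symm) (Metric.ball z₂ t) :=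
      hGW.comp (hq₂.mono Metric.isOpen_ball (Metric.ball_subset_ball htr.le))
        (mapsTo_iff_image_subset.2 ((image_mono Metric.ball_subset_closedBall).trans hBW))
    obtain ⟨s, hs, hss, hw⟩ := hGq₂.exists_euclideanHausdorffMeasure_image_closedBall_eq hn0 hs₀.le
      hst (w := vol n D - vol n (G '' D)) (tsub_pos_of_lt hlt).ne' (by
        rw [image_comp, tsub_le_iff_left]
        exact h1)
    rw [image_comp] at hw
    obtain ⟨hD', hcl, hfr⟩ := hD.union_ball he₂ hrt₂ hrD₂ hs (hss.trans_lt hsr₂)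
    refine hle _ hD' (hcl.trans (union_subset hDW (hBW₂ s hss))) ?_
      ⟨_, (hs₀' ⟨hs, hss⟩).2.2, hfr⟩
    -- the open ball has the same volume as the closed one, spheres being null sets
    have hnull : vol n (G '' (e₂.symm '' Metric.sphere z₂ s)) = 0 := by
      have h2 := hGq₂.euclideanHausdorffMeasure_image_le (S := Metric.sphere z₂ s)
        (Metric.sphere_subset_closedBall.trans (Metric.closedBall_subset_ball (hss.trans_lt hst))) n
      rw [EuclideanSpace.euclideanHausdorffMeasure_eq_volume, Measure.addHaar_sphere, mul_zero,
        image_comp] at h2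
      exact nonpos_iff_eq_zero.1 h2
    have hopen : vol n (G '' (e₂.symm '' Metric.ball z₂ s)) = vol n (G '' B₂ s) := by
      refine le_antisymm (measure_mono (image_mono (image_mono Metric.ball_subset_closedBall))) ?_
      simp only [B₂]
      rw [← Metric.ball_union_sphere, image_union, image_union]
      refine (measure_union_le _ _).trans ?_
      rw [← vol, ← vol, hnull, add_zero]
    have hbo : IsOpen (e₂.symm '' Metric.ball z₂ s) :=
      e₂.isOpen_image_symm_of_subset_target Metric.isOpen_ball
        ((Metric.ball_subset_ball (hss.trans hsr₂.le)).trans hrt₂)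
    have hbB : e₂.symm '' Metric.ball z₂ s ⊆ B₂ s := image_mono Metric.ball_subset_closedBall
    have hbW : e₂.symm '' Metric.ball z₂ s ⊆ W := hbB.trans (hBW₂ s hss)
    rw [image_union, vol, measure_union (hdisj _ _ (subset_closure.trans hDW) hbW
      ((hBD₂ s hss).mono_right hbB)) (hGW.isOpen_image hbo hbW).measurableSet, ← vol, ← vol, hopen,
      ← add_tsub_cancel_of_le hlt.le]
    exact congrArg (vol n (G '' D) + ·) hw
  · exact hle D hD hDW heq ⟨∅, by simp [area], by simp⟩
  · -- the volume is too large: remove a ball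
    have hsplit : ∀ s ≤ s₀, vol n (G '' D) = vol n (G '' (D \ B₁ s)) + vol n (G '' B₁ s) := by
      intro s hs
      have hBW₁ : B₁ s ⊆ W := (hBD₁ s hs).trans (subset_closure.trans hDW)
      rw [vol, vol, vol, ← measure_union ?_ (hGm _ (hBc₁ s hs) hBW₁), ← image_union,
        sdiff_union_of_subset (hBD₁ s hs)]
      exact hdisj _ _ (sdiff_subset.trans (subset_closure.trans hDW)) hBW₁ disjoint_sdiff_left
    have h1 : vol n (G '' (D \ B₁ s₀)) ≤ vol n D := by
      refine (hGW.euclideanHausdorffMeasure_image_le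
        (sdiff_subset.trans (subset_closure.trans hDW)) n).trans ?_
      rw [measure_sdiff (hBD₁ s₀ le_rfl) (hBc₁ s₀ le_rfl).measurableSet.nullMeasurableSet
        (measure_ne_top_of_subset (hBD₁ s₀ le_rfl) hvtop)]
      exact hc₁.le
    obtain ⟨s, hs, hss, hw⟩ := hGq₁.exists_euclideanHausdorffMeasure_image_closedBall_eq hn0 hs₀.le
      hsr₁ (w := vol n (G '' D) - vol n D) (tsub_pos_of_lt hgt).ne' (by
        rw [image_comp, tsub_le_iff_left, hsplit s₀ le_rfl]
        exact add_le_add_left h1 _)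
    rw [image_comp] at hw
    obtain ⟨hD', hfr⟩ := hD.diff_closedBall he₁ hrt₁ hrD₁ hs (hss.trans_lt hsr₁)
    refine hle _ hD' ((closure_mono sdiff_subset).trans hDW) ?_ ⟨_, (hs₀' ⟨hs, hss⟩).1.2, hfr⟩
    have h2 := hsplit s hss
    have h3 : vol n (G '' D) = vol n D + vol n (G '' B₁ s) :=
      (add_tsub_cancel_of_le hgt.le).symm.trans (congrArg (vol n D + ·) hw.symm)
    rw [h3] at h2
    refine ((ENNReal.add_left_inj ?_).1 h2).symm
    exact measure_ne_top_of_subset (image_mono (hBD₁ s hss)) hfin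

variable (n X Y) in
/-- `X` embeds in `Y`, locally and with arbitrarily small distortion: for every compact subset `K`
of `X` and every `c > 1` there is a smooth embedding of a neighbourhood of `K` in `Y` which changes
lengths by factors between `c⁻¹` and `c`. -/
def HasAlmostIsometricEmbeddings : Prop :=
  ∀ c : ℝ≥0, 1 < c → ∀ K : Set X, IsCompact K →
    ∃ (G : X → Y) (W : Set X), K ⊆ W ∧ IsQuasiIsometryOn n c G W

theorem HasAlmostIsometricEmbeddings.vol_univ_le
    (h : HasAlmostIsometricEmbeddings n X Y) :
    vol n (univ : Set X) ≤ vol n (univ : Set Y) := by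
  have : SecondCountableTopology X := secondCountableTopology_of_isRiemannianManifold X n
  have : LocallyCompactSpace X := Manifold.locallyCompact_of_finiteDimensional (𝓡 n)
  rw [← iUnion_compactCovering X, vol,
    (show Monotone (compactCovering X) from fun _ _ => (compactCovering_subset X ·)).measure_iUnion]
  refine iSup_le fun i => ge_of_tendsto (tendsto_coe_pow_mul n (vol n (univ : Set Y))) ?_
  filter_upwards [self_mem_nhdsWithin] with c hc
  obtain ⟨G, W, hKW, hG⟩ := h c hc _ (isCompact_compactCovering X i)
  refine (hG.euclideanHausdorffMeasure_le_image hKW n).trans ?_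
  gcongr
  exact measure_mono (subset_univ _)

theorem HasAlmostIsometricEmbeddings.isoperimetricProfile_le
    [IsContinuousRiemannianBundle (EuclideanSpace ℝ (Fin n)) (fun x : X => TangentSpace (𝓡 n) x)]
    (hn : 2 ≤ n)
    (h : HasAlmostIsometricEmbeddings n X Y) {v : ℝ≥0∞} (hv : v < vol n (univ : Set X)) :
    isoperimetricProfile n Y v ≤ isoperimetricProfile n X v := by
  rcases eq_or_ne v 0 with rfl | hv0
  · refine le_trans ?_ (zero_le (a := isoperimetricProfile n X 0))
    refine (iInf₂_le_of_le (∅ : Set Y) (by simp [IsSmoothDomain])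
      (iInf_le _ (by simp [vol]))).trans ?_
    simp [area]
  refine le_iInf₂ fun D hD => le_iInf fun hvol => ?_
  subst hvol
  refine ENNReal.le_of_forall_pos_le_add fun ε hε _ => ?_
  refine ge_of_tendsto (tendsto_coe_pow_mul (n - 1) (area n (frontier D) + ε)) ?_
  filter_upwards [hD.eventually_isoperimetricProfile_le (Y := Y) hn hv0 hv
    (ENNReal.coe_ne_zero.2 hε.ne'), self_mem_nhdsWithin] with c hc hc1
  exact hc (h c hc1)

end Comparison

/-! ### Consequences of pointed convergence -/

section Pointed

/-- The length of an image vector, through the Gram matrix of the images of the basis vectors. -/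
theorem norm_sq_map_eq_sum_inner {n : ℕ} {V : Type*} [NormedAddCommGroup V] [InnerProductSpace ℝ V]
    (L : (EuclideanSpace ℝ (Fin n)) →ₗ[ℝ] V) (w : EuclideanSpace ℝ (Fin n)) :
    ‖L w‖ ^ 2 = ∑ a, ∑ b, w a * w b * inner ℝ (L (EuclideanSpace.single a (1 : ℝ)))
      (L (EuclideanSpace.single b (1 : ℝ))) := by
  have h1 : L w = ∑ a, w a • L (EuclideanSpace.single a (1 : ℝ)) := by
    have h2 := (EuclideanSpace.basisFun (Fin n) ℝ).sum_repr w
    conv_lhs => rw [← h2]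
    simp [map_sum]
  rw [← real_inner_self_eq_norm_sq, h1, sum_inner]
  refine Finset.sum_congr rfl fun a _ => ?_
  rw [inner_sum]
  refine Finset.sum_congr rfl fun b _ => ?_
  rw [real_inner_smul_left, real_inner_smul_right]
  ring

theorem norm_sq_mfderiv_eq_sum_metricCoeff {n : ℕ} {X : Type*} [TopologicalSpace X]
    [ChartedSpace (EuclideanSpace ℝ (Fin n)) X]
    [RiemannianBundle (fun x : X => TangentSpace (𝓡 n) x)]
    (ψ : EuclideanSpace ℝ (Fin n) → X) (y w : EuclideanSpace ℝ (Fin n)) :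
    ‖mfderiv (𝓡 n) (𝓡 n) ψ y w‖ ^ 2 = ∑ a, ∑ b, w a * w b * metricCoeff ψ a b y :=
  norm_sq_map_eq_sum_inner (V := TangentSpace (𝓡 n) (ψ y)) (mfderiv (𝓡 n) (𝓡 n) ψ y).toLinearMap w

theorem abs_norm_sq_mfderiv_sub_le {n : ℕ} {X : Type*} [TopologicalSpace X]
    [ChartedSpace (EuclideanSpace ℝ (Fin n)) X]
    [RiemannianBundle (fun x : X => TangentSpace (𝓡 n) x)]
    {Y : Type*} [TopologicalSpace Y]
    [ChartedSpace (EuclideanSpace ℝ (Fin n)) Y]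
    [RiemannianBundle (fun x : Y => TangentSpace (𝓡 n) x)]
    {ψ : EuclideanSpace ℝ (Fin n) → X} {χ : EuclideanSpace ℝ (Fin n) → Y}
    {y : EuclideanSpace ℝ (Fin n)} {ε : ℝ}
    (h : ∀ a b, |metricCoeff χ a b y - metricCoeff ψ a b y| ≤ ε) (w : EuclideanSpace ℝ (Fin n)) :
    |‖mfderiv (𝓡 n) (𝓡 n) χ y w‖ ^ 2 - ‖mfderiv (𝓡 n) (𝓡 n) ψ y w‖ ^ 2|
      ≤ n ^ 2 * ε * ‖w‖ ^ 2 := by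
  rw [norm_sq_mfderiv_eq_sum_metricCoeff, norm_sq_mfderiv_eq_sum_metricCoeff,
    ← Finset.sum_sub_distrib]
  have h1 : ∀ a b, |w a * w b * metricCoeff χ a b y - w a * w b * metricCoeff ψ a b y|
      ≤ ε * ‖w‖ ^ 2 := by
    intro a b
    rw [← mul_sub, abs_mul, abs_mul, mul_comm, sq]
    have ha : |w a| ≤ ‖w‖ := PiLp.norm_apply_le w a
    have hb : |w b| ≤ ‖w‖ := PiLp.norm_apply_le w b
    have h0 : 0 ≤ ε := (abs_nonneg _).trans (h a b)
    gcongr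
    exact h a b
  calc _ ≤ ∑ a : Fin n, ∑ b : Fin n, ε * ‖w‖ ^ 2 := by
        refine (Finset.abs_sum_le_sum_abs _ _).trans (Finset.sum_le_sum fun a _ => ?_)
        rw [← Finset.sum_sub_distrib]
        exact (Finset.abs_sum_le_sum_abs _ _).trans (Finset.sum_le_sum fun b _ => h1 a b)
    _ = _ := by
        simp only [Finset.sum_const, Finset.card_univ, Fintype.card_fin, nsmul_eq_mul]
        ring

theorem lt_mul_of_abs_sq_sub_le {a b c η : ℝ} (ha : 0 < a) (hb : 0 ≤ b) (hc : 0 ≤ c)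
    (h1 : 1 + η < c ^ 2) (h2 : 1 < c ^ 2 * (1 - η)) (h : |b ^ 2 - a ^ 2| ≤ η * a ^ 2) :
    b < c * a ∧ a < c * b := by
  rw [abs_le] at h
  have ha2 : 0 < a ^ 2 := by positivity
  constructor
  · refine lt_of_pow_lt_pow_left₀ 2 (by positivity) ?_
    rw [mul_pow]
    nlinarith [h.2]
  · refine lt_of_pow_lt_pow_left₀ 2 (by positivity) ?_
    rw [mul_pow]
    have : c ^ 2 * ((1 - η) * a ^ 2) ≤ c ^ 2 * b ^ 2 := by
      gcongr
      linarith [h.1]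
    nlinarith

variable {n : ℕ}
  {M : Type*} [MetricSpace M] [ChartedSpace (EuclideanSpace ℝ (Fin n)) M]
  [RiemannianBundle (fun x : M => TangentSpace (𝓡 n) x)]
  {N : Type*} [MetricSpace N] [ChartedSpace (EuclideanSpace ℝ (Fin n)) N] [IsManifold (𝓡 n) ∞ N]
  [RiemannianBundle (fun x : N => TangentSpace (𝓡 n) x)]
  [IsContinuousRiemannianBundle (EuclideanSpace ℝ (Fin n)) (fun x : N => TangentSpace (𝓡 n) x)]

/-- If the pulled back metrics converge on `Ω`, then the maps are eventually as close to isometries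
as desired on compact subsets of `Ω`. -/
theorem PullbackMetricsConvergeOn.eventually_distortionLT {m : ℕ} {α : ℝ} {F : ℕ → N → M}
    {Ω K : Set N} (h : PullbackMetricsConvergeOn n m α F Ω) (hΩ : IsOpen Ω)
    (hF : ∀ᶠ i in atTop, ContMDiffOn (𝓡 n) (𝓡 n) 1 (F i) Ω) (hK : IsCompact K) (hKΩ : K ⊆ Ω)
    {c : ℝ} (hc : 1 < c) : ∀ᶠ i in atTop, ∀ x ∈ K, DistortionLT n c (F i) x := by
  refine eventually_forall_mem_of_isCompact hK fun x hx => ?_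
  let e := chartAt (EuclideanSpace ℝ (Fin n)) x
  have hxe : x ∈ e.source := mem_chart_source _ x
  have he : e ∈ IsManifold.maximalAtlas (𝓡 n) ∞ N := IsManifold.chart_mem_maximalAtlas x
  have h1 : e.target ∩ e.symm ⁻¹' Ω ∈ 𝓝 (e x) := by
    refine inter_mem (e.open_target.mem_nhds (e.map_source hxe)) ?_
    refine (e.continuousAt_symm (e.map_source hxe)).preimage_mem_nhds ?_
    rw [e.left_inv hxe]
    exact hΩ.mem_nhds (hKΩ hx)
  obtain ⟨r, hr, hrΩ⟩ := Metric.nhds_basis_closedBall.mem_iff.1 h1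
  have hB := isCompact_closedBall (e x) r
  obtain ⟨C, hC, hb⟩ := exists_chartNorm_bounds he hB (fun w hw => (hrΩ hw).1)
  -- this choice makes both `1 + η < c ^ 2` and `1 < c ^ 2 * (1 - η)`
  let η := (c ^ 2 - 1) / (2 * c ^ 2)
  have hc2 : 1 < c ^ 2 := by nlinarith
  have hη : 0 < η := div_pos (by linarith) (by linarith)
  have hηc : η * (2 * c ^ 2) = c ^ 2 - 1 := div_mul_cancel₀ _ (by positivity)
  have hη1 : 1 + η < c ^ 2 := by nlinarith
  have hη2 : 1 < c ^ 2 * (1 - η) := by nlinarith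
  let ε := η / (n ^ 2 * C ^ 2 + 1)
  have hε : 0 < ε := by positivity
  have hεη : n ^ 2 * ε * C ^ 2 ≤ η := by
    have : ε * (n ^ 2 * C ^ 2 + 1) = η := div_mul_cancel₀ _ (by positivity)
    nlinarith
  have h2 : ∀ᶠ i in atTop, ∀ a b : Fin n, ∀ y ∈ Metric.closedBall (e x) r,
      |metricCoeff (F i ∘ e.symm) a b y - metricCoeff e.symm a b y| ≤ ε := by
    refine eventually_all.2 fun a => eventually_all.2 fun b => ?_
    obtain ⟨ν, hν⟩ := h e he _ hB (fun w hw => (hrΩ hw).1)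
      (image_subset_iff.2 fun w hw => (hrΩ hw).2) a b ε hε
    filter_upwards [eventually_ge_atTop ν] with i hi y hy
    have h3 := (hν i hi).1 0 (Nat.zero_le _) y hy
    rwa [norm_iteratedFDeriv_zero, Real.norm_eq_abs] at h3
  have h3 : ∀ᶠ x' in 𝓝 x, x' ∈ e.source ∧ e x' ∈ Metric.closedBall (e x) r ∧ x' ∈ Ω := by
    filter_upwards [e.open_source.mem_nhds hxe,
      (e.continuousAt hxe).preimage_mem_nhds (Metric.closedBall_mem_nhds _ hr),
      hΩ.mem_nhds (hKΩ hx)] with x' h1 h2 h3 using ⟨h1, h2, h3⟩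
  filter_upwards [(h2.and hF).prod_mk h3] with p hp u hu
  obtain ⟨⟨hp1, hp2⟩, hp3, hp4, hp5⟩ := hp
  generalize p.2 = x' at *
  generalize p.1 = i at *
  let w : EuclideanSpace ℝ (Fin n) := mfderiv (𝓡 n) (𝓡 n) e x' u
  have h4 : ‖mfderiv (𝓡 n) (𝓡 n) e.symm (e x') w‖ = ‖u‖ := chartNorm_mfderiv he hp3 u
  have h5 : ‖mfderiv (𝓡 n) (𝓡 n) (F i ∘ e.symm) (e x') w‖ = ‖mfderiv (𝓡 n) (𝓡 n) (F i) x' u‖ := by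
    have h6 : mfderiv (𝓡 n) (𝓡 n) (F i ∘ e.symm) (e x')
        = (mfderiv (𝓡 n) (𝓡 n) (F i) (e.symm (e x'))).comp
          (mfderiv (𝓡 n) (𝓡 n) e.symm (e x')) := by
      refine mfderiv_comp _ ?_ ((mdifferentiable_of_mem_maximalAtlas he).mdifferentiableAt_symm
        (e.map_source hp3))
      rw [e.left_inv hp3]
      exact (hp2.contMDiffAt (hΩ.mem_nhds hp5)).mdifferentiableAt one_ne_zero
    have h7 : mfderiv (𝓡 n) (𝓡 n) (F i ∘ e.symm) (e x') w
        = mfderiv (𝓡 n) (𝓡 n) (F i) (e.symm (e x')) u := by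
      rw [h6]
      exact congrArg _ (mfderiv_symm_mfderiv he hp3 u)
    rw [h7]
    exact congrArg
      (fun z : N => ‖mfderiv (𝓡 n) (𝓡 n) (F i) z (show EuclideanSpace ℝ (Fin n) from u)‖)
        (e.left_inv hp3)
  have h8 := abs_norm_sq_mfderiv_sub_le (fun a b => hp1 a b (e x') hp4) w
  rw [h4, h5] at h8
  have h9 : ‖w‖ ≤ C * ‖u‖ := (hb (e x') hp4 w).2.trans_eq (congrArg (C * ·) h4)
  refine lt_mul_of_abs_sq_sub_le (norm_pos_iff.2 hu) (norm_nonneg _) (by linarith) hη1 hη2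
    (h8.trans ?_)
  calc n ^ 2 * ε * ‖w‖ ^ 2 ≤ n ^ 2 * ε * (C * ‖u‖) ^ 2 := by gcongr
    _ = n ^ 2 * ε * C ^ 2 * ‖u‖ ^ 2 := by ring
    _ ≤ η * ‖u‖ ^ 2 := by gcongr

/-- Under pointed convergence, neighbourhoods of compact subsets of the limit embed smoothly in `M`
with distortion as close to `1` as desired: the embeddings that come with the convergence are only
finitely often differentiable, but having small distortion and being injective on a compact set are
conditions stable under small `C^1` perturbations, so that they can be smoothed. -/
theorem PointedConverges.exists_isQuasiIsometryOn [IsManifold (𝓡 n) ∞ M]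
    [IsContinuousRiemannianBundle (EuclideanSpace ℝ (Fin n)) (fun x : M => TangentSpace (𝓡 n) x)]
    {m : ℕ} {α : ℝ} {p : ℕ → M} {q : N} (h : PointedConverges n m α p q) {K : Set N}
    (hK : IsCompact K) {c : ℝ≥0} (hc : 1 < c) :
    ∃ (G : N → M) (W : Set N), K ⊆ W ∧ IsQuasiIsometryOn n c G W := by
  have : LocallyCompactSpace N := Manifold.locallyCompact_of_finiteDimensional (𝓡 n)
  obtain ⟨K', hK', hKK'⟩ := exists_compact_superset hK
  obtain ⟨R, hR, hKR⟩ := hK'.isBounded.subset_ball_lt 0 q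
  obtain ⟨Ω, hΩ, hRΩ, ν, F, hF, hpull⟩ := h R hR
  have hK'Ω := hKR.trans hRΩ
  have hF1 : ∀ i ≥ ν, ContMDiffOn (𝓡 n) (𝓡 n) 1 (F i) Ω := fun i hi =>
    (hF i hi).1.1.of_le (by exact_mod_cast Nat.le_add_left 1 m)
  obtain ⟨i, hi, hiν⟩ := ((hpull.eventually_distortionLT hΩ
    ((eventually_ge_atTop ν).mono hF1) hK' hK'Ω (c := c) (by exact_mod_cast hc)).and
    (eventually_ge_atTop ν)).exists
  have hinj : InjOn (F i) Ω := injOn_iff_injective.2 (hF i hiν).1.2.1.injective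
  let P : (N → M) → Prop := fun F => (∀ x ∈ K', DistortionLT n c F x) ∧ InjOn F K'
  have hP : IsC1Stable n Ω P := fun F hF hPF G hG =>
    (isC1Stable_distortionLT hΩ hK' hK'Ω c F hF hPF.1 G hG).and
      (eventually_injOn_of_tendstoC1At hΩ hK' hK'Ω hF hPF.2
        (fun x hx => (hPF.1 x hx).injective) hG)
  obtain ⟨G, hPG, -, S, hS, hKS, -, hGS⟩ := exists_smooth_of_isC1Stable hΩ hK' hK'Ω hP (hF1 i hiν)
    ⟨hi, hinj.mono hK'Ω⟩
  refine ⟨G, S ∩ interior K', subset_inter (hKK'.trans (interior_subset.trans hKS)) hKK',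
    hS.inter isOpen_interior, hGS.mono inter_subset_left,
    hPG.2.mono (inter_subset_right.trans interior_subset),
    fun x hx => hPG.1 x (interior_subset hx.2)⟩

end Pointed

theorem isContinuousRiemannianBundle_of_isContMDiffRiemannianBundle {n : ℕ} (k : ℕ∞ω) (X : Type*)
    [TopologicalSpace X] [ChartedSpace (EuclideanSpace ℝ (Fin n)) X] [IsManifold (𝓡 n) ∞ X]
    [RiemannianBundle (fun x : X => TangentSpace (𝓡 n) x)]
    [h : IsContMDiffRiemannianBundle (𝓡 n) k (EuclideanSpace ℝ (Fin n))
      (fun x : X => TangentSpace (𝓡 n) x)] :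
    IsContinuousRiemannianBundle (EuclideanSpace ℝ (Fin n))
      (fun x : X => TangentSpace (𝓡 n) x) := by
  obtain ⟨g, hg, hg'⟩ := h.exists_contMDiff
  exact ⟨g, hg.continuous, hg'⟩

end RiemannianIso

end

theorem mainTheorem7 (n : ℕ) (hn : 2 ≤ n) (m : ℕ) (hm : 1 ≤ m) (α : ℝ) (hα : α ∈ Set.Icc (0 : ℝ) 1)
    -- `M` is a complete smooth Riemannian manifold of dimension `n`
    (M : Type*) [MetricSpace M] [MeasurableSpace M] [BorelSpace M]
    [ChartedSpace (EuclideanSpace ℝ (Fin n)) M] [IsManifold (𝓡 n) ∞ M]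
    [RiemannianBundle (fun x : M => TangentSpace (𝓡 n) x)]
    [IsContMDiffRiemannianBundle (𝓡 n) ∞ (EuclideanSpace ℝ (Fin n))
      (fun x : M => TangentSpace (𝓡 n) x)]
    [IsRiemannianManifold (𝓡 n) M] [CompleteSpace M]
    -- `N`, the limit, is a complete smooth manifold of dimension `n` with a `C^m` Riemannian metric
    (N : Type*) [MetricSpace N] [MeasurableSpace N] [BorelSpace N]
    [ChartedSpace (EuclideanSpace ℝ (Fin n)) N] [IsManifold (𝓡 n) ∞ N]
    [RiemannianBundle (fun x : N => TangentSpace (𝓡 n) x)]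
    [IsContMDiffRiemannianBundle (𝓡 n) m (EuclideanSpace ℝ (Fin n))
      (fun x : N => TangentSpace (𝓡 n) x)]
    [IsRiemannianManifold (𝓡 n) N] [CompleteSpace N]
    (hK : RiemannianIso.BoundedSectionalCurvature n M)
    (hinj : 0 < RiemannianIso.injectivityRadius n M)
    (p : ℕ → M) (q : N) (hconv : RiemannianIso.PointedConverges n m α p q) :
    RiemannianIso.vol n (Set.univ : Set N) ≤ RiemannianIso.vol n (Set.univ : Set M) ∧
      ∀ v : ℝ≥0∞, v < RiemannianIso.vol n (Set.univ : Set N) →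
        RiemannianIso.isoperimetricProfile n M v ≤ RiemannianIso.isoperimetricProfile n N v := by
  have := RiemannianIso.isContinuousRiemannianBundle_of_isContMDiffRiemannianBundle (n := n) ∞ M
  have := RiemannianIso.isContinuousRiemannianBundle_of_isContMDiffRiemannianBundle (n := n) m N
  have h : RiemannianIso.HasAlmostIsometricEmbeddings n N M := fun _ hc _ hK =>
    hconv.exists_isQuasiIsometryOn hK hc
  exact ⟨h.vol_univ_le, fun v hv => h.isoperimetricProfile_le hn hv⟩
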